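/- Let $d\ge 1$ and let $S\subset\mathbb R^d$ be closed with $0\in S$ and $\overline{S^{\rm int}}=S$. Let $\mathfrak M$ be the space of configurations $\xi=\sum_i\delta_{x_i}$ (countable sums, $x_i\in S$, $\xi(K)<\infty$ for every compact $K$) with the vague topology and its Borel $\sigma$-algebra, and let $\mu$ be a probability measure on $\mathfrak M$. Put $U_r=\{x\in S:|x|\le r\}$ and $\pi_r(\xi)=\xi(\cdot\cap U_r)$. A function $f:\mathfrak M\to\mathbb R$ is called local smooth if it is $\sigma[\pi_r]$-measurable for some $r\in\mathbb N$ and if, for all $r,n$ and all $\xi$ with $\xi(U_r)=n$, the function $(x_1,\dots,x_n)\mapsto f\big(\sum_{j}\delta_{x_j}+\xi(\cdot\cap (S\setminus U_r))\big)$ is $C^\infty$ on $U_r^n$. Let $\nu(\xi,x;y)\ge 0$ be measurable on $\mathfrak M\times\mathbb R^d\times\mathbb R^d$. With $\xi^{xy}=\xi-\delta_x+\delta_y$ set $$\mathfrak E(f,g)=\frac12\int_{\mathfrak M}\mu(d\xi)\int\xi(dx)\int_S \{f(\xi^{xy})-f(\xi)\}\{g(\xi^{xy})-g(\xi)\}\,\nu(\xi,x;y)\,dy,$$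 $$\mathfrak D_\infty=\{f \text{ local smooth}: f\in L^2(\mathfrak M,\mu),\ \mathfrak E(f,f)<\infty\}.$$ Assume: (A.1) $(\mathfrak E,\mathfrak D_\infty)$ is closable on $L^2(\mathfrak M,\mu)$. (A.2) $\mu$ has density functions, i.e. permutation invariant integrable functions $\sigma_r^n:U_r^n\to[0,\infty)$ with $\frac1{n!}\int_{U_r^n}f(\sum_j\delta_{x_j})\,\sigma_r^n(x)\,dx=\int_{\{\xi(U_r)=n\}}f\,d\mu$ for all bounded $\sigma[\pi_r]$-measurable $f$, and for some $1<q\le\infty$, $\sigma_r^k\in L^q(U_r^k,dx)$ for all $k,r$. (B.0) There are a constant $C_1$ and a function $p$ on $(0,\infty)$, bounded on compact subsets of $(0,\infty)$, such that for $\mu$-a.e. $\xi$, every particle $x$ of $\xi$ and a.e. $y\in S$, $\nu(\xi,x;y)\le C_1\,p(|x-y|)$. (B.1) The 1-correlation function $\rho^1\geq 0$ of $\mu$ (that is, $\int_A\rho^1dx=\int\xi(A)\,\mu(d\xi)$ for all bounded measurable $A\subset S$) exists and $\rho^1(x)=O(|x|^\kappa)$ as $|x|\to\infty$ for some $\kappa\ge0$.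 (B.2) $p(r)=O(r^{-(d+\alpha)})$ as $r\to\infty$ for some $\alpha>\kappa$. (B.3) $p(r)=O(r^{-(d+\beta)})$ as $r\to+0$ for some $0<\beta<2$. (B.4) $\xi(U_r)$ has finite second moment for all $r$ and $\mathrm{Var}[\xi(U_r)]/(\mathbb E[\xi(U_r)])^2=O(r^{-\delta})$ as $r\to\infty$, $r\in\mathbb N$, for some $\delta>0$. Then the closure $(\mathfrak E,\mathfrak D)$ of $(\mathfrak E,\mathfrak D_\infty)$ is a quasi-regular (symmetric) Dirichlet form on $L^2(\mathfrak M,\mu)$. -/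

import Mathlib

open MeasureTheory Filter Topology Set
open scoped NNReal ENNReal ContDiff CompactlySupported

noncomputable section

namespace JumpForm

/-! ### Configurations -/

/-- The Euclidean space `ℝ^d`. -/
abbrev Space (d : ℕ) : Type := EuclideanSpace ℝ (Fin d)

/-- `m = ∑ i, δ_{x i}` is a countable sum of Dirac measures at points of `S`
(with multiplicities allowed), finite on compact sets. -/
structure IsConfig {d : ℕ} (S : Set (Space d)) (m : Measure (Space d)) : Prop where
  exists_sum : ∃ (I : Set ℕ) (x : ℕ → Space d), (∀ i ∈ I, x i ∈ S) ∧
    m = Measure.sum (fun i : I => Measure.dirac (x i))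
  finite : ∀ K : Set (Space d), IsCompact K → m K < (⊤ : ℝ≥0∞)

theorem IsConfig.restrict {d : ℕ} {S : Set (Space d)} {m : Measure (Space d)}
    (h : IsConfig S m) (A : Set (Space d)) : IsConfig S (m.restrict A) := by
  classical
  refine ⟨?_, fun K hK => (Measure.restrict_apply_le A K).trans_lt (h.finite K hK)⟩
  obtain ⟨I, x, hx, rfl⟩ := h.exists_sum
  refine ⟨{i ∈ I | x i ∈ A}, x, fun i hi => hx i hi.1, ?_⟩
  rw [Measure.restrict_sum_of_countable]
  ext s hs
  rw [Measure.sum_apply _ hs, Measure.sum_apply _ hs]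
  have e1 := tsum_subtype I (fun i : ℕ => ((Measure.dirac (x i)).restrict A) s)
  have e2 := tsum_subtype {i ∈ I | x i ∈ A} (fun i : ℕ => (Measure.dirac (x i)) s)
  rw [e1, e2]
  refine tsum_congr fun i => ?_
  by_cases hI : i ∈ I <;> by_cases hA : x i ∈ A <;>
    simp [Set.indicator, hI, hA, restrict_dirac]

/-- The configuration space `𝔐(S)`. -/
def Config {d : ℕ} (S : Set (Space d)) : Type := {m : Measure (Space d) // IsConfig S m}

/-- The vague topology: the coarsest one making `ξ ↦ ∫ φ dξ` continuous for every continuous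
compactly supported `φ`. -/
instance {d : ℕ} (S : Set (Space d)) : TopologicalSpace (Config S) :=
  TopologicalSpace.induced
    (fun (ξ : Config S) (φ : C_c(Space d, ℝ)) => ∫ x, φ x ∂ξ.1) inferInstance

/-- The Borel σ-algebra of the vague topology. -/
instance {d : ℕ} (S : Set (Space d)) : MeasurableSpace (Config S) := borel (Config S)

instance {d : ℕ} (S : Set (Space d)) : BorelSpace (Config S) := ⟨rfl⟩

/-- The configuration `ξ(· ∩ A)`. -/
def Config.restrict {d : ℕ} {S : Set (Space d)} (A : Set (Space d)) (ξ : Config S) : Config S :=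
  ⟨ξ.1.restrict A, ξ.2.restrict A⟩

/-- `U_r = {x ∈ S ; |x| ≤ r}`. -/
def U {d : ℕ} (S : Set (Space d)) (r : ℝ) : Set (Space d) := S ∩ Metric.closedBall 0 r

/-- The set `U_r^n`. -/
def UPow {d : ℕ} (S : Set (Space d)) (r : ℝ) (n : ℕ) : Set (Fin n → Space d) :=
  {x | ∀ j, x j ∈ U S r}

open Classical in
/-- The value of `f` at the configuration given by the measure `m`
(and `0` if `m` is not a configuration). -/
def valueAt {d : ℕ} {S : Set (Space d)} (f : Config S → ℝ) (m : Measure (Space d)) : ℝ :=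
  if h : IsConfig S m then f ⟨m, h⟩ else 0

/-! ### Local smooth functions -/

/-- The σ-algebra `σ[π_r]` generated by `π_r : ξ ↦ ξ(· ∩ U_r)`. -/
@[reducible] def localSigma {d : ℕ} (S : Set (Space d)) (r : ℝ) : MeasurableSpace (Config S) :=
  MeasurableSpace.comap (Config.restrict (S := S) (U S r)) inferInstance

/-- `f` is `σ[π_r]`-measurable for some natural number `r`. -/
def IsLocal {d : ℕ} {S : Set (Space d)} (f : Config S → ℝ) : Prop :=
  ∃ r : ℕ, Measurable[localSigma S r] f

open Classical in
/-- The `U_r^n`-representation `f_{r,ξ}^n` of `f`: the particles outside `U_r` are those of `ξ`,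
those inside are `x_1, …, x_n`; it vanishes unless `ξ(U_r) = n`. -/
def urep {d : ℕ} {S : Set (Space d)} (f : Config S → ℝ) (r : ℝ) (n : ℕ) (ξ : Config S)
    (x : Fin n → Space d) : ℝ :=
  if ξ.1 (U S r) = n then
    valueAt f ((∑ j, Measure.dirac (x j)) + ξ.1.restrict (S \ U S r)) else 0

/-- Local smooth functions (the space `𝔇_∘`). -/
def IsLocalSmooth {d : ℕ} {S : Set (Space d)} (f : Config S → ℝ) : Prop :=
  IsLocal f ∧ ∀ (r n : ℕ) (ξ : Config S), ContDiffOn ℝ ∞ (urep f r n ξ) (UPow S r n)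

/-! ### The bilinear form -/

/-- `f(ξ^{xy}) - f(ξ)` with `ξ^{xy} = ξ - δ_x + δ_y`. -/
def jumpDiff {d : ℕ} {S : Set (Space d)} (f : Config S → ℝ) (ξ : Config S)
    (x y : Space d) : ℝ :=
  valueAt f (ξ.1 - Measure.dirac x + Measure.dirac y) - f ξ

/-- The square field `𝔻[f, g](ξ)`. -/
def squareField {d : ℕ} {S : Set (Space d)} (ν : Config S → Space d → Space d → ℝ≥0)
    (f g : Config S → ℝ) (ξ : Config S) : ℝ :=
  (1 / 2) * ∫ x, (∫ y in S, jumpDiff f ξ x y * jumpDiff g ξ x y * (ν ξ x y : ℝ)) ∂ξ.1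

/-- `𝔈(f, g) = ∫ 𝔻[f, g] dμ`. -/
def preForm {d : ℕ} {S : Set (Space d)} (ν : Config S → Space d → Space d → ℝ≥0)
    (μ : Measure (Config S)) (f g : Config S → ℝ) : ℝ :=
  ∫ ξ, squareField ν f g ξ ∂μ

/-- `𝔈(f, f)` as an element of `[0, ∞]`, well defined for every `f`. -/
def energy {d : ℕ} {S : Set (Space d)} (ν : Config S → Space d → Space d → ℝ≥0)
    (μ : Measure (Config S)) (f : Config S → ℝ) : ℝ≥0∞ :=
  ∫⁻ ξ, (1 / 2) * ∫⁻ x, (∫⁻ y in S, ENNReal.ofReal (jumpDiff f ξ x y ^ 2) * (ν ξ x y : ℝ≥0∞))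
    ∂ξ.1 ∂μ

/-- `𝔇_∞`: the local smooth functions in `L²(𝔐, μ)` with `𝔈(f, f) < ∞`. -/
def preDomain {d : ℕ} {S : Set (Space d)} (ν : Config S → Space d → Space d → ℝ≥0)
    (μ : Measure (Config S)) : Set (Config S → ℝ) :=
  {f | IsLocalSmooth f ∧ MemLp f 2 μ ∧ energy ν μ f < (⊤ : ℝ≥0∞)}

/-- `s` is a sequence in `𝔇_∞` which is Cauchy for `𝔈`. -/
def IsCauchySeq {d : ℕ} {S : Set (Space d)} (ν : Config S → Space d → Space d → ℝ≥0)
    (μ : Measure (Config S)) (s : ℕ → Config S → ℝ) : Prop :=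
  (∀ n, s n ∈ preDomain ν μ) ∧
    ∀ ε : ℝ, 0 < ε → ∃ N, ∀ m ≥ N, ∀ n ≥ N, preForm ν μ (s m - s n) (s m - s n) < ε

/-- Closability of `(𝔈, 𝔇_∞)` on `L²(𝔐, μ)`. -/
def IsClosable {d : ℕ} {S : Set (Space d)} (ν : Config S → Space d → Space d → ℝ≥0)
    (μ : Measure (Config S)) : Prop :=
  ∀ s : ℕ → Config S → ℝ, IsCauchySeq ν μ s →
    Tendsto (fun n => eLpNorm (s n) 2 μ) atTop (𝓝 0) →
    Tendsto (fun n => preForm ν μ (s n) (s n)) atTop (𝓝 0)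

/-! ### Quasi-regular Dirichlet forms -/

/-- A bilinear form on a linear subspace of `L²(X, m)`. -/
structure L2Form {X : Type*} [MeasurableSpace X] (m : Measure X) where
  /-- the domain -/
  dom : Submodule ℝ (Lp ℝ 2 m)
  /-- the form -/
  form : LinearMap.BilinForm ℝ dom

namespace L2Form

variable {X : Type*} [MeasurableSpace X] {m : Measure X}

/-- `‖u‖₁² = 𝔈(u, u) + ‖u‖²_{L²}`. -/
def normSq (F : L2Form m) (u : F.dom) : ℝ := F.form u u + ‖(u : Lp ℝ 2 m)‖ ^ 2

/-- `A` is `‖·‖₁`-dense in the domain. -/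
def IsDense (F : L2Form m) (A : Set F.dom) : Prop :=
  ∀ u : F.dom, ∀ ε : ℝ, 0 < ε → ∃ a ∈ A, F.normSq (u - a) < ε

/-- A (symmetric) Dirichlet form: densely defined, symmetric, nonnegative, closed, and
Markovian (stable under the unit contraction `u ↦ (0 ∨ u) ∧ 1`). -/
structure IsDirichlet (F : L2Form m) : Prop where
  dense : Dense (F.dom : Set (Lp ℝ 2 m))
  symm : ∀ u v, F.form u v = F.form v u
  nonneg : ∀ u, 0 ≤ F.form u u
  closed : ∀ s : ℕ → F.dom,
    (∀ ε : ℝ, 0 < ε → ∃ N, ∀ k ≥ N, ∀ n ≥ N, F.normSq (s k - s n) < ε) →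
    ∃ u : F.dom, Tendsto (fun n => F.normSq (s n - u)) atTop (𝓝 0)
  markov : ∀ (u : F.dom) (v : Lp ℝ 2 m),
    (∀ᵐ x ∂m, v x = min (max ((u : Lp ℝ 2 m) x) 0) 1) →
    ∃ hv : v ∈ F.dom, F.form ⟨v, hv⟩ ⟨v, hv⟩ ≤ F.form u u

variable [TopologicalSpace X]

/-- `𝔈`-nests: increasing sequences of closed sets `K n` such that the elements of the domain
vanishing a.e. outside some `K n` are `‖·‖₁`-dense. -/
structure IsNest (F : L2Form m) (K : ℕ → Set X) : Prop where
  mono : Monotone K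
  closed : ∀ n, IsClosed (K n)
  dense : F.IsDense {u | ∃ n, ∀ᵐ x ∂m, x ∉ K n → (u : Lp ℝ 2 m) x = 0}

/-- `𝔈`-exceptional sets. -/
def IsExceptional (F : L2Form m) (N : Set X) : Prop :=
  ∃ K : ℕ → Set X, F.IsNest K ∧ N ⊆ ⋂ n, (K n)ᶜ

/-- `𝔈`-quasi-continuous functions. -/
def IsQuasiContinuous (F : L2Form m) (f : X → ℝ) : Prop :=
  ∃ K : ℕ → Set X, F.IsNest K ∧ ∀ n, ContinuousOn f (K n)

/-- `f` is an `𝔈`-quasi-continuous version of `u`. -/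
def IsQuasiVersion (F : L2Form m) (u : F.dom) (f : X → ℝ) : Prop :=
  F.IsQuasiContinuous f ∧ (u : Lp ℝ 2 m) =ᵐ[m] f

/-- Quasi-regular Dirichlet forms. -/
structure IsQuasiRegularDirichlet (F : L2Form m) : Prop where
  isDirichlet : F.IsDirichlet
  compact_nest : ∃ K : ℕ → Set X, F.IsNest K ∧ ∀ n, IsCompact (K n)
  dense_quasiContinuous : ∃ A : Set F.dom, F.IsDense A ∧ ∀ u ∈ A, ∃ f, F.IsQuasiVersion u f
  separating : ∃ (u : ℕ → F.dom) (f : ℕ → X → ℝ) (N : Set X),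
    (∀ n, F.IsQuasiVersion (u n) (f n)) ∧ F.IsExceptional N ∧
    ∀ x ∉ N, ∀ y ∉ N, x ≠ y → ∃ n, f n x ≠ f n y

end L2Form

/-- `s` is an `𝔈`-Cauchy sequence in `𝔇_∞` which converges to `u` in `L²(𝔐, μ)`. -/
def Approximates {d : ℕ} {S : Set (Space d)} (ν : Config S → Space d → Space d → ℝ≥0)
    (μ : Measure (Config S)) (s : ℕ → Config S → ℝ) (u : Lp ℝ 2 μ) : Prop :=
  IsCauchySeq ν μ s ∧ Tendsto (fun n => eLpNorm (s n - ⇑u) 2 μ) atTop (𝓝 0)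

/-- `F` is the closure of `(𝔈, 𝔇_∞)`; this determines `F` uniquely. -/
structure IsClosureForm {d : ℕ} {S : Set (Space d)} (ν : Config S → Space d → Space d → ℝ≥0)
    (μ : Measure (Config S)) (F : L2Form μ) : Prop where
  mem_dom : ∀ u : Lp ℝ 2 μ, u ∈ F.dom ↔ ∃ s, Approximates ν μ s u
  tendsto_form : ∀ (u v : F.dom) (s t : ℕ → Config S → ℝ),
    Approximates ν μ s u → Approximates ν μ t v →
    Tendsto (fun n => preForm ν μ (s n) (t n)) atTop (𝓝 (F.form u v))

/-! ### Correlation and density functions -/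

/-- The number `ξ(U_r)` of particles in `U_r`. -/
def count {d : ℕ} {S : Set (Space d)} (r : ℝ) (ξ : Config S) : ℝ := (ξ.1 (U S r)).toReal

/-- `ρ` is the 1-correlation function of `μ`. -/
def IsCorrelation {d : ℕ} {S : Set (Space d)} (μ : Measure (Config S))
    (ρ : Space d → ℝ≥0) : Prop :=
  Measurable ρ ∧ ∀ A : Set (Space d), A ⊆ S → MeasurableSet A → Bornology.IsBounded A →
    ∫⁻ x in A, (ρ x : ℝ≥0∞) = ∫⁻ ξ, ξ.1 A ∂μ

/-- `σ r n : U_r^n → [0, ∞)` are the density functions of `μ`. -/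
def IsDensity {d : ℕ} {S : Set (Space d)} (μ : Measure (Config S))
    (σ : ℕ → (n : ℕ) → (Fin n → Space d) → ℝ) : Prop :=
  ∀ r n : ℕ, 0 < r →
    (∀ x ∈ UPow S r n, 0 ≤ σ r n x) ∧
    (∀ (e : Equiv.Perm (Fin n)), ∀ x ∈ UPow S r n, σ r n (x ∘ e) = σ r n x) ∧
    IntegrableOn (σ r n) (UPow S r n) ∧
    ∀ f : Config S → ℝ, Measurable[localSigma S r] f → (∃ M : ℝ, ∀ ξ, |f ξ| ≤ M) →
      (1 / (n.factorial : ℝ)) *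
          ∫ x in UPow S r n, valueAt f (∑ j, Measure.dirac (x j)) * σ r n x =
        ∫ ξ in {ξ : Config S | ξ.1 (U S r) = n}, f ξ ∂μ

end JumpForm

end

/-! The form is half the squared norm of a discrete gradient. On triples $(\xi,x,y)$ put the measure
$\mu(d\xi)\,\xi(dx)\,1_S(y)dy$ and let $\nabla f=\sqrt\nu\,(f(\xi^{xy})-f(\xi))$. On $\mathfrak
D_\infty$ the energy is $\frac12\|\nabla f\|^2$ in $L^2$ of this measure, and $\nabla$ is linear.
Closability says that the closure of the graph of $\nabla$ is again a graph; `closedForm` is read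
off from it, and completeness is then completeness of a closed subspace.

All quantitative input is in `exists_energy_bound`. If $\varphi$ and its local difference quotients
are at most $C e^{-\sqrt{1+|x|^2}}$, then every function whose increments are dominated by those of
$\sum\varphi(x_i)$ has energy at most $C^2B$, with one finite $B$. For short jumps the squared
increment supplies a factor $|x-y|^2$, integrable against $|x-y|^{-(d+\beta)}$ since $\beta<2$. For
long jumps the decay of $p$ is used. In both cases a factor $(1+|x|)^{-(d+\alpha)}$ is left, and its
sum over the particles has finite mean by Campbell's formula, since $\alpha>\kappa$.

Limits are taken with `exists_mem_closure_of_norm_le`, which replaces weak compactness: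
$L^2$-convergence with bounded gradients puts the limit in the closed graph. Applied to smooth
approximations of the unit contraction, it gives the Markov property. Density in $L^2$ is a π-λ
argument starting from smoothed indicators of $\{\sum\varphi(x_i)>a\}$.

For quasi-regularity let $X(\xi)=\sum_i e^{-\sqrt{1+|x_i|^2}}$, which is finite almost surely. A
bound on $X$ bounds the number of particles in every ball, so $\{X\le 2(n+1)\}$ lies, up to a null
set, in `compactSet S n`, a continuous image of a closed set of sequences in the one-point
compactification of $\mathbb R^d$. A smooth cut-off $h(2-X/(n+1))$ has gradient of norm $O(1/n)$.
Multiplied by a truncation of $f$ at height about $n$ it keeps the gradients bounded, vanishes off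
the compact set and tends to $f$ in $L^2$; convexity and closability upgrade this to approximation
in the form norm. Local smooth functions are continuous on the compact sets, because nearby
enumerations differ only by small moves of finitely many visible particles, and arctangents of
countably many linear statistics separate points. -/

noncomputable section

namespace JumpForm

/-! ### Smooth cut-off functions -/

/-- The function `√(1 + |x|²)`. -/
def bracket {d : ℕ} (x : Space d) : ℝ := √(1 + ‖x‖ ^ 2)

theorem contDiff_bracket {d : ℕ} : ContDiff ℝ ∞ (bracket (d := d)) := by
  unfold bracket
  exact (contDiff_const.add (contDiff_norm_sq ℝ)).sqrt fun x => by positivity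

theorem norm_le_bracket {d : ℕ} (x : Space d) : ‖x‖ ≤ bracket x :=
  Real.le_sqrt_of_sq_le (by linarith)

theorem one_le_bracket {d : ℕ} (x : Space d) : 1 ≤ bracket x :=
  Real.le_sqrt_of_sq_le (by nlinarith [sq_nonneg ‖x‖])

theorem bracket_le {d : ℕ} (x : Space d) : bracket x ≤ 1 + ‖x‖ :=
  Real.sqrt_le_iff.2 ⟨by positivity, by nlinarith [norm_nonneg x]⟩

theorem abs_bracket_sub_le {d : ℕ} (x y : Space d) : |bracket x - bracket y| ≤ ‖x - y‖ := by
  have hx : bracket x ^ 2 = 1 + ‖x‖ ^ 2 := Real.sq_sqrt (by positivity)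
  have hy : bracket y ^ 2 = 1 + ‖y‖ ^ 2 := Real.sq_sqrt (by positivity)
  have h1 := one_le_bracket x
  have h2 := one_le_bracket y
  have hs : 0 < bracket x + bracket y := by linarith
  have e : (bracket x - bracket y) * (bracket x + bracket y)
      = (‖x‖ - ‖y‖) * (‖x‖ + ‖y‖) := by nlinarith
  have h3 : |bracket x - bracket y| * (bracket x + bracket y)
      ≤ ‖x - y‖ * (bracket x + bracket y) := by
    calc |bracket x - bracket y| * (bracket x + bracket y)
        = |(bracket x - bracket y) * (bracket x + bracket y)| := by
          rw [abs_mul, abs_of_pos hs]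
      _ = |‖x‖ - ‖y‖| * (‖x‖ + ‖y‖) := by
          rw [e, abs_mul, abs_of_nonneg (by positivity : 0 ≤ ‖x‖ + ‖y‖)]
      _ ≤ ‖x - y‖ * (bracket x + bracket y) := by
          gcongr
          · exact abs_norm_sub_norm_le x y
          · exact norm_le_bracket x
          · exact norm_le_bracket y
  exact le_of_mul_le_mul_right h3 hs

/-- The derivative is continuous and vanishes off $[0,1]$, hence is bounded. -/
theorem exists_lipschitz_smoothTransition :
    ∃ L : ℝ≥0, 1 ≤ L ∧ LipschitzWith L Real.smoothTransition := by
  have hd : ContDiff ℝ ∞ Real.smoothTransition := Real.smoothTransition.contDiff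
  have hc : Continuous (deriv Real.smoothTransition) := hd.continuous_deriv (by simp)
  have hsupp : HasCompactSupport (deriv Real.smoothTransition) := by
    refine HasCompactSupport.intro (isCompact_Icc (a := (0 : ℝ)) (b := 1)) fun x hx => ?_
    rw [mem_Icc, not_and_or, not_le, not_le] at hx
    rcases hx with hx | hx
    · have : Real.smoothTransition =ᶠ[𝓝 x] fun _ => 0 := by
        filter_upwards [Iio_mem_nhds hx] with y hy
        exact Real.smoothTransition.zero_of_nonpos (le_of_lt hy)
      rw [this.deriv_eq]; simp
    · have : Real.smoothTransition =ᶠ[𝓝 x] fun _ => 1 := by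
        filter_upwards [Ioi_mem_nhds hx] with y hy
        exact Real.smoothTransition.one_of_one_le (le_of_lt hy)
      rw [this.deriv_eq]; simp
  obtain ⟨C, hC⟩ := hsupp.exists_bound_of_continuous hc
  refine ⟨max 1 C.toNNReal, le_max_left _ _,
    lipschitzWith_of_nnnorm_deriv_le (hd.differentiable (by simp)) fun x => ?_⟩
  refine le_max_of_le_right ?_
  rw [← NNReal.coe_le_coe, coe_nnnorm]
  exact (hC x).trans (Real.le_coe_toNNReal C)

/-- A smooth cut-off function, equal to `1` on the ball of radius `R` and vanishing outside the
ball of radius `R + 2`. -/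
def cut {d : ℕ} (R : ℝ) (x : Space d) : ℝ := Real.smoothTransition (R + 2 - bracket x)

theorem contDiff_cut {d : ℕ} (R : ℝ) : ContDiff ℝ ∞ (cut (d := d) R) :=
  Real.smoothTransition.contDiff.comp (contDiff_const.sub contDiff_bracket)

theorem cut_nonneg {d : ℕ} (R : ℝ) (x : Space d) : 0 ≤ cut R x := Real.smoothTransition.nonneg _

theorem cut_le_one {d : ℕ} (R : ℝ) (x : Space d) : cut R x ≤ 1 := Real.smoothTransition.le_one _

/-- The margin 2 in `cut` pays for $\|x\|\le$ `bracket x` $\le 1+\|x\|$ and for the unit length of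
the transition interval. -/
theorem cut_eq_one {d : ℕ} {R : ℝ} {x : Space d} (h : ‖x‖ ≤ R) : cut R x = 1 :=
  Real.smoothTransition.one_of_one_le (by linarith [bracket_le x])

theorem cut_eq_zero {d : ℕ} {R : ℝ} {x : Space d} (h : R + 2 ≤ ‖x‖) : cut R x = 0 :=
  Real.smoothTransition.zero_of_nonpos (by linarith [norm_le_bracket x])

theorem hasCompactSupport_mul_cut {d : ℕ} (g : Space d → ℝ) (R : ℝ) :
    HasCompactSupport (fun x => g x * cut R x) :=
  HasCompactSupport.intro (isCompact_closedBall 0 (R + 2)) fun x hx => by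
    rw [cut_eq_zero, mul_zero]
    simpa using (not_le.1 (by simpa using hx) : R + 2 < ‖x‖).le

theorem cut_mono {d : ℕ} {R R' : ℝ} (h : R ≤ R') (x : Space d) : cut R x ≤ cut R' x :=
  Real.smoothTransition.monotone (by linarith)

/-- The product of `g` with the cut-off function, as a compactly supported function. -/
def cutMul {d : ℕ} (g : C(Space d, ℝ)) (R : ℝ) : C_c(Space d, ℝ) where
  toFun x := g x * cut R x
  continuous_toFun := g.continuous.mul (contDiff_cut R).continuous
  hasCompactSupport' := hasCompactSupport_mul_cut g R

/-! ### The vague topology -/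

/-- The linear statistic `∑ φ(x_i)` of a configuration. -/
def pair {d : ℕ} {S : Set (Space d)} (φ : Space d → ℝ) (ξ : Config S) : ℝ := ∫ x, φ x ∂ξ.1

theorem continuous_pair {d : ℕ} {S : Set (Space d)} (φ : C_c(Space d, ℝ)) :
    Continuous (fun ξ : Config S => pair φ ξ) :=
  (continuous_apply φ).comp (continuous_induced_dom
    (f := fun (ξ : Config S) (φ : C_c(Space d, ℝ)) => ∫ x, φ x ∂ξ.1))

instance {d : ℕ} {S : Set (Space d)} (ξ : Config S) : IsFiniteMeasureOnCompacts ξ.1 :=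
  ⟨fun K hK => ξ.2.finite K hK⟩

theorem integrable_cc {d : ℕ} {S : Set (Space d)} (φ : C_c(Space d, ℝ)) (ξ : Config S) :
    Integrable φ ξ.1 :=
  φ.continuous.integrable_of_hasCompactSupport φ.hasCompactSupport

instance {d : ℕ} {S : Set (Space d)} : T2Space (Config S) := by
  refine ⟨fun ξ η hne => ?_⟩
  have : ∃ φ : C_c(Space d, ℝ), pair φ ξ ≠ pair φ η := by
    by_contra! h
    exact hne (Subtype.ext (Measure.ext_of_integral_eq_on_compactlySupported h))
  obtain ⟨φ, hφ⟩ := this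
  obtain ⟨u, v, hu, hv, h1, h2, h3⟩ := t2_separation hφ
  exact ⟨_, _, hu.preimage (continuous_pair φ), hv.preimage (continuous_pair φ), h1, h2,
    h3.preimage _⟩

/-- The cut-off is 1 where $\varphi\ne0$, so the difference is the integral of
$(\varphi-g)\cdot$`cut R`. The error is measured by a mass that is itself a linear statistic. -/
theorem abs_pair_sub_pair_cutMul_le {d : ℕ} {S : Set (Space d)} (φ : C_c(Space d, ℝ))
    {R : ℝ} (hR : ∀ x, R < ‖x‖ → φ x = 0) (g : C(Space d, ℝ)) {ε : ℝ}
    (hg : ∀ x, ‖x‖ ≤ R + 2 → |φ x - g x| ≤ ε) (ξ : Config S) :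
    |pair φ ξ - pair (cutMul g R) ξ| ≤ ε * pair (cutMul 1 R) ξ := by
  unfold pair
  rw [← integral_sub (integrable_cc φ ξ) (integrable_cc _ ξ), ← integral_const_mul]
  rw [← Real.norm_eq_abs]
  refine norm_integral_le_of_norm_le ((integrable_cc _ ξ).const_mul ε) (ae_of_all _ fun x => ?_)
  change |φ x - g x * cut R x| ≤ ε * (1 * cut R x)
  have h1 : φ x = φ x * cut R x := by
    by_cases h : R < ‖x‖
    · rw [hR x h, zero_mul]
    · rw [cut_eq_one (not_lt.1 h), mul_one]
  rw [h1, ← sub_mul, abs_mul, abs_of_nonneg (cut_nonneg R x), one_mul]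
  by_cases h : ‖x‖ ≤ R + 2
  · exact mul_le_mul_of_nonneg_right (hg x h) (cut_nonneg R x)
  · rw [cut_eq_zero (not_le.1 h).le]; simp

/-- A countable set of smooth functions, dense for locally uniform convergence, suffices after
multiplication by the cut-offs of integer radius. A test function is approximated uniformly on a
ball, and the error is controlled by the mass of that ball, which stays bounded near a given
configuration. -/
theorem exists_countable_smooth_inducing {d : ℕ} (S : Set (Space d)) :
    ∃ φ : ℕ → C_c(Space d, ℝ), (∀ k, ContDiff ℝ ∞ (φ k)) ∧
      IsInducing (fun (ξ : Config S) (k : ℕ) => pair (φ k) ξ) := by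
  have hdense := (ContinuousMap.dense_setOfPred_contDiff :
    Dense {f : C(Space d, ℝ) | ContDiff ℝ ∞ f})
  obtain ⟨D, hD, hDc, hDd⟩ := hdense.exists_countable_dense_subset
  -- The constant 1 is added so that the masses `pair (cutMul 1 R)` are continuous for the induced
  -- topology.
  obtain ⟨g, hg⟩ := (hDc.insert (1 : C(Space d, ℝ))).exists_eq_range (insert_nonempty _ _)
  have hgs : ∀ k, ContDiff ℝ ∞ (g k) := fun k => by
    have : g k ∈ insert 1 D := hg ▸ mem_range_self k
    rcases this with h | h
    · rw [h]; exact contDiff_const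
    · exact hD h
  refine ⟨fun k => cutMul (g k.unpair.1) k.unpair.2, fun k => (hgs _).mul (contDiff_cut _),
    ⟨le_antisymm (continuous_iff_le_induced.1 (continuous_pi fun k => continuous_pair _)) ?_⟩⟩
  let t : TopologicalSpace (Config S) := TopologicalSpace.induced
    (fun (ξ : Config S) (k : ℕ) => pair (cutMul (g k.unpair.1) k.unpair.2) ξ) inferInstance
  have hbase : ∀ k R : ℕ, Continuous[t, _] fun ξ : Config S => pair (cutMul (g k) R) ξ := by
    intro k R
    have h := (continuous_apply (Nat.pair k R)).comp (continuous_induced_dom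
      (f := fun (ξ : Config S) (k : ℕ) => pair (cutMul (g k.unpair.1) k.unpair.2) ξ))
    simpa [Function.comp_def] using h
  have hone : ∀ R : ℕ, Continuous[t, _] fun ξ : Config S => pair (cutMul 1 R) ξ := by
    intro R
    obtain ⟨k, hk⟩ : (1 : C(Space d, ℝ)) ∈ range g := hg ▸ mem_insert _ _
    have h := hbase k R
    rwa [hk] at h
  refine continuous_iff_le_induced.1 (continuous_pi fun φ => ?_)
  change Continuous[t, _] fun ξ : Config S => pair φ ξ
  obtain ⟨R, hR⟩ : ∃ R : ℕ, ∀ x, (R : ℝ) < ‖x‖ → φ x = 0 := by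
    obtain ⟨r, hr⟩ := φ.hasCompactSupport.isCompact.isBounded.subset_closedBall 0
    refine ⟨⌈r⌉₊, fun x hx => image_eq_zero_of_notMem_tsupport fun h => ?_⟩
    have := hr h
    rw [mem_closedBall_zero_iff] at this
    exact absurd hx (not_lt.2 (this.trans (Nat.le_ceil r)))
  rw [continuous_iff_continuousAt]
  intro ξ
  rw [ContinuousAt, Metric.tendsto_nhds]
  intro ε hε
  set m := pair (cutMul 1 R) ξ with hm
  have hm0 : 0 ≤ m := integral_nonneg fun x => by
    change 0 ≤ 1 * cut R x
    rw [one_mul]; exact cut_nonneg _ _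
  -- Near `ξ` the mass stays below $m+1$, so each of the two approximation errors is at most
  -- $\varepsilon/4$; the third quarter goes to the variation of the approximating statistic.
  set e : ℝ := ε / (4 * (m + 1)) with he
  have he0 : 0 < e := by positivity
  have hem : e * (m + 1) = ε / 4 := by rw [he]; field_simp
  obtain ⟨k, hk⟩ : ∃ k, ∀ x, ‖x‖ ≤ R + 2 → |φ x - g k x| ≤ e := by
    have hnb := (mem_closure_iff_nhds_basis (nhds_basis_uniformity
      Metric.uniformity_basis_dist.compactConvergenceUniformity)).1
      (hDd (φ : C(Space d, ℝ))) (Metric.closedBall 0 (R + 2), e) ⟨isCompact_closedBall _ _, he0⟩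
    obtain ⟨g', hg', hd⟩ := hnb
    obtain ⟨k, rfl⟩ : g' ∈ range g := hg ▸ mem_insert_of_mem _ hg'
    refine ⟨k, fun x hx => ?_⟩
    have := hd x (by simpa using hx)
    change dist (g k x) (φ x) < e at this
    rw [Real.dist_eq, abs_sub_comm] at this
    exact this.le
  have h1 : ∀ᶠ η in @nhds _ t ξ, dist (pair (cutMul (g k) R) η) (pair (cutMul (g k) R) ξ)
      < ε / 4 := Metric.tendsto_nhds.1 (continuous_iff_continuousAt.1 (hbase k R) ξ) _ (by linarith)
  have h2 : ∀ᶠ η in @nhds _ t ξ, pair (cutMul 1 R) η < m + 1 :=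
    (continuous_iff_continuousAt.1 (hone R) ξ).eventually (gt_mem_nhds (by linarith))
  filter_upwards [h1, h2] with η h1 h2
  have a1 := abs_pair_sub_pair_cutMul_le φ hR (g k) hk η
  have a2 := abs_pair_sub_pair_cutMul_le φ hR (g k) hk ξ
  have b1 : e * pair (cutMul 1 R) η ≤ ε / 4 := by
    rw [← hem]; exact mul_le_mul_of_nonneg_left h2.le he0.le
  have b2 : e * m ≤ ε / 4 := by
    rw [← hem]; exact mul_le_mul_of_nonneg_left (by linarith) he0.le
  rw [Real.dist_eq] at h1 ⊢
  rw [abs_le] at a1 a2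
  rw [abs_lt] at h1 ⊢
  constructor <;> linarith

/-! ### Measurability on the configuration space -/

theorem measurable_pair_cc {d : ℕ} {S : Set (Space d)} (φ : C_c(Space d, ℝ)) :
    Measurable (fun ξ : Config S => pair φ ξ) :=
  (continuous_pair φ).measurable

theorem lintegral_cc {d : ℕ} {S : Set (Space d)} (φ : C_c(Space d, ℝ)) (h : ∀ x, 0 ≤ φ x)
    (ξ : Config S) : ∫⁻ x, ENNReal.ofReal (φ x) ∂ξ.1 = ENNReal.ofReal (pair φ ξ) :=
  (ofReal_integral_eq_lintegral_ofReal (integrable_cc φ ξ) (ae_of_all _ h)).symm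

/-- The cut-off makes the measures finite, so measurability need only be checked on the π-system of
closed sets. There the indicator is a limit of continuous functions, whose integrals are continuous
linear statistics. -/
theorem measurable_withDensity_cut {d : ℕ} (S : Set (Space d)) (R : ℝ) :
    Measurable fun ξ : Config S => ξ.1.withDensity fun x => ENNReal.ofReal (cut R x) := by
  have hcut : Measurable fun x : Space d => ENNReal.ofReal (cut R x) :=
    (contDiff_cut R).continuous.measurable.ennreal_ofReal
  have hval : ∀ (g : C(Space d, ℝ)), (∀ x, 0 ≤ g x) → ∀ ξ : Config S,
      ∫⁻ x, ENNReal.ofReal (g x) ∂(ξ.1.withDensity fun x => ENNReal.ofReal (cut R x))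
        = ENNReal.ofReal (pair (cutMul g R) ξ) := by
    intro g hg ξ
    rw [← lintegral_cc _ (fun x => mul_nonneg (hg x) (cut_nonneg R x)),
      lintegral_withDensity_eq_lintegral_mul _ hcut g.continuous.measurable.ennreal_ofReal]
    refine lintegral_congr fun x => ?_
    rw [Pi.mul_apply, ← ENNReal.ofReal_mul (cut_nonneg R x), mul_comm]
    rfl
  have huniv : ∀ ξ : Config S, (ξ.1.withDensity fun x => ENNReal.ofReal (cut R x)) univ
      = ENNReal.ofReal (pair (cutMul 1 R) ξ) := by
    intro ξ
    rw [← hval 1 (fun _ => zero_le_one)]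
    simp
  have : ∀ ξ : Config S,
      IsFiniteMeasure (ξ.1.withDensity fun x => ENNReal.ofReal (cut R x)) :=
    fun ξ => ⟨by rw [huniv]; exact ENNReal.ofReal_lt_top⟩
  refine Measurable.measure_of_isPiSystem (S := {F : Set (Space d) | IsClosed F})
    ?_ (fun F hF G hG _ => hF.inter hG) ?_ ?_
  · rw [← borel_eq_generateFrom_isClosed]; exact BorelSpace.measurable_eq
  · intro F hF
    refine measurable_of_tendsto_metrizable (f := fun n (ξ : Config S) =>
      ∫⁻ x, (hF.apprSeq n x : ℝ≥0∞) ∂(ξ.1.withDensity fun x => ENNReal.ofReal (cut R x))) ?_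
      (tendsto_pi_nhds.2 fun ξ => HasOuterApproxClosed.tendsto_lintegral_apprSeq hF _)
    intro n
    have h := hval ⟨fun x => (hF.apprSeq n x : ℝ), by fun_prop⟩ (fun x => by simp)
    simp only [ContinuousMap.coe_mk, ENNReal.ofReal_coe_nnreal] at h
    simp_rw [h]
    exact (measurable_pair_cc _).ennreal_ofReal
  · simp_rw [huniv]
    exact (measurable_pair_cc _).ennreal_ofReal

theorem iSup_cut {d : ℕ} (x : Space d) : ⨆ R : ℕ, ENNReal.ofReal (cut R x) = 1 := by
  refine le_antisymm (iSup_le fun R => ?_) ?_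
  · rw [← ENNReal.ofReal_one]; exact ENNReal.ofReal_le_ofReal (cut_le_one _ _)
  · refine le_iSup_of_le ⌈‖x‖⌉₊ ?_
    rw [cut_eq_one (Nat.le_ceil _), ENNReal.ofReal_one]

theorem measurable_val {d : ℕ} (S : Set (Space d)) :
    Measurable fun ξ : Config S => ξ.1 := by
  refine Measure.measurable_of_measurable_coe _ fun A hA => ?_
  have : ∀ ξ : Config S, ξ.1 A
      = ⨆ R : ℕ, (ξ.1.withDensity fun x => ENNReal.ofReal (cut R x)) A := by
    intro ξ
    simp_rw [withDensity_apply _ hA]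
    rw [← lintegral_iSup]
    · simp [iSup_cut]
    · exact fun R => (contDiff_cut _).continuous.measurable.ennreal_ofReal
    · exact fun R R' h x => ENNReal.ofReal_le_ofReal (cut_mono (by exact_mod_cast h) x)
  simp_rw [this]
  exact .iSup fun R => (Measure.measurable_coe hA).comp (measurable_withDensity_cut S R)

theorem measurable_apply {d : ℕ} {S : Set (Space d)} {A : Set (Space d)} (hA : MeasurableSet A) :
    Measurable fun ξ : Config S => ξ.1 A :=
  (Measure.measurable_coe hA).comp (measurable_val S)

/-- The Borel σ-algebra is generated by the linear statistics of countably many smooth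
functions. -/
theorem measurableSpace_eq_comap {d : ℕ} {S : Set (Space d)} {φ : ℕ → C_c(Space d, ℝ)}
    (h : IsInducing (fun (ξ : Config S) (k : ℕ) => pair (φ k) ξ)) :
    (inferInstance : MeasurableSpace (Config S))
      = MeasurableSpace.comap (fun (ξ : Config S) (k : ℕ) => pair (φ k) ξ) inferInstance := by
  have h1 : (inferInstance : MeasurableSpace (ℕ → ℝ)) = borel (ℕ → ℝ) := BorelSpace.measurable_eq
  rw [h1, ← borel_comap, ← h.eq_induced]
  rfl

/-- The Borel σ-algebra is generated by linear statistics, and each of these is a difference of two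
Lebesgue integrals, measurable as soon as all particle counts are. -/
theorem measurable_toConfig {d : ℕ} {S : Set (Space d)} {Z : Type*} [MeasurableSpace Z]
    {g : Z → Config S} (hg : ∀ A, MeasurableSet A → Measurable fun z => (g z).1 A) :
    Measurable g := by
  obtain ⟨φ, -, hφ⟩ := exists_countable_smooth_inducing S
  have hm : Measurable fun z => (g z).1 := Measure.measurable_of_measurable_coe _ hg
  have e := measurableSpace_eq_comap hφ
  change Measurable[_, (inferInstance : MeasurableSpace (Config S))] g
  rw [e, measurable_comap_iff, measurable_pi_iff]
  intro k
  have hφm : Measurable (φ k) := (φ k).continuous.measurable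
  have : ∀ z, pair (φ k) (g z) = (∫⁻ x, ENNReal.ofReal (φ k x) ∂(g z).1).toReal
      - (∫⁻ x, ENNReal.ofReal (-φ k x) ∂(g z).1).toReal := fun z =>
    integral_eq_lintegral_pos_part_sub_lintegral_neg_part (integrable_cc _ _)
  simp_rw [Function.comp_def, this]
  exact ((Measure.measurable_lintegral hφm.ennreal_ofReal).comp hm).ennreal_toReal.sub
    ((Measure.measurable_lintegral hφm.neg.ennreal_ofReal).comp hm).ennreal_toReal

theorem measurable_restrict {d : ℕ} {S : Set (Space d)} {A : Set (Space d)}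
    (hA : MeasurableSet A) : Measurable (Config.restrict (S := S) A) := by
  refine measurable_toConfig fun B hB => ?_
  change Measurable fun ξ : Config S => ξ.1.restrict A B
  simp_rw [Measure.restrict_apply hB]
  exact measurable_apply (hB.inter hA)

/-- A finite kernel needs a uniform bound on total masses; splitting the source by the integer part
of the total mass provides one on each piece. -/
theorem isSFiniteKernel_of_forall_isFiniteMeasure {X Y : Type*} [MeasurableSpace X]
    [MeasurableSpace Y] (κ : ProbabilityTheory.Kernel X Y) (h : ∀ a, κ a univ < ⊤) :
    ProbabilityTheory.IsSFiniteKernel κ := by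
  classical
  have hs : ∀ n : ℕ, MeasurableSet {a | ⌊(κ a univ).toReal⌋₊ = n} := fun n =>
    (Nat.measurable_floor.comp (κ.measurable_coe .univ).ennreal_toReal) (measurableSet_singleton n)
  refine ⟨fun n => ProbabilityTheory.Kernel.piecewise (hs n) κ 0, fun n =>
    ⟨n + 1, by simp, fun a => ?_⟩, ?_⟩
  · rw [ProbabilityTheory.Kernel.piecewise_apply]
    split_ifs with h'
    · have h2 : (κ a univ).toReal < n + 1 := by
        have := Nat.lt_floor_add_one (κ a univ).toReal
        rwa [show ⌊(κ a univ).toReal⌋₊ = n from h'] at this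
      rw [← ENNReal.ofReal_toReal (a := κ a univ) (h a).ne]
      refine (ENNReal.ofReal_le_ofReal h2.le).trans ?_
      rw [ENNReal.ofReal_add (by positivity) zero_le_one]; simp
    · simp
  · ext a A hA
    rw [ProbabilityTheory.Kernel.sum_apply' _ _ hA, tsum_eq_single ⌊(κ a univ).toReal⌋₊]
    · rw [ProbabilityTheory.Kernel.piecewise_apply, if_pos (by rfl)]
    · intro n hn
      rw [ProbabilityTheory.Kernel.piecewise_apply, if_neg (fun h' => hn h'.symm)]; simp

/-- The kernel `ξ ↦ ξ(dx)`. -/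
def configKernel {d : ℕ} (S : Set (Space d)) : ProbabilityTheory.Kernel (Config S) (Space d) where
  toFun ξ := ξ.1
  measurable' := measurable_val S

/-- Each shell $\lfloor\|x\|\rfloor=n$ is bounded, so it carries finitely many particles. This is
what permits Fubini for $\mu(d\xi)\,\xi(dx)$. -/
instance {d : ℕ} (S : Set (Space d)) : ProbabilityTheory.IsSFiniteKernel (configKernel S) := by
  have hs : ∀ n : ℕ, MeasurableSet {x : Space d | ⌊‖x‖⌋₊ = n} := fun n =>
    (Nat.measurable_floor.comp measurable_norm) (measurableSet_singleton n)
  have e : configKernel S = ProbabilityTheory.Kernel.sum fun n =>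
      (configKernel S).restrict (hs n) := by
    ext ξ A hA
    rw [ProbabilityTheory.Kernel.sum_apply' _ _ hA]
    simp_rw [ProbabilityTheory.Kernel.restrict_apply, Measure.restrict_apply hA]
    rw [← measure_iUnion]
    · congr 1; ext x; simp
    · intro i j hij
      refine Set.disjoint_left.2 fun x hx hx' => hij ?_
      rw [← show ⌊‖x‖⌋₊ = i from hx.2, ← show ⌊‖x‖⌋₊ = j from hx'.2]
    · exact fun n => hA.inter (hs n)
  have : ∀ n, ProbabilityTheory.IsSFiniteKernel ((configKernel S).restrict (hs n)) := fun n =>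
    isSFiniteKernel_of_forall_isFiniteMeasure _ fun ξ => by
      rw [ProbabilityTheory.Kernel.restrict_apply, Measure.restrict_apply .univ, univ_inter]
      refine (measure_mono fun x hx => ?_).trans_lt
        (ξ.2.finite _ (isCompact_closedBall (0 : Space d) (n + 1)))
      rw [mem_closedBall_zero_iff, ← show ⌊‖x‖⌋₊ = n from hx]
      exact (Nat.lt_floor_add_one _).le
  rw [e]
  exact ProbabilityTheory.Kernel.isSFiniteKernel_sum

/-! ### The jump map -/

theorem IsConfig.ae_mem {d : ℕ} {S : Set (Space d)} {m : Measure (Space d)} (h : IsConfig S m) :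
    ∀ᵐ x ∂m, x ∈ S ∧ 1 ≤ m {x} := by
  obtain ⟨I, x, hx, rfl⟩ := h.exists_sum
  rw [Measure.ae_sum_iff]
  rintro ⟨i, hi⟩
  rw [ae_dirac_eq]
  refine ⟨hx i hi, ?_⟩
  refine le_trans ?_ (Measure.le_sum (fun i : I => Measure.dirac (x i)) ⟨i, hi⟩ _)
  simp

/-- An atom of mass at least 1 is one of the enumerated points, and the jump overwrites that index
by `y`. The inequality in the conclusion makes the truncated subtraction of measures a genuine one.
-/
theorem IsConfig.sub_add {d : ℕ} {S : Set (Space d)} {m : Measure (Space d)} (h : IsConfig S m)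
    {x y : Space d} (hx : 1 ≤ m {x}) (hy : y ∈ S) :
    IsConfig S (m - Measure.dirac x + Measure.dirac y) ∧ Measure.dirac x ≤ m := by
  classical
  obtain ⟨I, z, hz, rfl⟩ := h.exists_sum
  obtain ⟨i, hi, rfl⟩ : ∃ i ∈ I, z i = x := by
    by_contra! hne
    rw [Measure.sum_apply _ (measurableSet_singleton x)] at hx
    have : ∀ i : I, (Measure.dirac (z i) : Measure (Space d)) {x} = 0 := fun i => by
      rw [Measure.dirac_apply' _ (measurableSet_singleton x)]
      simp [hne i i.2]
    simp [this] at hx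
  have hsplit : ∀ u : ℕ → Space d, Measure.sum (fun j : I => Measure.dirac (u j))
      = Measure.sum (fun j : I => if (j : ℕ) = i then 0 else Measure.dirac (u j))
        + Measure.dirac (u i) := by
    intro u
    ext A hA
    rw [Measure.add_apply, Measure.sum_apply _ hA, Measure.sum_apply _ hA,
      ENNReal.tsum_eq_add_tsum_ite (⟨i, hi⟩ : I), add_comm]
    congr 1
    refine tsum_congr fun j => ?_
    by_cases hj : (j : ℕ) = i
    · have : j = ⟨i, hi⟩ := Subtype.ext hj
      simp [this]
    · have : j ≠ ⟨i, hi⟩ := fun h => hj (congrArg Subtype.val h)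
      simp [this, hj]
  have e := hsplit z
  have e' := hsplit (Function.update z i y)
  simp only [Function.update_self] at e'
  have hcongr : (fun j : I => if (j : ℕ) = i then (0 : Measure (Space d)) else
      Measure.dirac (Function.update z i y j))
      = fun j : I => if (j : ℕ) = i then 0 else Measure.dirac (z j) := by
    funext j
    split_ifs with hj
    · rfl
    · rw [Function.update_of_ne hj]
  rw [hcongr] at e'
  have hfin := h.finite
  rw [e] at hfin ⊢
  rw [Measure.add_sub_cancel]
  refine ⟨⟨⟨I, Function.update z i y, fun j hj => ?_, e'.symm⟩, fun K hK => ?_⟩,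
    Measure.le_add_left le_rfl⟩
  · by_cases hji : j = i
    · rw [hji, Function.update_self]; exact hy
    · rw [Function.update_of_ne hji]; exact hz j hj
  · rw [Measure.add_apply]
    refine ENNReal.add_lt_top.2 ⟨?_, measure_lt_top _ _⟩
    exact lt_of_le_of_lt (by rw [Measure.add_apply]; exact le_self_add) (hfin K hK)

/-- The set of triples `(ξ, x, y)` for which `x` is a particle of `ξ` and `y ∈ S`. -/
def jumpSet {d : ℕ} (S : Set (Space d)) : Set ((Config S × Space d) × Space d) :=
  {z | 1 ≤ z.1.1.1 {z.1.2} ∧ z.2 ∈ S}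

open Classical in
/-- The configuration `ξ^{xy}` (and `ξ` if `(ξ, x, y)` is not an admissible triple). -/
def jumpMap {d : ℕ} {S : Set (Space d)} (z : (Config S × Space d) × Space d) : Config S :=
  if h : z ∈ jumpSet S then
    ⟨z.1.1.1 - Measure.dirac z.1.2 + Measure.dirac z.2, (z.1.1.2.sub_add h.1 h.2).1⟩ else z.1.1

theorem jumpMap_of_mem {d : ℕ} {S : Set (Space d)} {z : (Config S × Space d) × Space d}
    (h : z ∈ jumpSet S) : jumpMap z =
      ⟨z.1.1.1 - Measure.dirac z.1.2 + Measure.dirac z.2, (z.1.1.2.sub_add h.1 h.2).1⟩ :=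
  dif_pos h

theorem jumpMap_of_notMem {d : ℕ} {S : Set (Space d)} {z : (Config S × Space d) × Space d}
    (h : z ∉ jumpSet S) : jumpMap z = z.1.1 :=
  dif_neg h

theorem valueAt_eq {d : ℕ} {S : Set (Space d)} (f : Config S → ℝ) {m : Measure (Space d)}
    (h : IsConfig S m) : valueAt f m = f ⟨m, h⟩ :=
  dif_pos h

theorem jumpDiff_eq {d : ℕ} {S : Set (Space d)} (f : Config S → ℝ) {ξ : Config S} {x y : Space d}
    (h : ((ξ, x), y) ∈ jumpSet S) : jumpDiff f ξ x y = f (jumpMap ((ξ, x), y)) - f ξ := by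
  rw [jumpDiff, valueAt_eq f (ξ.2.sub_add h.1 h.2).1, jumpMap_of_mem h]

/-- The map $(\xi,x)\mapsto\xi(\{x\})$ is the kernel mass of a section of the diagonal, hence
measurable. -/
theorem measurableSet_jumpSet {d : ℕ} {S : Set (Space d)} (hS : MeasurableSet S) :
    MeasurableSet (jumpSet S) := by
  have h1 : Measurable fun z : Config S × Space d => z.1.1 {z.2} := by
    have := ProbabilityTheory.Kernel.measurable_kernel_prodMk_left
      (κ := (configKernel S).comap (Prod.fst : Config S × Space d → Config S) measurable_fst)
      (t := {p : (Config S × Space d) × Space d | p.2 = p.1.2})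
      (measurableSet_eq_fun measurable_snd (measurable_snd.comp measurable_fst)) 
    convert! this using 1
  exact (measurableSet_le measurable_const (h1.comp measurable_fst)).inter (measurable_snd hS)

theorem measurable_jumpMap {d : ℕ} {S : Set (Space d)} (hS : MeasurableSet S) :
    Measurable (jumpMap (S := S)) := by
  classical
  refine measurable_toConfig fun A hA => ?_
  have : (fun z => (jumpMap (S := S) z).1 A) = fun z => if z ∈ jumpSet S then
      z.1.1.1 A - A.indicator 1 z.1.2 + A.indicator 1 z.2 else z.1.1.1 A := by
    funext z
    split_ifs with h
    · rw [jumpMap_of_mem h]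
      change (z.1.1.1 - Measure.dirac z.1.2 + Measure.dirac z.2) A = _
      rw [Measure.add_apply, Measure.sub_apply hA (z.1.1.2.sub_add h.1 h.2).2,
        Measure.dirac_apply' _ hA, Measure.dirac_apply' _ hA]
    · rw [jumpMap_of_notMem h]
  rw [this]
  have h1 : Measurable fun z : (Config S × Space d) × Space d => z.1.1.1 A :=
    (measurable_apply hA).comp (measurable_fst.comp measurable_fst)
  have h2 : Measurable fun z : Space d => A.indicator (1 : Space d → ℝ≥0∞) z :=
    measurable_one.indicator hA
  exact Measurable.ite (measurableSet_jumpSet hS)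
    ((h1.sub (h2.comp (measurable_snd.comp measurable_fst))).add (h2.comp measurable_snd)) h1

/-! ### Analytic preliminaries -/

/-- A Banach–Saks type argument without weak topologies. The closed convex sets of second components
available within distance $1/(n+1)$ of `u` decrease with `n`; their elements of least norm have
bounded increasing norms, and the parallelogram law makes them a Cauchy sequence. The limit lies in
every one of these sets. -/
theorem exists_mem_closure_of_norm_le {H₁ H₂ : Type*} [NormedAddCommGroup H₁] [NormedSpace ℝ H₁]
    [NormedAddCommGroup H₂] [InnerProductSpace ℝ H₂] [CompleteSpace H₂] {P : Set (H₁ × H₂)}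
    (hP : Convex ℝ P) {u : H₁} {C : ℝ}
    (h : ∀ ε : ℝ, 0 < ε → ∃ p ∈ P, ‖p.1 - u‖ ≤ ε ∧ ‖p.2‖ ≤ C) :
    ∃ v, (u, v) ∈ closure P ∧ ‖v‖ ≤ C := by
  let K : ℕ → Set H₂ := fun n => closure (Prod.snd '' (P ∩ {p | ‖p.1 - u‖ ≤ 1 / ((n : ℝ) + 1)}))
  have hpos : ∀ n : ℕ, (0 : ℝ) < 1 / ((n : ℝ) + 1) := fun n => by positivity
  have hconv : ∀ n, Convex ℝ (K n) := by
    intro n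
    refine Convex.closure ((hP.inter ?_).linear_image (LinearMap.snd ℝ H₁ H₂))
    have : {p : H₁ × H₂ | ‖p.1 - u‖ ≤ 1 / ((n : ℝ) + 1)}
        = LinearMap.fst ℝ H₁ H₂ ⁻¹' (Metric.closedBall u (1 / ((n : ℝ) + 1))) := by
      ext p; simp [dist_eq_norm]
    rw [this]
    exact (convex_closedBall _ _).linear_preimage _
  have hanti : ∀ m n, m ≤ n → K n ⊆ K m := by
    intro m n hmn
    refine closure_mono (image_mono fun p hp => ⟨hp.1, ?_⟩)
    have hp2 : ‖p.1 - u‖ ≤ 1 / ((n : ℝ) + 1) := hp.2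
    refine hp2.trans ?_
    exact one_div_le_one_div_of_le (by positivity) (by gcongr)
  have hmin : ∀ n, ∃ v ∈ K n, ∀ w ∈ K n, ‖v‖ ≤ ‖w‖ := by
    intro n
    have hne : (K n).Nonempty := by
      obtain ⟨p, hp, h1, -⟩ := h _ (hpos n)
      exact ⟨p.2, subset_closure ⟨p, ⟨hp, h1⟩, rfl⟩⟩
    obtain ⟨v, hv, hv'⟩ := exists_norm_eq_iInf_of_complete_convex hne isClosed_closure.isComplete
      (hconv n) 0
    refine ⟨v, hv, fun w hw => ?_⟩
    rw [zero_sub, norm_neg] at hv'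
    rw [hv']
    refine (ciInf_le ⟨0, ?_⟩ (⟨w, hw⟩ : K n)).trans (by simp)
    rintro _ ⟨x, rfl⟩
    exact norm_nonneg _
  choose m hmK hmle using hmin
  have hmC : ∀ n, ‖m n‖ ≤ C := by
    intro n
    obtain ⟨p, hp, h1, h2⟩ := h _ (hpos n)
    exact (hmle n _ (subset_closure ⟨p, ⟨hp, h1⟩, rfl⟩)).trans h2
  have hmono : Monotone fun n => ‖m n‖ ^ 2 := fun i j hij =>
    pow_le_pow_left₀ (norm_nonneg _) (hmle i _ (hanti i j hij (hmK j))) 2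
  -- Both points lie in the convex set `K i`, so their midpoint has norm at least `‖m i‖`.
  have hpar : ∀ i j, i ≤ j → ‖m i - m j‖ ^ 2 ≤ 2 * (‖m j‖ ^ 2 - ‖m i‖ ^ 2) := by
    intro i j hij
    have h1 := parallelogram_law_with_norm ℝ (m i) (m j)
    have h2 : ‖m i‖ ≤ ‖(2⁻¹ : ℝ) • (m i + m j)‖ := by
      refine hmle i _ ?_
      rw [smul_add]
      exact hconv i (hmK i) (hanti i j hij (hmK j)) (by norm_num) (by norm_num) (by norm_num)
    rw [norm_smul, Real.norm_of_nonneg (by norm_num)] at h2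
    have h3 : (2 * ‖m i‖) ^ 2 ≤ ‖m i + m j‖ ^ 2 :=
      pow_le_pow_left₀ (by positivity) (by linarith) 2
    nlinarith
  have hC0 : 0 ≤ C := (norm_nonneg _).trans (hmC 0)
  have hlim := tendsto_atTop_ciSup hmono ⟨C ^ 2, by
    rintro _ ⟨n, rfl⟩; exact pow_le_pow_left₀ (norm_nonneg _) (hmC n) 2⟩
  have hcau : CauchySeq m := by
    rw [Metric.cauchySeq_iff']
    intro ε hε
    obtain ⟨N, hN⟩ := Metric.cauchySeq_iff'.1 hlim.cauchySeq (ε ^ 2 / 2) (by positivity)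
    refine ⟨N, fun n hn => ?_⟩
    have h1 := hN n hn
    rw [Real.dist_eq] at h1
    rw [dist_comm, dist_eq_norm]
    refine lt_of_pow_lt_pow_left₀ 2 hε.le ((hpar N n hn).trans_lt ?_)
    linarith [le_abs_self (‖m n‖ ^ 2 - ‖m N‖ ^ 2)]
  obtain ⟨v, hv⟩ := cauchySeq_tendsto_of_complete hcau
  refine ⟨v, ?_, le_of_tendsto hv.norm (Eventually.of_forall hmC)⟩
  have hvK : ∀ n, v ∈ K n := fun n =>
    isClosed_closure.mem_of_tendsto hv (eventually_atTop.2 ⟨n, fun j hj => hanti n j hj (hmK j)⟩)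
  rw [Metric.mem_closure_iff]
  intro ε hε
  obtain ⟨n, hn⟩ := exists_nat_one_div_lt hε
  obtain ⟨_, ⟨p, ⟨hp, hpn⟩, rfl⟩, hd⟩ := Metric.mem_closure_iff.1 (hvK n) ε hε
  refine ⟨p, hp, ?_⟩
  rw [Prod.dist_eq, max_lt_iff]
  refine ⟨?_, hd⟩
  rw [dist_comm, dist_eq_norm]
  exact lt_of_le_of_lt hpn hn

/-- Mollification at scale `ε`: an average of translates keeps the Lipschitz constant and moves a
1-Lipschitz function by at most `ε`. -/
theorem exists_contDiff_lipschitz_approx {f : ℝ → ℝ} (hf : LipschitzWith 1 f) {ε : ℝ}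
    (hε : 0 < ε) : ∃ g : ℝ → ℝ, ContDiff ℝ ∞ g ∧ (∀ a b, |g a - g b| ≤ |a - b|) ∧
      ∀ a, |g a - f a| ≤ ε := by
  let φ : ContDiffBump (0 : ℝ) := ⟨ε / 2, ε, half_pos hε, half_lt_self hε⟩
  have hloc : LocallyIntegrable f volume := hf.continuous.locallyIntegrable
  refine ⟨_, (φ.hasCompactSupport_normed (μ := volume)).contDiff_convolution_left (n := ⊤)
    (ContinuousLinearMap.lsmul ℝ ℝ) φ.contDiff_normed hloc, fun a b => ?_, fun a => ?_⟩
  · have hint : ∀ x, Integrable fun t => φ.normed volume t • f (x - t) := fun x =>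
      ((φ.continuous_normed (μ := volume)).smul (hf.continuous.comp
        (continuous_const.sub continuous_id))).integrable_of_hasCompactSupport
        (φ.hasCompactSupport_normed (μ := volume)).smul_right
    rw [convolution_def, convolution_def]
    simp only [ContinuousLinearMap.lsmul_apply]
    rw [← integral_sub (hint a) (hint b), ← Real.norm_eq_abs]
    refine (norm_integral_le_of_norm_le (g := fun t => φ.normed volume t * |a - b|)
      ((φ.integrable_normed (μ := volume)).mul_const _) (ae_of_all _ fun t => ?_)).trans_eq ?_
    · rw [← smul_sub, norm_smul, Real.norm_of_nonneg (φ.nonneg_normed t)]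
      refine mul_le_mul_of_nonneg_left ?_ (φ.nonneg_normed t)
      have := hf.dist_le_mul (a - t) (b - t)
      simpa [dist_eq_norm] using this
    · rw [integral_mul_const, φ.integral_normed, one_mul]
  · have := φ.dist_normed_convolution_le (μ := volume) (g := f) (x₀ := a) (ε := ε)
      hf.continuous.aestronglyMeasurable fun x hx => ?_
    · rwa [Real.dist_eq] at this
    · have h1 := hf.dist_le_mul x a
      rw [NNReal.coe_one, one_mul] at h1
      exact h1.trans (le_of_lt hx)

theorem tendsto_eLpNorm_two_of_dominated {X : Type*} [MeasurableSpace X] {m : Measure X}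
    {F : ℕ → X → ℝ} {f G : X → ℝ} (hF : ∀ n, AEStronglyMeasurable (F n) m) (hG : MemLp G 2 m)
    (hFG : ∀ n, ∀ᵐ x ∂m, |F n x - f x| ≤ G x)
    (hlim : ∀ᵐ x ∂m, Tendsto (fun n => F n x) atTop (𝓝 (f x))) :
    Tendsto (fun n => eLpNorm (F n - f) 2 m) atTop (𝓝 0) := by
  have hf : AEStronglyMeasurable f m := aestronglyMeasurable_of_tendsto_ae _ hF hlim
  have h2 : (fun n => eLpNorm (F n - f) 2 m)
      = fun n => (∫⁻ x, ‖F n x - f x‖ₑ ^ (2 : ℝ) ∂m) ^ (1 / (2 : ℝ)) := by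
    funext n
    rw [eLpNorm_eq_lintegral_rpow_enorm_toReal (by simp) (by simp)]
    simp
  have hG2 : ∫⁻ x, ‖G x‖ₑ ^ (2 : ℝ) ∂m < ⊤ := by
    have := lintegral_rpow_enorm_lt_top_of_eLpNorm_lt_top (by simp) (by simp) hG.2
    simpa using this
  have key : Tendsto (fun n => ∫⁻ x, ‖F n x - f x‖ₑ ^ (2 : ℝ) ∂m) atTop
      (𝓝 (∫⁻ _, 0 ∂m)) := by
    refine tendsto_lintegral_of_dominated_convergence' (fun x => ‖G x‖ₑ ^ (2 : ℝ))
      (fun n => ((hF n).sub hf).enorm.pow_const _) (fun n => ?_) hG2.ne ?_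
    · filter_upwards [hFG n] with x hx
      refine ENNReal.rpow_le_rpow ?_ (by norm_num)
      rw [enorm_le_iff_norm_le, Real.norm_eq_abs, Real.norm_eq_abs]
      exact hx.trans (le_abs_self _)
    · filter_upwards [hlim] with x hx
      have h1 : Tendsto (fun n => ‖F n x - f x‖ₑ) atTop (𝓝 0) := by
        have := (hx.sub_const (f x)).enorm
        simpa using this
      have := h1.ennrpow_const (2 : ℝ)
      simpa using this
  rw [h2]
  rw [lintegral_zero] at key
  have := key.ennrpow_const (1 / (2 : ℝ))
  simpa using this

/-! ### Constructing configurations -/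

theorem IsConfig.of_sum {d : ℕ} {S : Set (Space d)} {ι : Type*} [Countable ι] {x : ι → Space d}
    (hx : ∀ i, x i ∈ S)
    (hfin : ∀ K, IsCompact K → Measure.sum (fun i => Measure.dirac (x i)) K < (⊤ : ℝ≥0∞)) :
    IsConfig S (Measure.sum fun i => Measure.dirac (x i)) := by
  obtain ⟨e, he⟩ := exists_injective_nat ι
  refine ⟨⟨range e, Function.extend e x 0, ?_, ?_⟩, hfin⟩
  · rintro _ ⟨i, rfl⟩
    rw [he.extend_apply]; exact hx i
  · ext A hA
    rw [Measure.sum_apply _ hA, Measure.sum_apply _ hA, ← (Equiv.ofInjective e he).tsum_eq]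
    refine tsum_congr fun i => ?_
    rw [Equiv.ofInjective_apply, he.extend_apply]

theorem IsConfig.add {d : ℕ} {S : Set (Space d)} {m m' : Measure (Space d)}
    (h : IsConfig S m) (h' : IsConfig S m') : IsConfig S (m + m') := by
  have hfin : ∀ K, IsCompact K → (m + m') K < (⊤ : ℝ≥0∞) := fun K hK => by
    rw [Measure.add_apply]; exact ENNReal.add_lt_top.2 ⟨h.finite K hK, h'.finite K hK⟩
  obtain ⟨I, x, hx, rfl⟩ := h.exists_sum
  obtain ⟨I', x', hx', rfl⟩ := h'.exists_sum
  have e : Measure.sum (fun i : I => Measure.dirac (x i))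
      + Measure.sum (fun i : I' => Measure.dirac (x' i))
      = Measure.sum fun j : I ⊕ I' => Measure.dirac
        (Sum.elim (fun i : I => x i) (fun i : I' => x' i) j) := by
    ext A hA
    rw [Measure.add_apply, Measure.sum_apply _ hA, Measure.sum_apply _ hA, Measure.sum_apply _ hA,
      Summable.tsum_sum ENNReal.summable ENNReal.summable]
    rfl
  rw [e] at hfin ⊢
  refine IsConfig.of_sum (fun j => ?_) hfin
  rcases j with i | i
  · exact hx i i.2
  · exact hx' i i.2

theorem isConfig_sum_dirac {d : ℕ} {S : Set (Space d)} {ι : Type*} [Fintype ι] {x : ι → Space d}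
    (hx : ∀ i, x i ∈ S) : IsConfig S (∑ i, Measure.dirac (x i)) := by
  rw [← Measure.sum_fintype]
  refine IsConfig.of_sum hx fun K _ => ?_
  rw [Measure.sum_fintype]
  exact measure_lt_top _ _

theorem isConfig_urep {d : ℕ} {S : Set (Space d)} {r : ℝ} {n : ℕ} {x : Fin n → Space d}
    (hx : x ∈ UPow S r n) (ξ : Config S) :
    IsConfig S ((∑ j, Measure.dirac (x j)) + ξ.1.restrict (S \ U S r)) :=
  (isConfig_sum_dirac fun j => (hx j).1).add (ξ.2.restrict _)

theorem urep_eq {d : ℕ} {S : Set (Space d)} (f : Config S → ℝ) {r : ℝ} {n : ℕ} {ξ : Config S}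
    (h : ξ.1 (U S r) = n) {x : Fin n → Space d} (hx : x ∈ UPow S r n) :
    urep f r n ξ x = f ⟨_, isConfig_urep hx ξ⟩ := by
  rw [urep, if_pos h, valueAt_eq f (isConfig_urep hx ξ)]

/-! ### Local smooth functions -/

theorem measurableSet_U {d : ℕ} {S : Set (Space d)} (hS : MeasurableSet S) (r : ℝ) :
    MeasurableSet (U S r) :=
  hS.inter Metric.isClosed_closedBall.measurableSet

theorem localSigma_mono {d : ℕ} {S : Set (Space d)} (hS : MeasurableSet S) {r r' : ℝ}
    (h : r ≤ r') : localSigma S r ≤ localSigma S r' := by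
  have hsub : U S r ⊆ U S r' := inter_subset_inter_right _ (Metric.closedBall_subset_closedBall h)
  have e : Config.restrict (S := S) (U S r)
      = Config.restrict (U S r) ∘ Config.restrict (U S r') := by
    funext ξ
    refine Subtype.ext ?_
    change ξ.1.restrict _ = (ξ.1.restrict _).restrict _
    rw [Measure.restrict_restrict (measurableSet_U hS r), inter_eq_left.2 hsub]
  rw [localSigma, e, ← MeasurableSpace.comap_comp]
  exact MeasurableSpace.comap_mono (measurable_restrict (measurableSet_U hS r)).comap_le

theorem IsLocal.measurable {d : ℕ} {S : Set (Space d)} (hS : MeasurableSet S) {f : Config S → ℝ}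
    (h : IsLocal f) : Measurable f := by
  obtain ⟨r, hr⟩ := h
  exact hr.mono (measurable_restrict (measurableSet_U hS r)).comap_le le_rfl

/-- Level sets of `f` are pulled back along $\pi_r$, so they cannot separate configurations that
agree on $U_r$. -/
theorem eq_of_restrict_eq {d : ℕ} {S : Set (Space d)} {f : Config S → ℝ} {r : ℝ}
    (h : Measurable[localSigma S r] f) {ξ η : Config S}
    (he : ξ.1.restrict (U S r) = η.1.restrict (U S r)) : f ξ = f η := by
  obtain ⟨B, -, hB⟩ := h (measurableSet_singleton (f ξ))
  have he' : Config.restrict (U S r) ξ = Config.restrict (U S r) η := Subtype.ext he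
  have h1 : ξ ∈ Config.restrict (S := S) (U S r) ⁻¹' B := by rw [hB]; rfl
  have h2 : η ∈ Config.restrict (S := S) (U S r) ⁻¹' B := by
    rw [mem_preimage, ← he']; exact h1
  rw [hB] at h2
  exact (h2 : f η = f ξ).symm

/-- The two-variable form covers sums, products, multiples and contractions at once. -/
theorem IsLocalSmooth.comp₂ {d : ℕ} {S : Set (Space d)} (hS : MeasurableSet S)
    {f g : Config S → ℝ} (hf : IsLocalSmooth f) (hg : IsLocalSmooth g) {G : ℝ × ℝ → ℝ}
    (hG : ContDiff ℝ ∞ G) : IsLocalSmooth fun ξ => G (f ξ, g ξ) := by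
  obtain ⟨⟨r, hr⟩, hf⟩ := hf
  obtain ⟨⟨r', hr'⟩, hg⟩ := hg
  refine ⟨⟨max r r', ?_⟩, fun s n ξ => ?_⟩
  · have h1 : Measurable[localSigma S (max r r' : ℕ)] f :=
      hr.mono (localSigma_mono hS (by simp)) le_rfl
    have h2 : Measurable[localSigma S (max r r' : ℕ)] g :=
      hr'.mono (localSigma_mono hS (by simp)) le_rfl
    exact hG.continuous.measurable.comp
      (@Measurable.prodMk _ _ _ _ _ (_) f g h1 h2)
  · by_cases h : ξ.1 (U S s) = n
    · have hc : ContDiffOn ℝ ∞ (fun x => G (urep f s n ξ x, urep g s n ξ x)) (UPow S s n) :=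
        hG.comp_contDiffOn ((hf s n ξ).prodMk (hg s n ξ))
      refine hc.congr fun x hx => ?_
      rw [urep_eq _ h hx, urep_eq _ h hx, urep_eq _ h hx]
    · have : urep (fun ξ => G (f ξ, g ξ)) s n ξ = fun _ => 0 := by
        funext x; rw [urep, if_neg h]
      rw [this]; exact contDiffOn_const

theorem IsLocalSmooth.comp {d : ℕ} {S : Set (Space d)} (hS : MeasurableSet S)
    {f : Config S → ℝ} (hf : IsLocalSmooth f) {G : ℝ → ℝ} (hG : ContDiff ℝ ∞ G) :
    IsLocalSmooth fun ξ => G (f ξ) :=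
  hf.comp₂ hS hf (G := fun p => G p.1) (hG.comp contDiff_fst)

/-- In the coordinates of $U_s^n$ the statistic is $\sum_j\varphi(x_j)$ plus a constant contributed
by the outer particles. -/
theorem isLocalSmooth_pair {d : ℕ} {S : Set (Space d)} (hS : MeasurableSet S) (φ : C_c(Space d, ℝ))
    (hφ : ContDiff ℝ ∞ φ) : IsLocalSmooth fun ξ : Config S => pair φ ξ := by
  obtain ⟨R, hR⟩ : ∃ R : ℕ, ∀ x, (R : ℝ) < ‖x‖ → φ x = 0 := by
    obtain ⟨r, hr⟩ := φ.hasCompactSupport.isCompact.isBounded.subset_closedBall 0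
    refine ⟨⌈r⌉₊, fun x hx => image_eq_zero_of_notMem_tsupport fun h => ?_⟩
    have := hr h
    rw [mem_closedBall_zero_iff] at this
    exact absurd hx (not_lt.2 (this.trans (Nat.le_ceil r)))
  refine ⟨⟨R, ?_⟩, fun s n ξ => ?_⟩
  · have e : (fun ξ : Config S => pair φ ξ)
        = (fun ξ : Config S => pair φ ξ) ∘ Config.restrict (U S R) := by
      funext ξ
      change ∫ x, φ x ∂ξ.1 = ∫ x in U S R, φ x ∂ξ.1
      rw [← integral_indicator (measurableSet_U hS R)]
      refine integral_congr_ae ?_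
      filter_upwards [ξ.2.ae_mem] with x hx
      by_cases h : ‖x‖ ≤ R
      · have hxU : x ∈ U S R := ⟨hx.1, by simpa using h⟩
        rw [indicator_of_mem hxU]
      · rw [hR x (not_le.1 h)]
        by_cases hx : x ∈ U S R
        · rw [indicator_of_mem hx, hR x (not_le.1 h)]
        · rw [indicator_of_notMem hx]
    rw [e]
    exact (measurable_pair_cc φ).comp (comap_measurable _)
  · by_cases h : ξ.1 (U S s) = n
    · have hc : ContDiffOn ℝ ∞ (fun x : Fin n → Space d =>
          (∑ j, φ (x j)) + ∫ y, φ y ∂(ξ.1.restrict (S \ U S s))) (UPow S s n) := by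
        refine ContDiff.contDiffOn (ContDiff.add (ContDiff.sum fun j _ => ?_) contDiff_const)
        exact hφ.comp (contDiff_apply ℝ (Space d) j)
      refine hc.congr fun x hx => ?_
      rw [urep_eq _ h hx]
      change ∫ y, φ y ∂((∑ j, Measure.dirac (x j)) + ξ.1.restrict (S \ U S s)) = _
      have hint : ∀ j, Integrable φ (Measure.dirac (x j)) := fun j =>
        φ.continuous.integrable_of_hasCompactSupport φ.hasCompactSupport
      rw [integral_add_measure, integral_finsetSum_measure fun j _ => hint j]
      · simp
      · exact integrable_finsetSum_measure.2 fun j _ => hint j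
      · exact (integrable_cc φ ξ).restrict
    · have : urep (fun ξ : Config S => pair φ ξ) s n ξ = fun _ => 0 := by
        funext x; rw [urep, if_neg h]
      rw [this]; exact contDiffOn_const

/-! ### Increments and energy -/

/-- The increment `f(ξ^{xy}) - f(ξ)`. -/
def incr {d : ℕ} {S : Set (Space d)} (f : Config S → ℝ) (z : (Config S × Space d) × Space d) : ℝ :=
  f (jumpMap z) - f z.1.1

/-- Only the moved particle contributes. Energies of functions of linear statistics thereby reduce
to pointwise estimates on $\mathbb R^d$. -/
theorem incr_pair {d : ℕ} {S : Set (Space d)} (φ : C_c(Space d, ℝ))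
    {z : (Config S × Space d) × Space d} (h : z ∈ jumpSet S) :
    incr (fun ξ : Config S => pair φ ξ) z = φ z.2 - φ z.1.2 := by
  have hint : ∀ x, Integrable φ (Measure.dirac x) := fun x =>
    φ.continuous.integrable_of_hasCompactSupport φ.hasCompactSupport
  have hle := (z.1.1.2.sub_add h.1 h.2).2
  have e : z.1.1.1 = z.1.1.1 - Measure.dirac z.1.2 + Measure.dirac z.1.2 :=
    (Measure.sub_add_cancel_of_le hle).symm
  have h1 : Integrable φ (z.1.1.1 - Measure.dirac z.1.2) :=
    (integrable_cc φ z.1.1).mono_measure Measure.sub_le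
  rw [incr, jumpMap_of_mem h]
  change ∫ y, φ y ∂(z.1.1.1 - Measure.dirac z.1.2 + Measure.dirac z.2) - ∫ y, φ y ∂z.1.1.1 = _
  rw [integral_add_measure h1 (hint _)]
  nth_rw 2 [e]
  rw [integral_add_measure h1 (hint _), integral_dirac, integral_dirac]
  ring

theorem measurable_incr {d : ℕ} {S : Set (Space d)} (hS : MeasurableSet S) {f : Config S → ℝ}
    (hf : Measurable f) : Measurable (incr f) :=
  (hf.comp (measurable_jumpMap hS)).sub (hf.comp (measurable_fst.comp measurable_fst))

/-- The measure `μ(dξ) ξ(dx) 1_S(y) dy`. -/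
def jumpMeasure {d : ℕ} {S : Set (Space d)} (μ : Measure (Config S)) :
    Measure ((Config S × Space d) × Space d) :=
  (μ.compProd (configKernel S)).prod (volume.restrict S)

theorem lintegral_jumpMeasure {d : ℕ} {S : Set (Space d)} (μ : Measure (Config S)) [SFinite μ]
    {Ψ : (Config S × Space d) × Space d → ℝ≥0∞} (hΨ : Measurable Ψ) :
    ∫⁻ z, Ψ z ∂(jumpMeasure μ) = ∫⁻ ξ, ∫⁻ x, (∫⁻ y in S, Ψ ((ξ, x), y)) ∂ξ.1 ∂μ := by
  rw [jumpMeasure, lintegral_prod _ hΨ.aemeasurable,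
    Measure.lintegral_compProd hΨ.lintegral_prod_right']
  rfl

theorem ae_mem_jumpSet {d : ℕ} {S : Set (Space d)} (hS : MeasurableSet S) (ξ : Config S) :
    ∀ᵐ x ∂ξ.1, ∀ᵐ y ∂(volume.restrict S), ((ξ, x), y) ∈ jumpSet S := by
  filter_upwards [ξ.2.ae_mem] with x hx
  filter_upwards [ae_restrict_mem hS] with y hy
  exact ⟨hx.2, hy⟩

/-- The jump rate as a function of the triple `(ξ, x, y)`. -/
def rate {d : ℕ} {S : Set (Space d)} (ν : Config S → Space d → Space d → ℝ≥0)
    (z : (Config S × Space d) × Space d) : ℝ≥0 := ν z.1.1 z.1.2 z.2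

theorem measurable_rate {d : ℕ} {S : Set (Space d)} {ν : Config S → Space d → Space d → ℝ≥0}
    (hν : Measurable (fun z : Config S × Space d × Space d => ν z.1 z.2.1 z.2.2)) :
    Measurable (rate ν) :=
  hν.comp ((measurable_fst.comp measurable_fst).prodMk
    ((measurable_snd.comp measurable_fst).prodMk measurable_snd))

/-- Off `jumpSet` the two increments may differ by their default values, but such triples are
negligible for `jumpMeasure`. The gain is that `incr` is jointly measurable. -/
theorem energy_eq {d : ℕ} {S : Set (Space d)} (hS : MeasurableSet S)
    {ν : Config S → Space d → Space d → ℝ≥0} (hν : Measurable (rate ν))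
    (μ : Measure (Config S)) [SFinite μ] {f : Config S → ℝ} (hf : Measurable f) :
    energy ν μ f
      = (1 / 2) * ∫⁻ z, ENNReal.ofReal (incr f z ^ 2) * (rate ν z : ℝ≥0∞) ∂(jumpMeasure μ) := by
  have hm : Measurable fun z => ENNReal.ofReal (incr f z ^ 2) * (rate ν z : ℝ≥0∞) :=
    ((measurable_incr hS hf).pow_const 2).ennreal_ofReal.mul hν.coe_nnreal_ennreal
  rw [← lintegral_const_mul _ hm, lintegral_jumpMeasure μ (hm.const_mul _), energy]
  refine lintegral_congr fun ξ => ?_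
  rw [← lintegral_const_mul' _ _ (by simp)]
  refine lintegral_congr_ae ?_
  filter_upwards [ae_mem_jumpSet hS ξ] with x hx
  rw [← lintegral_const_mul' _ _ (by simp)]
  refine lintegral_congr_ae ?_
  filter_upwards [hx] with y hy
  rw [jumpDiff_eq f hy]
  rfl

theorem energy_le {d : ℕ} {S : Set (Space d)} (hS : MeasurableSet S)
    {ν : Config S → Space d → Space d → ℝ≥0} (hν : Measurable (rate ν))
    (μ : Measure (Config S)) [SFinite μ] {f g h : Config S → ℝ} (hf : Measurable f)
    (hg : Measurable g) (hh : Measurable h) {a b : ℝ} (ha : 0 ≤ a) (hb : 0 ≤ b)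
    (H : ∀ z, incr h z ^ 2 ≤ a * incr f z ^ 2 + b * incr g z ^ 2) :
    energy ν μ h ≤ ENNReal.ofReal a * energy ν μ f + ENNReal.ofReal b * energy ν μ g := by
  have hm : ∀ {f : Config S → ℝ}, Measurable f →
      Measurable fun z => ENNReal.ofReal (incr f z ^ 2) * (rate ν z : ℝ≥0∞) := fun hf =>
    ((measurable_incr hS hf).pow_const 2).ennreal_ofReal.mul hν.coe_nnreal_ennreal
  rw [energy_eq hS hν μ hf, energy_eq hS hν μ hg, energy_eq hS hν μ hh, mul_left_comm,
    mul_left_comm (ENNReal.ofReal b), ← mul_add, ← lintegral_const_mul _ (hm hf),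
    ← lintegral_const_mul _ (hm hg), ← lintegral_add_left ((hm hf).const_mul _)]
  gcongr with z
  rw [← mul_assoc, ← mul_assoc, ← add_mul, ← ENNReal.ofReal_mul ha, ← ENNReal.ofReal_mul hb,
    ← ENNReal.ofReal_add (by positivity) (by positivity)]
  gcongr
  exact H z

/-- The gradient `√ν (f(ξ^{xy}) - f(ξ))`. -/
def grad {d : ℕ} {S : Set (Space d)} (ν : Config S → Space d → Space d → ℝ≥0)
    (f : Config S → ℝ) (z : (Config S × Space d) × Space d) : ℝ := incr f z * √(rate ν z)

theorem measurable_grad {d : ℕ} {S : Set (Space d)} (hS : MeasurableSet S)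
    {ν : Config S → Space d → Space d → ℝ≥0} (hν : Measurable (rate ν)) {f : Config S → ℝ}
    (hf : Measurable f) : Measurable (grad ν f) :=
  (measurable_incr hS hf).mul hν.coe_nnreal_real.sqrt

theorem energy_eq_grad {d : ℕ} {S : Set (Space d)} (hS : MeasurableSet S)
    {ν : Config S → Space d → Space d → ℝ≥0} (hν : Measurable (rate ν))
    (μ : Measure (Config S)) [SFinite μ] {f : Config S → ℝ} (hf : Measurable f) :
    energy ν μ f = (1 / 2) * ∫⁻ z, ENNReal.ofReal (grad ν f z ^ 2) ∂(jumpMeasure μ) := by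
  rw [energy_eq hS hν μ hf]
  congr 1
  refine lintegral_congr fun z => ?_
  rw [grad, mul_pow, Real.sq_sqrt (NNReal.coe_nonneg (rate ν z)), ENNReal.ofReal_mul (sq_nonneg _),
    ENNReal.ofReal_coe_nnreal]

theorem memLp_grad_iff {d : ℕ} {S : Set (Space d)} (hS : MeasurableSet S)
    {ν : Config S → Space d → Space d → ℝ≥0} (hν : Measurable (rate ν))
    (μ : Measure (Config S)) [SFinite μ] {f : Config S → ℝ} (hf : Measurable f) :
    MemLp (grad ν f) 2 (jumpMeasure μ) ↔ energy ν μ f < ⊤ := by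
  have hm := measurable_grad hS hν hf
  rw [memLp_two_iff_integrable_sq hm.aestronglyMeasurable, energy_eq_grad hS hν μ hf]
  have h1 : Integrable (fun z => grad ν f z ^ 2) (jumpMeasure μ)
      ↔ ∫⁻ z, ENNReal.ofReal (grad ν f z ^ 2) ∂(jumpMeasure μ) < ⊤ := by
    rw [← hasFiniteIntegral_iff_ofReal (ae_of_all _ fun z => sq_nonneg _)]
    exact ⟨fun h => h.2, fun h => ⟨(hm.pow_const 2).aestronglyMeasurable, h⟩⟩
  rw [h1]
  constructor
  · intro h
    exact ENNReal.mul_lt_top (by simp) h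
  · intro h
    by_contra hn
    rw [not_lt_top_iff] at hn
    rw [hn] at h
    simp at h

/-- An iterated Bochner integral takes the value 0 where integrability fails. Square-integrable
gradients have an integrable product, so Fubini applies and the form is half an inner product. -/
theorem preForm_eq {d : ℕ} {S : Set (Space d)} (hS : MeasurableSet S)
    {ν : Config S → Space d → Space d → ℝ≥0}
    (μ : Measure (Config S)) [SFinite μ] {f g : Config S → ℝ}
    (hf : MemLp (grad ν f) 2 (jumpMeasure μ)) (hg : MemLp (grad ν g) 2 (jumpMeasure μ)) :
    preForm ν μ f g = (1 / 2) * ∫ z, grad ν f z * grad ν g z ∂(jumpMeasure μ) := by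
  have hint : Integrable (fun z => grad ν f z * grad ν g z) (jumpMeasure μ) := hf.integrable_mul hg
  rw [jumpMeasure] at hint ⊢
  rw [integral_prod _ hint, Measure.integral_compProd hint.integral_prod_left,
    ← integral_const_mul, preForm]
  refine integral_congr_ae (ae_of_all _ fun ξ => ?_)
  rw [squareField]
  congr 1
  refine integral_congr_ae ?_
  filter_upwards [ae_mem_jumpSet hS ξ] with x hx
  refine integral_congr_ae ?_
  filter_upwards [hx] with y hy
  rw [jumpDiff_eq f hy, jumpDiff_eq g hy]
  change incr f _ * incr g _ * (rate ν ((ξ, x), y) : ℝ) = _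
  rw [grad, grad]
  have := Real.mul_self_sqrt (NNReal.coe_nonneg (rate ν ((ξ, x), y)))
  rw [mul_mul_mul_comm]
  congr 1
  exact this.symm

/-! ### Energy estimates -/

/-- A reference weight on `ℝ^d`. -/
def weight {d : ℕ} (x : Space d) : ℝ := Real.exp (-bracket x)

theorem weight_pos {d : ℕ} (x : Space d) : 0 < weight x := Real.exp_pos _

theorem contDiff_weight {d : ℕ} : ContDiff ℝ ∞ (weight (d := d)) :=
  Real.contDiff_exp.comp contDiff_bracket.neg

/-- With $t=1+\|x\|$ the weight is at most $e\cdot e^{-t}$, and $t^n\le n!\,e^t$ for an integer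
$n\ge s$; this gives the constant $n!\,e$. -/
theorem exists_weight_le_rpow {d : ℕ} (s : ℝ) :
    ∃ K : ℝ, 0 < K ∧ ∀ x : Space d, weight x ≤ K * (1 + ‖x‖) ^ (-s) := by
  obtain ⟨n, hn⟩ := exists_nat_ge s
  have hf : (0 : ℝ) < n.factorial := by positivity
  refine ⟨n.factorial * Real.exp 1, by positivity, fun x => ?_⟩
  set t := 1 + ‖x‖ with ht
  have ht1 : 1 ≤ t := by simp [ht]
  have ht0 : 0 < t := by linarith
  have h1 : t ^ n / n.factorial ≤ Real.exp t := Real.pow_div_factorial_le_exp t ht0.le n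
  have h2 : t ^ s ≤ t ^ n := by
    rw [← Real.rpow_natCast t n]; exact Real.rpow_le_rpow_of_exponent_le ht1 hn
  have h3 : t ^ s ≤ n.factorial * Real.exp t := by
    rw [div_le_iff₀ hf] at h1; linarith
  have h4 : weight x ≤ Real.exp 1 * Real.exp (-t) := by
    rw [weight, ← Real.exp_add]
    exact Real.exp_le_exp.2 (by linarith [norm_le_bracket x])
  have h5 : Real.exp (-t) ≤ n.factorial * t ^ (-s) := by
    rw [Real.rpow_neg ht0.le, Real.exp_neg, inv_le_iff_one_le_mul₀ (Real.exp_pos t), mul_assoc,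
      mul_left_comm, ← div_eq_inv_mul, one_le_div (Real.rpow_pos_of_pos ht0 s)]
    exact h3
  calc weight x ≤ Real.exp 1 * Real.exp (-t) := h4
    _ ≤ Real.exp 1 * (n.factorial * t ^ (-s)) := by gcongr
    _ = n.factorial * Real.exp 1 * t ^ (-s) := by ring

/-- `φ` is bounded by a multiple of the weight, and so are its local difference quotients. -/
def WeightBounded {d : ℕ} (C : ℝ) (φ : Space d → ℝ) : Prop :=
  (∀ x, |φ x| ≤ C * weight x) ∧
    ∀ x y, ‖x - y‖ ≤ 1 → |φ y - φ x| ≤ C * weight x * ‖x - y‖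

/-- The constant comes from $|e^t-1|\le 2|t|$ for $|t|\le1$, as `bracket` is 1-Lipschitz. -/
theorem weightBounded_weight {d : ℕ} : WeightBounded 2 (weight (d := d)) := by
  refine ⟨fun x => ?_, fun x y h => ?_⟩
  · rw [abs_of_pos (weight_pos x)]; linarith [weight_pos x]
  · set t := bracket x - bracket y with ht
    have h1 : |t| ≤ ‖x - y‖ := abs_bracket_sub_le x y
    have e : weight y - weight x = weight x * (Real.exp t - 1) := by
      rw [weight, weight, mul_sub, ← Real.exp_add, mul_one, ht]; ring_nf
    rw [e, abs_mul, abs_of_pos (weight_pos x)]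
    have h2 := Real.abs_exp_sub_one_le (h1.trans h)
    nlinarith [weight_pos x]

/-- The new constant does not depend on `R`, so the energies stay bounded when the cut-off is
removed. -/
theorem WeightBounded.mul_cut {d : ℕ} {C : ℝ} {φ : Space d → ℝ} (h : WeightBounded C φ)
    {L : ℝ≥0} (hL : LipschitzWith L Real.smoothTransition) (R : ℝ) :
    WeightBounded (C * (1 + L)) (fun x => φ x * cut R x) := by
  have hC : ∀ x : Space d, 0 ≤ C * weight x := fun x => (abs_nonneg _).trans (h.1 x)
  have hCL : ∀ x : Space d, C * weight x ≤ C * (1 + L) * weight x := fun x => by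
    have := mul_nonneg (hC x) L.coe_nonneg
    linarith [show C * (1 + L) * weight x = C * weight x + C * weight x * L by ring]
  refine ⟨fun x => ?_, fun x y hxy => ?_⟩
  · rw [abs_mul, abs_of_nonneg (cut_nonneg R x)]
    refine (mul_le_of_le_one_right (abs_nonneg _) (cut_le_one R x)).trans ((h.1 x).trans (hCL x))
  · have e : φ y * cut R y - φ x * cut R x
        = (φ y - φ x) * cut R y + φ x * (cut R y - cut R x) := by ring
    have h1 : |cut R y - cut R x| ≤ L * ‖x - y‖ := by
      have h2 := hL.dist_le_mul (R + 2 - bracket y) (R + 2 - bracket x)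
      rw [Real.dist_eq, Real.dist_eq] at h2
      refine h2.trans (mul_le_mul_of_nonneg_left ?_ L.2)
      have : R + 2 - bracket y - (R + 2 - bracket x) = bracket x - bracket y := by ring
      rw [this]
      exact abs_bracket_sub_le x y
    calc |φ y * cut R y - φ x * cut R x|
        ≤ |φ y - φ x| * cut R y + |φ x| * |cut R y - cut R x| := by
          rw [e]
          refine (abs_add_le _ _).trans_eq ?_
          rw [abs_mul, abs_mul, abs_of_nonneg (cut_nonneg R y)]
      _ ≤ C * weight x * ‖x - y‖ * 1 + C * weight x * (L * ‖x - y‖) := by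
          have h3 := h.2 x y hxy
          have h4 := hC x
          refine add_le_add (mul_le_mul h3 (cut_le_one R y) (cut_nonneg R y) (by positivity)) ?_
          exact mul_le_mul (h.1 x) h1 (abs_nonneg _) h4
      _ = C * (1 + L) * weight x * ‖x - y‖ := by ring

/-- If the support lies in the ball of radius `r`, then beyond radius $r+1$ a point and all points
within distance 1 of it miss the support, while inside that radius the weight is at least
$e^{-(r+2)}$. -/
theorem weightBounded_of_contDiff {d : ℕ} {φ : Space d → ℝ} (hφ : ContDiff ℝ ∞ φ)
    (hs : HasCompactSupport φ) : ∃ C, WeightBounded C φ := by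
  obtain ⟨L, hL⟩ := hφ.lipschitzWith_of_hasCompactSupport hs (by simp)
  obtain ⟨r, hr⟩ := hs.isCompact.isBounded.subset_closedBall 0
  have hzero : ∀ x, r < ‖x‖ → φ x = 0 := fun x hx =>
    image_eq_zero_of_notMem_tsupport fun h => by
      have := hr h
      rw [mem_closedBall_zero_iff] at this
      linarith
  obtain ⟨B, hB⟩ := hs.exists_bound_of_continuous hφ.continuous
  have hB0 : 0 ≤ B := (norm_nonneg _).trans (hB 0)
  have hw : ∀ x : Space d, ‖x‖ ≤ r + 1 → 1 ≤ Real.exp (r + 2) * weight x := fun x hx => by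
    rw [weight, ← Real.exp_add]
    exact Real.one_le_exp (by linarith [bracket_le x])
  refine ⟨(B + L) * Real.exp (r + 2), fun x => ?_, fun x y hxy => ?_⟩
  · by_cases hx : ‖x‖ ≤ r + 1
    · have := hB x
      rw [Real.norm_eq_abs] at this
      calc |φ x| ≤ (B + L) * 1 := by linarith [L.2, show (0 : ℝ) ≤ L from L.2]
        _ ≤ (B + L) * (Real.exp (r + 2) * weight x) := by gcongr; exact hw x hx
        _ = _ := by ring
    · rw [hzero x (by linarith), abs_zero]
      have := weight_pos x
      positivity
  · by_cases hx : ‖x‖ ≤ r + 1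
    · have h1 := hL.dist_le_mul y x
      rw [Real.dist_eq, dist_eq_norm, norm_sub_rev] at h1
      calc |φ y - φ x| ≤ L * ‖x - y‖ := h1
        _ ≤ (B + L) * 1 * ‖x - y‖ := by gcongr; linarith
        _ ≤ (B + L) * (Real.exp (r + 2) * weight x) * ‖x - y‖ := by gcongr; exact hw x hx
        _ = _ := by ring
    · have hy : r < ‖y‖ := by
        have := norm_sub_norm_le x y
        linarith
      rw [hzero x (by linarith), hzero y hy, sub_zero, abs_zero]
      have := weight_pos x
      positivity

/-- The profile `r^{-(d+β)}` for `r ≤ 1`, `r^{-(d+α)}` for `r > 1`, dominates `p`. -/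
theorem exists_profile_bound {p : ℝ → ℝ} {a b : ℝ} (ha : 0 < a) (hb : 0 < b)
    (hp : ∀ a b : ℝ, 0 < a → ∃ M : ℝ, ∀ r ∈ Set.Icc a b, |p r| ≤ M)
    (hB2 : p =O[atTop] (fun r => r ^ (-a))) (hB3 : p =O[𝓝[>] 0] (fun r => r ^ (-b))) :
    ∃ M : ℝ, 0 < M ∧ (∀ r, 0 < r → r ≤ 1 → |p r| ≤ M * r ^ (-b)) ∧
      ∀ r, 1 < r → |p r| ≤ M * r ^ (-a) := by
  obtain ⟨c₁, hc₁, h₁⟩ := hB2.exists_pos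
  obtain ⟨c₂, hc₂, h₂⟩ := hB3.exists_pos
  obtain ⟨R, hR⟩ := eventually_atTop.1 h₁.bound
  obtain ⟨e, he, hI⟩ := mem_nhdsGT_iff_exists_Ioo_subset.1 h₂.bound
  replace hI : Ioo 0 (min e 1) ⊆ _ := fun r hr => hI ⟨hr.1, hr.2.trans_le (min_le_left _ _)⟩
  replace he : 0 < min e 1 := lt_min he one_pos
  have he1 : min e 1 ≤ 1 := min_le_right _ _
  generalize min e 1 = e at hI he he1
  obtain ⟨M₃, hM₃⟩ := hp (e / 2) (max R 1) (by linarith)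
  set B := max R 1 with hB
  have hB1 : 1 ≤ B := le_max_right _ _
  have hBa : 1 ≤ B ^ a := Real.one_le_rpow hB1 ha.le
  -- The last term serves the compact middle range, where $r^{-a}\ge B^{-a}$ for $1<r\le B$ and
  -- $r^{-b}\ge1$ for $r\le1$.
  refine ⟨c₁ + c₂ + |M₃| * B ^ a, by positivity, fun r hr0 hr1 => ?_, fun r hr1 => ?_⟩
  · have hpos : 0 < r ^ (-b) := Real.rpow_pos_of_pos hr0 _
    by_cases hre : r < e
    · have h := hI ⟨hr0, hre⟩
      simp only [mem_ofPred_eq, Real.norm_eq_abs, abs_of_pos hpos] at h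
      refine h.trans ?_
      gcongr
      have : 0 ≤ |M₃| * B ^ a := by positivity
      linarith
    · have h := hM₃ r ⟨by linarith, hr1.trans hB1⟩
      have h1 : 1 ≤ r ^ (-b) := Real.one_le_rpow_of_pos_of_le_one_of_nonpos hr0 hr1 (by linarith)
      calc |p r| ≤ |M₃| * 1 := by rw [mul_one]; exact h.trans (le_abs_self _)
        _ ≤ |M₃| * B ^ a := by gcongr
        _ ≤ (c₁ + c₂ + |M₃| * B ^ a) * 1 := by linarith
        _ ≤ _ := by gcongr
  · have hr0 : 0 < r := by linarith
    have hpos : 0 < r ^ (-a) := Real.rpow_pos_of_pos hr0 _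
    by_cases hre : R ≤ r
    · have h := hR r hre
      simp only [Real.norm_eq_abs, abs_of_pos hpos] at h
      refine h.trans ?_
      gcongr
      have : 0 ≤ |M₃| * B ^ a := by positivity
      linarith
    · have hrB : r ≤ B := (not_le.1 hre).le.trans (le_max_left _ _)
      have h := hM₃ r ⟨by linarith, hrB⟩
      have h1 : 1 ≤ B ^ a * r ^ (-a) := by
        rw [Real.rpow_neg hr0.le, ← div_eq_mul_inv, one_le_div (Real.rpow_pos_of_pos hr0 a)]
        exact Real.rpow_le_rpow hr0.le hrB ha.le
      calc |p r| ≤ |M₃| * 1 := by rw [mul_one]; exact h.trans (le_abs_self _)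
        _ ≤ |M₃| * (B ^ a * r ^ (-a)) := by gcongr
        _ ≤ (c₁ + c₂ + |M₃| * B ^ a) * r ^ (-a) := by nlinarith

/-- The local part of the dominating jump kernel. -/
def nearKernel (d : ℕ) (β : ℝ) (z : Space d) : ℝ :=
  (Metric.closedBall 0 1).indicator (fun z => ‖z‖ ^ (-((d : ℝ) + β - 2))) z

theorem nearKernel_nonneg {d : ℕ} (β : ℝ) (z : Space d) : 0 ≤ nearKernel d β z :=
  indicator_nonneg (fun _ _ => by positivity) _

theorem measurable_nearKernel {d : ℕ} (β : ℝ) : Measurable (nearKernel d β) :=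
  (measurable_norm.pow_const _).indicator Metric.isClosed_closedBall.measurableSet

/-- The singularity at the origin has order $d+\beta-2<d$. -/
theorem lintegral_nearKernel_lt_top {d : ℕ} (hd : 0 < d) {β : ℝ} (hβ : β < 2) :
    ∫⁻ z, ENNReal.ofReal (nearKernel d β z) < ⊤ := by
  have h : IntegrableOn (nearKernel d β) (Metric.ball 0 2) := by
    refine integrableOn_ball_of_norm_le_rpow (C := 1) (α := (d : ℝ) + β - 2) ?_ ?_
      (ae_of_all _ fun z => ?_) (measurable_nearKernel β).aestronglyMeasurable
    · simpa using Nat.succ_le_of_lt hd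
    · simp; linarith
    · rw [Real.norm_of_nonneg (nearKernel_nonneg β z), one_mul]
      exact indicator_le_self' (fun _ _ => by positivity) z
  have h2 : Integrable (nearKernel d β) := by
    refine (integrableOn_iff_integrable_of_support_subset fun z hz => ?_).1 h
    by_contra hz'
    refine hz (indicator_of_notMem (fun hz1 => hz' ?_) _)
    exact Metric.closedBall_subset_ball (by norm_num) hz1
  exact (hasFiniteIntegral_iff_ofReal (ae_of_all _ (nearKernel_nonneg β))).1 h2.2

/-- The kernel which dominates the squared increments of weight-bounded statistics. -/
def dominator (d : ℕ) (s β : ℝ) (x y : Space d) : ℝ :=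
  (1 + ‖x‖) ^ (-s) *
    (nearKernel d β (x - y) + (1 + ‖x - y‖) ^ (-s) + (1 + ‖y‖) ^ (-s))

theorem dominator_nonneg {d : ℕ} (s β : ℝ) (x y : Space d) : 0 ≤ dominator d s β x y := by
  have := nearKernel_nonneg β (x - y)
  unfold dominator
  positivity

/-- The purpose is a bound of the form $(1+|x|)^{-s}$ times functions of `y` with integral
independent of `x`, where $s=d+\alpha$. Jumps of length at most 1 use the difference quotients of
$\varphi$, longer ones only its size and the decay of `p`. -/
theorem exists_increment_bound {d : ℕ} {C₁ : ℝ} {p : ℝ → ℝ} {α β : ℝ} (hα : 0 < α) (hβ : 0 < β)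
    (hp : ∀ a b : ℝ, 0 < a → ∃ M : ℝ, ∀ r ∈ Set.Icc a b, |p r| ≤ M)
    (hB2 : p =O[atTop] (fun r => r ^ (-((d : ℝ) + α))))
    (hB3 : p =O[𝓝[>] 0] (fun r => r ^ (-((d : ℝ) + β)))) :
    ∃ M : ℝ, 0 < M ∧ ∀ (C : ℝ) (φ : Space d → ℝ), WeightBounded C φ → ∀ (x y : Space d) (t : ℝ),
      0 ≤ t → t ≤ C₁ * p ‖x - y‖ →
      (φ y - φ x) ^ 2 * t ≤ C ^ 2 * (M * dominator d (d + α) β x y) := by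
  obtain ⟨M, hM, hM1, hM2⟩ := exists_profile_bound (a := d + α) (b := d + β) (by positivity)
    (by positivity) hp hB2 hB3
  set s : ℝ := d + α with hs
  have hs0 : 0 < s := by positivity
  obtain ⟨K, hK, hKw⟩ := exists_weight_le_rpow (d := d) s
  have hMC : 0 ≤ M * |C₁| := by positivity
  refine ⟨(M * |C₁| + 1) * (K ^ 2 * (2 * 2 ^ s) + K ^ 2), by positivity,
    fun C φ hφ x y t ht0 ht => ?_⟩
  have hnn : 0 ≤ nearKernel d β (x - y) := nearKernel_nonneg β _
  have hrhs : ∀ {A : ℝ}, A ≤ C ^ 2 * (M * |C₁| * ((K ^ 2 * (2 * 2 ^ s) + K ^ 2) * dominator d s β x y)) →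
      A ≤ C ^ 2 * ((M * |C₁| + 1) * (K ^ 2 * (2 * 2 ^ s) + K ^ 2) * dominator d s β x y) := by
    intro A hA
    refine hA.trans ?_
    have := dominator_nonneg s β x y
    rw [mul_assoc (M * |C₁| + 1)]
    gcongr
    linarith
  apply hrhs
  -- Nothing is known about `p` at 0, but the increment vanishes on the diagonal.
  rcases eq_or_ne x y with rfl | hne
  · have := dominator_nonneg s β x x
    rw [sub_self]; simp only [ne_eq, OfNat.ofNat_ne_zero, not_false_eq_true, zero_pow, zero_mul]
    positivity
  have hr : 0 < ‖x - y‖ := norm_pos_iff.2 (sub_ne_zero.2 hne)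
  have htp : t ≤ |C₁| * |p ‖x - y‖| := ht.trans ((le_abs_self _).trans_eq (abs_mul _ _))
  have hwx : weight x ^ 2 ≤ K ^ 2 * (1 + ‖x‖) ^ (-s) := by
    have h1 : (1 + ‖x‖) ^ (-s) ≤ 1 :=
      Real.rpow_le_one_of_one_le_of_nonpos (by simp) (by linarith)
    have h2 : 0 ≤ (1 + ‖x‖) ^ (-s) := by positivity
    calc weight x ^ 2 ≤ (K * (1 + ‖x‖) ^ (-s)) ^ 2 :=
          pow_le_pow_left₀ (weight_pos x).le (hKw x) 2
      _ = K ^ 2 * ((1 + ‖x‖) ^ (-s) * (1 + ‖x‖) ^ (-s)) := by ring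
      _ ≤ K ^ 2 * ((1 + ‖x‖) ^ (-s) * 1) := by gcongr
      _ = _ := by ring
  by_cases hle : ‖x - y‖ ≤ 1
  · have h1 := hφ.2 x y hle
    have h2 : (φ y - φ x) ^ 2 ≤ C ^ 2 * weight x ^ 2 * ‖x - y‖ ^ 2 := by
      rw [← sq_abs (φ y - φ x)]
      calc |φ y - φ x| ^ 2 ≤ (C * weight x * ‖x - y‖) ^ 2 :=
            pow_le_pow_left₀ (abs_nonneg _) h1 2
        _ = _ := by ring
    have h3 : t ≤ M * |C₁| * ‖x - y‖ ^ (-((d : ℝ) + β)) := by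
      refine htp.trans ?_
      rw [mul_comm M, mul_assoc]
      exact mul_le_mul_of_nonneg_left (hM1 _ hr hle) (abs_nonneg _)
    -- The squared increment lowers the order of the singularity by 2.
    have h4 : ‖x - y‖ ^ 2 * ‖x - y‖ ^ (-((d : ℝ) + β)) = nearKernel d β (x - y) := by
      rw [nearKernel, indicator_of_mem (by simpa using hle), ← Real.rpow_natCast,
        ← Real.rpow_add hr]
      congr 1
      push_cast; ring
    calc (φ y - φ x) ^ 2 * t
        ≤ (C ^ 2 * weight x ^ 2 * ‖x - y‖ ^ 2) * (M * |C₁| * ‖x - y‖ ^ (-((d : ℝ) + β))) := by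
          gcongr
      _ = C ^ 2 * (M * |C₁| * (weight x ^ 2 * nearKernel d β (x - y))) := by rw [← h4]; ring
      _ ≤ C ^ 2 * (M * |C₁| * ((K ^ 2 * (1 + ‖x‖) ^ (-s)) *
            (nearKernel d β (x - y) + (1 + ‖x - y‖) ^ (-s) + (1 + ‖y‖) ^ (-s)))) := by
          have e1 : 0 ≤ (1 + ‖x - y‖) ^ (-s) := by positivity
          have e2 : 0 ≤ (1 + ‖y‖) ^ (-s) := by positivity
          gcongr
          linarith
      _ = C ^ 2 * (M * |C₁| * (K ^ 2 * dominator d s β x y)) := by rw [dominator]; ring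
      _ ≤ _ := by
          have := dominator_nonneg s β x y
          gcongr
          have : 0 ≤ K ^ 2 * (2 * 2 ^ s) := by positivity
          linarith
  · have hlt := not_le.1 hle
    have hC2 : ∀ u, φ u ^ 2 ≤ C ^ 2 * weight u ^ 2 := fun u => by
      rw [← sq_abs (φ u), ← mul_pow]
      exact pow_le_pow_left₀ (abs_nonneg _) (hφ.1 u) 2
    have h2 : (φ y - φ x) ^ 2 ≤ C ^ 2 * (2 * (weight x ^ 2 + weight y ^ 2)) := by
      nlinarith [hC2 x, hC2 y, sq_nonneg (φ y + φ x)]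
    -- For $r>1$ one has $r\ge(1+r)/2$, whence the factor $2^s$.
    have h3 : t ≤ M * |C₁| * (2 ^ s * (1 + ‖x - y‖) ^ (-s)) := by
      refine htp.trans ?_
      rw [mul_comm M, mul_assoc]
      refine mul_le_mul_of_nonneg_left ((hM2 _ hlt).trans ?_) (abs_nonneg _)
      refine mul_le_mul_of_nonneg_left ?_ hM.le
      have e1 : (2 : ℝ) ^ s * (1 + ‖x - y‖) ^ (-s) = ((1 + ‖x - y‖) / 2) ^ (-s) := by
        rw [Real.div_rpow (by positivity) (by norm_num), Real.rpow_neg (by norm_num : (0:ℝ) ≤ 2)]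
        field_simp
      rw [e1]
      exact Real.rpow_le_rpow_of_nonpos (by positivity) (by linarith) (by linarith)
    -- Submultiplicativity of $1+\|\cdot\|$ lets one factor of decay at `y` and the decay in $x-y$
    -- combine to decay at `x`; the second factor at `y` is kept for integrability.
    have h5 : weight y ^ 2 * (1 + ‖x - y‖) ^ (-s) ≤ K ^ 2 * ((1 + ‖x‖) ^ (-s) * (1 + ‖y‖) ^ (-s)) := by
      have e1 : 1 + ‖x‖ ≤ (1 + ‖x - y‖) * (1 + ‖y‖) := by
        have := norm_le_norm_sub_add x y
        nlinarith [norm_nonneg (x - y), norm_nonneg y]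
      have e2 : ((1 + ‖x - y‖) * (1 + ‖y‖)) ^ (-s) ≤ (1 + ‖x‖) ^ (-s) :=
        Real.rpow_le_rpow_of_nonpos (by positivity) e1 (by linarith)
      rw [Real.mul_rpow (by positivity) (by positivity)] at e2
      calc weight y ^ 2 * (1 + ‖x - y‖) ^ (-s)
          ≤ (K * (1 + ‖y‖) ^ (-s)) ^ 2 * (1 + ‖x - y‖) ^ (-s) := by
            gcongr
            · exact (weight_pos y).le
            · exact hKw y
        _ = K ^ 2 * ((1 + ‖x - y‖) ^ (-s) * (1 + ‖y‖) ^ (-s)) * (1 + ‖y‖) ^ (-s) := by ring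
        _ ≤ K ^ 2 * (1 + ‖x‖) ^ (-s) * (1 + ‖y‖) ^ (-s) := by gcongr
        _ = _ := by ring
    have hX : 0 ≤ (1 + ‖x‖) ^ (-s) := by positivity
    have hE : 0 ≤ (1 + ‖x - y‖) ^ (-s) := by positivity
    calc (φ y - φ x) ^ 2 * t
        ≤ (C ^ 2 * (2 * (weight x ^ 2 + weight y ^ 2))) *
            (M * |C₁| * (2 ^ s * (1 + ‖x - y‖) ^ (-s))) := by gcongr
      _ = C ^ 2 * (M * |C₁| * (2 * 2 ^ s * (weight x ^ 2 * (1 + ‖x - y‖) ^ (-s)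
            + weight y ^ 2 * (1 + ‖x - y‖) ^ (-s)))) := by ring
      _ ≤ C ^ 2 * (M * |C₁| * (2 * 2 ^ s * (K ^ 2 * (1 + ‖x‖) ^ (-s) * (1 + ‖x - y‖) ^ (-s)
            + K ^ 2 * ((1 + ‖x‖) ^ (-s) * (1 + ‖y‖) ^ (-s))))) := by gcongr
      _ ≤ C ^ 2 * (M * |C₁| * (2 * 2 ^ s * (K ^ 2 * ((1 + ‖x‖) ^ (-s) *
            (nearKernel d β (x - y) + (1 + ‖x - y‖) ^ (-s) + (1 + ‖y‖) ^ (-s)))))) := by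
          gcongr
          nlinarith [mul_nonneg (mul_nonneg (sq_nonneg K) hX) hnn]
      _ = C ^ 2 * (M * |C₁| * (K ^ 2 * (2 * 2 ^ s) * dominator d s β x y)) := by
          rw [dominator]; ring
      _ ≤ _ := by
          have := dominator_nonneg s β x y
          gcongr
          linarith [sq_nonneg K]

/-! ### The Campbell formula and finiteness of the energy -/

/-- Campbell's formula at the level of measures. The intensity is prescribed on bounded subsets of
`S`; both sides vanish off `S`, and balls exhaust the space. -/
theorem IsCorrelation.bind_eq {d : ℕ} {S : Set (Space d)} (hS : MeasurableSet S)
    {μ : Measure (Config S)} {ρ : Space d → ℝ≥0} (hρ : IsCorrelation μ ρ) :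
    μ.bind (fun ξ => ξ.1) = (volume.restrict S).withDensity (fun x => (ρ x : ℝ≥0∞)) := by
  have hval : AEMeasurable (fun ξ : Config S => ξ.1) μ := (measurable_val S).aemeasurable
  ext A hA
  have hAR : ∀ n : ℕ, MeasurableSet (A ∩ S ∩ Metric.closedBall 0 (n : ℝ)) := fun n =>
    (hA.inter hS).inter Metric.isClosed_closedBall.measurableSet
  have hmono : Monotone fun n : ℕ => A ∩ S ∩ Metric.closedBall 0 (n : ℝ) := fun m n h =>
    inter_subset_inter_right _ (Metric.closedBall_subset_closedBall (by exact_mod_cast h))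
  have hU : ⋃ n : ℕ, A ∩ S ∩ Metric.closedBall 0 (n : ℝ) = A ∩ S := by
    rw [← inter_iUnion, inter_eq_left]
    intro x _
    exact mem_iUnion.2 ⟨⌈‖x‖⌉₊, by simpa using Nat.le_ceil ‖x‖⟩
  have h1 : μ.bind (fun ξ => ξ.1) A = μ.bind (fun ξ => ξ.1) (A ∩ S) := by
    rw [Measure.bind_apply hA hval, Measure.bind_apply (hA.inter hS) hval]
    refine lintegral_congr fun ξ => measure_congr ?_
    filter_upwards [ξ.2.ae_mem] with x hx
    exact propext ⟨fun h => ⟨h, hx.1⟩, fun h => h.1⟩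
  have h2 : (volume.restrict S).withDensity (fun x => (ρ x : ℝ≥0∞)) A
      = (volume.restrict S).withDensity (fun x => (ρ x : ℝ≥0∞)) (A ∩ S) := by
    rw [withDensity_apply _ hA, withDensity_apply _ (hA.inter hS), Measure.restrict_restrict hA,
      Measure.restrict_restrict (hA.inter hS), inter_assoc, inter_self]
  rw [h1, h2, ← hU, hmono.measure_iUnion, hmono.measure_iUnion]
  congr 1
  funext n
  rw [Measure.bind_apply (hAR n) hval, withDensity_apply _ (hAR n), Measure.restrict_restrict (hAR n),
    show A ∩ S ∩ Metric.closedBall 0 (n : ℝ) ∩ S = A ∩ S ∩ Metric.closedBall 0 (n : ℝ) from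
      inter_eq_left.2 fun x hx => hx.1.2]
  exact (hρ.2 _ (fun x hx => hx.1.2) (hAR n)
    (Metric.isBounded_closedBall.subset inter_subset_right)).symm

theorem IsCorrelation.lintegral_eq {d : ℕ} {S : Set (Space d)} (hS : MeasurableSet S)
    {μ : Measure (Config S)} {ρ : Space d → ℝ≥0} (hρ : IsCorrelation μ ρ)
    {F : Space d → ℝ≥0∞} (hF : Measurable F) :
    ∫⁻ ξ, ∫⁻ x, F x ∂ξ.1 ∂μ = ∫⁻ x in S, ρ x * F x := by
  rw [← Measure.lintegral_bind (measurable_val S).aemeasurable hF.aemeasurable, hρ.bind_eq hS,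
    lintegral_withDensity_eq_lintegral_mul _ hρ.1.coe_nnreal_ennreal hF]
  rfl

/-- In a large ball the integral is at most the mean number of particles. Outside it the integrand
is $O((1+|x|)^{-(d+\alpha-\kappa)})$, integrable because $\alpha>\kappa$. -/
theorem lintegral_rpow_lt_top {d : ℕ} {S : Set (Space d)} (hS : MeasurableSet S)
    {μ : Measure (Config S)} [IsProbabilityMeasure μ] {ρ : Space d → ℝ≥0}
    (hρ : IsCorrelation μ ρ) {κ : ℝ} (hκ : 0 ≤ κ)
    (hB1 : (fun x => (ρ x : ℝ)) =O[Bornology.cobounded (Space d) ⊓ 𝓟 S] (fun x => ‖x‖ ^ κ))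
    (hL2 : ∀ r : ℕ, MemLp (count (S := S) r) 2 μ) {α : ℝ} (hα : κ < α) :
    ∫⁻ ξ, ∫⁻ x, ENNReal.ofReal ((1 + ‖x‖) ^ (-((d : ℝ) + α))) ∂ξ.1 ∂μ < (⊤ : ℝ≥0∞) := by
  have hmeas : ∀ s : ℝ, Measurable fun x : Space d => ENNReal.ofReal ((1 + ‖x‖) ^ s) := fun s =>
    ((measurable_const.add measurable_norm).pow_const s).ennreal_ofReal
  rw [hρ.lintegral_eq hS (hmeas _)]
  obtain ⟨c, hc⟩ := hB1.isBigOWith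
  have hc' := hc.bound
  rw [eventually_inf_principal] at hc'
  obtain ⟨R, -, hR⟩ := (Metric.hasBasis_cobounded_compl_closedBall (0 : Space d)).eventually_iff.1 hc'
  set n : ℕ := ⌈R⌉₊
  have hle : ∀ x ∈ S, (ρ x : ℝ≥0∞) * ENNReal.ofReal ((1 + ‖x‖) ^ (-((d : ℝ) + α)))
      ≤ (U S n).indicator (fun x => (ρ x : ℝ≥0∞)) x
        + ENNReal.ofReal |c| * ENNReal.ofReal ((1 + ‖x‖) ^ (-((d : ℝ) + α - κ))) := by
    intro x hxS
    have hd : (0 : ℝ) ≤ d := Nat.cast_nonneg d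
    by_cases hx : x ∈ U S n
    · rw [indicator_of_mem hx]
      refine le_add_right ?_
      refine mul_le_of_le_one_right' ?_
      rw [← ENNReal.ofReal_one]
      exact ENNReal.ofReal_le_ofReal
        (Real.rpow_le_one_of_one_le_of_nonpos (by simp) (by linarith))
    · rw [indicator_of_notMem hx, zero_add]
      have hxR : x ∉ Metric.closedBall 0 R := fun h => hx ⟨hxS, by
        rw [mem_closedBall_zero_iff] at h ⊢
        exact h.trans (Nat.le_ceil R)⟩
      have h1 := hR hxR hxS
      rw [Real.norm_of_nonneg (NNReal.coe_nonneg _), Real.norm_of_nonneg (by positivity)] at h1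
      rw [← ENNReal.ofReal_coe_nnreal, ← ENNReal.ofReal_mul (NNReal.coe_nonneg _),
        ← ENNReal.ofReal_mul (abs_nonneg _)]
      refine ENNReal.ofReal_le_ofReal ?_
      have e : (1 + ‖x‖) ^ (-((d : ℝ) + α - κ)) = (1 + ‖x‖) ^ κ * (1 + ‖x‖) ^ (-((d : ℝ) + α)) := by
        rw [← Real.rpow_add (by positivity)]; ring_nf
      rw [e, ← mul_assoc]
      gcongr
      refine h1.trans ?_
      gcongr
      · exact le_abs_self c
      · linarith
  refine (setLIntegral_mono_ae' hS (ae_of_all _ hle)).trans_lt ?_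
  rw [lintegral_add_right _ ((hmeas _).const_mul _), lintegral_const_mul _ (hmeas _),
    lintegral_indicator (measurableSet_U hS _), Measure.restrict_restrict (measurableSet_U hS _),
    show U S (n : ℝ) ∩ S = U S n from inter_eq_left.2 fun x hx => hx.1,
    hρ.2 _ (fun x hx => hx.1) (measurableSet_U hS _)
      (Metric.isBounded_closedBall.subset inter_subset_right)]
  refine ENNReal.add_lt_top.2 ⟨?_, ENNReal.mul_lt_top ENNReal.ofReal_lt_top ?_⟩
  · have h1 := ((hL2 n).integrable (by norm_num)).2
    rw [hasFiniteIntegral_iff_ofReal (f := count (n : ℝ))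
      (ae_of_all _ fun ξ => ENNReal.toReal_nonneg)] at h1
    convert! h1 using 1
    refine lintegral_congr fun ξ => ?_
    have : ξ.1 (U S n) < ⊤ := (measure_mono inter_subset_right).trans_lt
      (ξ.2.finite _ (isCompact_closedBall (0 : Space d) n))
    exact (ENNReal.ofReal_toReal this.ne).symm
  · refine (setLIntegral_le_lintegral _ _).trans_lt (finite_integral_one_add_norm ?_)
    rw [finrank_euclideanSpace_fin]; linarith

/-- The order of the quantifiers matters: `B` depends neither on the statistic nor on `f`, so the
bound survives letting cut-off radii tend to infinity and scales quadratically with the slope of a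
cut-off. -/
theorem exists_energy_bound {d : ℕ} (hd : 0 < d) {S : Set (Space d)} (hS : MeasurableSet S)
    {ν : Config S → Space d → Space d → ℝ≥0}
    {μ : Measure (Config S)} [IsProbabilityMeasure μ] {C₁ : ℝ} {p : ℝ → ℝ}
    (hp : ∀ a b : ℝ, 0 < a → ∃ M : ℝ, ∀ r ∈ Set.Icc a b, |p r| ≤ M)
    (hB0 : ∀ᵐ ξ ∂μ, ∀ᵐ x ∂ξ.1, ∀ᵐ y ∂(volume.restrict S), (ν ξ x y : ℝ) ≤ C₁ * p ‖x - y‖)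
    {ρ : Space d → ℝ≥0} (hρ : IsCorrelation μ ρ) {κ : ℝ} (hκ : 0 ≤ κ)
    (hB1 : (fun x => (ρ x : ℝ)) =O[Bornology.cobounded (Space d) ⊓ 𝓟 S] (fun x => ‖x‖ ^ κ))
    {α : ℝ} (hα : κ < α) (hB2 : p =O[atTop] (fun r => r ^ (-((d : ℝ) + α))))
    {β : ℝ} (hβ0 : 0 < β) (hβ2 : β < 2) (hB3 : p =O[𝓝[>] 0] (fun r => r ^ (-((d : ℝ) + β))))
    (hL2 : ∀ r : ℕ, MemLp (count (S := S) r) 2 μ) :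
    ∃ B : ℝ≥0∞, B < ⊤ ∧ ∀ (C : ℝ) (φ : Space d → ℝ), WeightBounded C φ → ∀ f : Config S → ℝ,
      (∀ z ∈ jumpSet S, incr f z ^ 2 ≤ (φ z.2 - φ z.1.2) ^ 2) →
      energy ν μ f ≤ ENNReal.ofReal (C ^ 2) * B := by
  obtain ⟨M, hM, hbound⟩ := exists_increment_bound (C₁ := C₁) (d := d) (by linarith : 0 < α) hβ0
    hp hB2 hB3
  set s : ℝ := d + α with hs
  have hmeas : Measurable fun x : Space d => ENNReal.ofReal ((1 + ‖x‖) ^ (-s)) :=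
    ((measurable_const.add measurable_norm).pow_const _).ennreal_ofReal
  set J : ℝ≥0∞ := ∫⁻ x : Space d, ENNReal.ofReal ((1 + ‖x‖) ^ (-s)) with hJ
  set J' : ℝ≥0∞ := ∫⁻ z : Space d, ENNReal.ofReal (nearKernel d β z) with hJ'
  have hJt : J < ⊤ := finite_integral_one_add_norm (by rw [finrank_euclideanSpace_fin]; linarith)
  have hJt' : J' < ⊤ := lintegral_nearKernel_lt_top hd hβ2
  have hI := lintegral_rpow_lt_top hS hρ hκ hB1 hL2 hα
  rw [← hs] at hI
  set I := ∫⁻ ξ, ∫⁻ x, ENNReal.ofReal ((1 + ‖x‖) ^ (-s)) ∂ξ.1 ∂μ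
  -- By translation invariance the integral over `y` leaves only the power of $1+\|x\|$, to which
  -- Campbell's formula applies.
  have hdom : ∀ x : Space d, ∫⁻ y in S, ENNReal.ofReal (M * dominator d s β x y)
      ≤ (ENNReal.ofReal M * (J' + J + J)) * ENNReal.ofReal ((1 + ‖x‖) ^ (-s)) := by
    intro x
    refine (setLIntegral_le_lintegral _ _).trans_eq ?_
    have e : ∀ y, ENNReal.ofReal (M * dominator d s β x y)
        = (ENNReal.ofReal M * ENNReal.ofReal ((1 + ‖x‖) ^ (-s))) *
          (ENNReal.ofReal (nearKernel d β (x - y)) + ENNReal.ofReal ((1 + ‖x - y‖) ^ (-s))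
            + ENNReal.ofReal ((1 + ‖y‖) ^ (-s))) := by
      intro y
      have := nearKernel_nonneg (d := d) β (x - y)
      rw [dominator, ENNReal.ofReal_mul hM.le, ENNReal.ofReal_mul (by positivity),
        ENNReal.ofReal_add (by positivity) (by positivity),
        ENNReal.ofReal_add (by positivity) (by positivity), mul_assoc]
    simp_rw [e]
    have m1 : Measurable fun y => ENNReal.ofReal (nearKernel d β (x - y)) :=
      ((measurable_nearKernel β).comp (measurable_const.sub measurable_id)).ennreal_ofReal
    have m2 : Measurable fun y => ENNReal.ofReal ((1 + ‖x - y‖) ^ (-s)) :=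
      hmeas.comp (measurable_const.sub measurable_id)
    have m3 : Measurable fun y => ENNReal.ofReal (nearKernel d β (x - y))
        + ENNReal.ofReal ((1 + ‖x - y‖) ^ (-s)) := m1.add m2
    have m4 : Measurable fun y => ENNReal.ofReal (nearKernel d β (x - y))
        + ENNReal.ofReal ((1 + ‖x - y‖) ^ (-s)) + ENNReal.ofReal ((1 + ‖y‖) ^ (-s)) := m3.add hmeas
    rw [lintegral_const_mul _ m4, lintegral_add_left m3,
      lintegral_add_left m1,
      lintegral_sub_left_eq_self (fun z => ENNReal.ofReal (nearKernel d β z)) x,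
      lintegral_sub_left_eq_self (fun z : Space d => ENNReal.ofReal ((1 + ‖z‖) ^ (-s))) x]
    ring
  refine ⟨ENNReal.ofReal M * (J' + J + J) * I, ?_, fun C φ hφ f hf => ?_⟩
  · refine ENNReal.mul_lt_top (ENNReal.mul_lt_top ENNReal.ofReal_lt_top ?_) hI
    exact ENNReal.add_lt_top.2 ⟨ENNReal.add_lt_top.2 ⟨hJt', hJt⟩, hJt⟩
  · have hmI : Measurable fun ξ : Config S =>
        ∫⁻ x, ENNReal.ofReal ((1 + ‖x‖) ^ (-s)) ∂ξ.1 :=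
      (Measure.measurable_lintegral hmeas).comp (measurable_val S)
    set A : ℝ≥0∞ := ENNReal.ofReal M * (J' + J + J)
    calc energy ν μ f ≤ ∫⁻ ξ, ∫⁻ x, (ENNReal.ofReal (C ^ 2) * A) *
          ENNReal.ofReal ((1 + ‖x‖) ^ (-s)) ∂ξ.1 ∂μ := ?_
      _ = ENNReal.ofReal (C ^ 2) * (A * I) := by
        simp_rw [lintegral_const_mul _ hmeas]
        rw [lintegral_const_mul _ hmI, mul_assoc]
    refine lintegral_mono_ae ?_
    filter_upwards [hB0] with ξ hξ
    refine (mul_le_of_le_one_left' (by simp)).trans (lintegral_mono_ae ?_)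
    filter_upwards [hξ, ae_mem_jumpSet hS ξ] with x hx hx'
    rw [mul_assoc]
    refine le_trans ?_ (mul_le_mul_right (hdom x) _)
    rw [← lintegral_const_mul' _ _ ENNReal.ofReal_ne_top]
    refine lintegral_mono_ae ?_
    filter_upwards [hx, hx'] with y hy hy'
    rw [← ENNReal.ofReal_coe_nnreal, ← ENNReal.ofReal_mul (sq_nonneg _),
      ← ENNReal.ofReal_mul (sq_nonneg _)]
    refine ENNReal.ofReal_le_ofReal (le_trans ?_ (hbound C φ hφ x y _ (NNReal.coe_nonneg _) hy))
    refine mul_le_mul_of_nonneg_right ?_ (NNReal.coe_nonneg _)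
    rw [jumpDiff_eq f hy']
    exact hf _ hy'

/-! ### Compact sets of configurations -/

/-- The Dirac measure at `o`, zero if `o` is the point at infinity. -/
def pointMeasure {d : ℕ} (o : OnePoint (Space d)) : Measure (Space d) := o.elim 0 Measure.dirac

@[simp] theorem pointMeasure_coe {d : ℕ} (x : Space d) :
    pointMeasure (x : OnePoint (Space d)) = Measure.dirac x := rfl

@[simp] theorem pointMeasure_infty {d : ℕ} :
    pointMeasure (OnePoint.infty : OnePoint (Space d)) = 0 := rfl

theorem pointMeasure_restrict_eq_zero {d : ℕ} {o : OnePoint (Space d)} {A : Set (Space d)}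
    (hA : MeasurableSet A) (h : o ∉ (OnePoint.some : Space d → _) '' A) :
    (pointMeasure o).restrict A = 0 := by
  induction o using OnePoint.rec with
  | infty => simp
  | coe x =>
    have hx : x ∉ A := fun hx => h ⟨x, hx, rfl⟩
    rw [pointMeasure_coe, Measure.restrict_eq_zero, Measure.dirac_apply' _ hA]
    simp [hx]

/-- The configuration enumerated by `s`. -/
def enumMeasure {d : ℕ} (s : ℕ → OnePoint (Space d)) : Measure (Space d) :=
  Measure.sum fun i => pointMeasure (s i)

/-- Enumerations of configurations in `S` with at most `a r` points in the ball of radius `r`. -/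
def enumSet {d : ℕ} (S : Set (Space d)) (a : ℕ → ℕ) : Set (ℕ → OnePoint (Space d)) :=
  {s | ∀ i, s i ∉ (OnePoint.some : Space d → _) '' Sᶜ ∧
    ∀ r : ℕ, a r ≤ i → s i ∉ (OnePoint.some : Space d → _) '' Metric.ball 0 r}

/-- Tychonoff: each coordinate has to avoid sets that are open in the compactification. This is why
the definition uses open balls. -/
theorem isCompact_enumSet {d : ℕ} {S : Set (Space d)} (hS : IsClosed S) (a : ℕ → ℕ) :
    IsCompact (enumSet S a) := by
  refine IsClosed.isCompact ?_
  have e : enumSet S a = ⋂ i, ((fun s : ℕ → OnePoint (Space d) => s i) ⁻¹'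
      ((OnePoint.some : Space d → _) '' Sᶜ)ᶜ ∩
      ⋂ r : ℕ, ⋂ _ : a r ≤ i, (fun s : ℕ → OnePoint (Space d) => s i) ⁻¹'
        ((OnePoint.some : Space d → _) '' Metric.ball 0 r)ᶜ) := by
    ext s
    simp only [enumSet, mem_iInter, mem_inter_iff, mem_preimage, mem_compl_iff]
    rfl
  rw [e]
  refine isClosed_iInter fun i => IsClosed.inter ?_ (isClosed_iInter fun r => isClosed_iInter
    fun _ => ?_)
  · exact (OnePoint.isOpen_image_coe.2 hS.isOpen_compl).isClosed_compl.preimage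
      (continuous_apply i)
  · exact (OnePoint.isOpen_image_coe.2 Metric.isOpen_ball).isClosed_compl.preimage
      (continuous_apply i)

theorem enumMeasure_restrict {d : ℕ} (s : ℕ → OnePoint (Space d)) (A : Set (Space d)) :
    (enumMeasure s).restrict A = Measure.sum fun i => (pointMeasure (s i)).restrict A :=
  Measure.restrict_sum_of_countable _ _

theorem sum_eq_finset_sum {X : Type*} [MeasurableSpace X] {m : ℕ → Measure X} {J : Finset ℕ}
    (h : ∀ i ∉ J, m i = 0) : Measure.sum m = ∑ i ∈ J, m i := by
  ext A hA
  rw [Measure.sum_apply _ hA, Measure.finsetSum_apply]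
  exact tsum_eq_sum fun i hi => by rw [h i hi]; rfl

theorem isConfig_enumMeasure {d : ℕ} {S : Set (Space d)} {a : ℕ → ℕ}
    {s : ℕ → OnePoint (Space d)} (hs : s ∈ enumSet S a) : IsConfig S (enumMeasure s) := by
  have hex : ∀ i : {i // s i ≠ OnePoint.infty}, ∃ x : Space d, (x : OnePoint (Space d)) = s i :=
    fun i => OnePoint.ne_infty_iff_exists.1 i.2
  choose x hx using hex
  have e : enumMeasure s = Measure.sum fun i : {i // s i ≠ OnePoint.infty} =>
      Measure.dirac (x i) := by
    ext A hA
    rw [enumMeasure, Measure.sum_apply _ hA, Measure.sum_apply _ hA]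
    have : ∀ i : {i // s i ≠ OnePoint.infty}, Measure.dirac (x i) A = pointMeasure (s i) A :=
      fun i => by rw [← hx i, pointMeasure_coe]
    simp_rw [this]
    refine (tsum_subtype_eq_of_support_subset (s := {i | s i ≠ OnePoint.infty}) ?_).symm
    intro i hi hi'
    rw [Function.mem_support] at hi
    have hi' : s i = OnePoint.infty := hi'
    rw [hi'] at hi
    exact hi rfl
  rw [e]
  refine IsConfig.of_sum (fun i => ?_) fun K hK => ?_
  · by_contra h
    exact (hs i).1 ⟨x i, h, hx i⟩
  · rw [← e]
    obtain ⟨r, hr⟩ := hK.isBounded.subset_ball 0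
    have hr' : K ⊆ Metric.ball 0 ⌈r⌉₊ := hr.trans (Metric.ball_subset_ball (Nat.le_ceil r))
    refine (measure_mono hr').trans_lt ?_
    rw [← Measure.restrict_apply_univ, enumMeasure_restrict,
      sum_eq_finset_sum (J := Finset.range (a ⌈r⌉₊)) fun i hi => ?_]
    · rw [Measure.finsetSum_apply]
      refine ENNReal.sum_lt_top.2 fun i _ => ?_
      rw [Measure.restrict_apply_univ]
      induction s i using OnePoint.rec with
      | infty => simp
      | coe x => exact measure_lt_top (Measure.dirac x) _
    · exact pointMeasure_restrict_eq_zero measurableSet_ball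
        ((hs i).2 _ (not_lt.1 fun h => hi (Finset.mem_range.2 h)))

/-- The map sending an enumeration to the enumerated configuration. -/
def enumConfig {d : ℕ} {S : Set (Space d)} {a : ℕ → ℕ} (s : enumSet S a) : Config S :=
  ⟨enumMeasure s.1, isConfig_enumMeasure s.2⟩

/-- A test function, extended by 0 at infinity, is continuous on the compactification, and only
finitely many coordinates can enter its support. The statistic is thus a finite sum of continuous
functions. -/
theorem continuous_enumConfig {d : ℕ} {S : Set (Space d)} {a : ℕ → ℕ} :
    Continuous (enumConfig (S := S) (a := a)) := by
  refine continuous_induced_rng.2 (continuous_pi fun φ => ?_)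
  obtain ⟨r, hr⟩ := φ.hasCompactSupport.isCompact.isBounded.subset_ball 0
  have hr' : tsupport φ ⊆ Metric.ball 0 ⌈r⌉₊ := hr.trans (Metric.ball_subset_ball (Nat.le_ceil r))
  have hc : Continuous fun o : OnePoint (Space d) => o.elim 0 φ := by
    rw [OnePoint.continuous_iff]
    refine ⟨?_, φ.continuous⟩
    refine (tendsto_congr' ?_).2 tendsto_const_nhds
    rw [coclosedCompact_eq_cocompact]
    filter_upwards [φ.hasCompactSupport.isCompact.compl_mem_cocompact] with x hx
    change φ x = 0
    exact image_eq_zero_of_notMem_tsupport hx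
  have e : ∀ s : enumSet S a, ∫ x, φ x ∂(enumConfig s).1
      = ∑ i ∈ Finset.range (a ⌈r⌉₊), (s.1 i).elim 0 φ := by
    intro s
    have h1 : HasSum (fun i => ∫ x, φ x ∂pointMeasure (s.1 i)) (∫ x, φ x ∂(enumConfig s).1) :=
      hasSum_integral_measure (integrable_cc φ (enumConfig s))
    have h2 : ∀ i, ∫ x, φ x ∂pointMeasure (s.1 i) = (s.1 i).elim 0 φ := by
      intro i
      induction s.1 i using OnePoint.rec with
      | infty => simp
      | coe x => simp
    simp_rw [h2] at h1
    refine h1.unique (hasSum_sum_of_ne_finset_zero fun i hi => ?_)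
    have h3 := (s.2 i).2 ⌈r⌉₊ (not_lt.1 fun h => hi (Finset.mem_range.2 h))
    generalize s.1 i = o at h3
    induction o using OnePoint.rec with
    | infty => simp
    | coe x =>
      change φ x = 0
      exact image_eq_zero_of_notMem_tsupport fun hx => h3 ⟨x, hr' hx, rfl⟩
  change Continuous fun s : enumSet S a => ∫ x, φ x ∂(enumConfig s).1
  simp_rw [e]
  exact continuous_finsetSum _ fun i _ => hc.comp ((continuous_apply i).comp continuous_subtype_val)

theorem isCompact_range_enumConfig {d : ℕ} {S : Set (Space d)} (hS : IsClosed S) (a : ℕ → ℕ) :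
    IsCompact (range (enumConfig (S := S) (a := a))) := by
  have := isCompact_iff_compactSpace.1 (isCompact_enumSet hS a)
  exact isCompact_range continuous_enumConfig

theorem range_enumConfig_mono {d : ℕ} {S : Set (Space d)} {a b : ℕ → ℕ} (h : a ≤ b) :
    range (enumConfig (S := S) (a := a)) ⊆ range (enumConfig (S := S) (a := b)) := by
  rintro _ ⟨s, rfl⟩
  exact ⟨⟨s.1, fun i => ⟨(s.2 i).1, fun r hr => (s.2 i).2 r ((h r).trans hr)⟩⟩, rfl⟩

/-- List the particles by increasing norm: those of norm at most `r` occupy the first places, of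
which there are at most `a r`. -/
theorem mem_range_enumConfig {d : ℕ} {S : Set (Space d)} {a : ℕ → ℕ} {ξ : Config S}
    (h : ∀ r : ℕ, ξ.1 (U S r) ≤ a r) (hS : MeasurableSet S) : ξ ∈ range (enumConfig (a := a)) := by
  obtain ⟨I, x, hx, hm⟩ := ξ.2.exists_sum
  have hcount : ∀ r : ℕ, {i ∈ I | ‖x i‖ ≤ r}.encard ≤ a r := by
    intro r
    have h1 := h r
    rw [hm, Measure.sum_apply _ (measurableSet_U hS r)] at h1
    have h2 : ∑' i : I, (Measure.dirac (x i) : Measure (Space d)) (U S r)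
        = ({i ∈ I | ‖x i‖ ≤ r}.encard : ℝ≥0∞) := by
      rw [← ENNReal.tsum_set_one, tsum_subtype I
        (fun i => (Measure.dirac (x i) : Measure (Space d)) (U S r)),
        tsum_subtype {i ∈ I | ‖x i‖ ≤ r} (fun _ => (1 : ℝ≥0∞))]
      refine tsum_congr fun i => ?_
      by_cases hI : i ∈ I
      · by_cases hi : ‖x i‖ ≤ r
        · have hU : x i ∈ U S r := ⟨hx i hI, by simpa using hi⟩
          have hs : i ∈ {i | i ∈ I ∧ ‖x i‖ ≤ r} := ⟨hI, hi⟩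
          rw [indicator_of_mem hI, indicator_of_mem hs,
            Measure.dirac_apply' _ (measurableSet_U hS r), indicator_of_mem hU]
          rfl
        · have hU : x i ∉ U S r := fun hU => hi (by simpa using hU.2)
          have hs : i ∉ {i | i ∈ I ∧ ‖x i‖ ≤ r} := fun hs => hi hs.2
          rw [indicator_of_mem hI, indicator_of_notMem hs,
            Measure.dirac_apply' _ (measurableSet_U hS r), indicator_of_notMem hU]
      · have hs : i ∉ {i | i ∈ I ∧ ‖x i‖ ≤ r} := fun hs => hI hs.1
        rw [indicator_of_notMem hI, indicator_of_notMem hs]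
    rw [h2] at h1
    exact_mod_cast h1
  -- Predecessors in the order by norm, with ties broken by index so that coinciding particles
  -- receive distinct ranks.
  let pred : ℕ → Set ℕ := fun i => {j ∈ I | ‖x j‖ < ‖x i‖ ∨ (‖x j‖ = ‖x i‖ ∧ j < i)}
  have hfin : ∀ r : ℕ, {i ∈ I | ‖x i‖ ≤ r}.Finite := fun r =>
    finite_of_encard_le_coe (hcount r)
  have hpred : ∀ i, ∀ r : ℕ, ‖x i‖ ≤ r → pred i ⊆ {i ∈ I | ‖x i‖ ≤ r} := fun i r hr j hj =>
    ⟨hj.1, by rcases hj.2 with h | h; exacts [h.le.trans hr, h.1.le.trans hr]⟩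
  have hpfin : ∀ i, (pred i).Finite := fun i =>
    (hfin _).subset (hpred i _ (Nat.le_ceil ‖x i‖))
  have hlt : ∀ i ∈ I, ∀ j ∈ I, (‖x i‖ < ‖x j‖ ∨ (‖x i‖ = ‖x j‖ ∧ i < j)) →
      (pred i).ncard < (pred j).ncard := by
    intro i hi j hj hij
    refine ncard_lt_ncard ⟨fun k hk => ⟨hk.1, ?_⟩, fun hsub => ?_⟩ (hpfin j)
    · rcases hk.2 with h1 | h1 <;> rcases hij with h2 | h2
      · exact Or.inl (h1.trans h2)
      · exact Or.inl (h2.1 ▸ h1)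
      · exact Or.inl (h1.1 ▸ h2)
      · exact Or.inr ⟨h1.1.trans h2.1, h1.2.trans h2.2⟩
    · have : i ∈ pred i := hsub ⟨hi, hij⟩
      rcases this.2 with h | h
      · exact lt_irrefl _ h
      · exact lt_irrefl _ h.2
  let e : I → ℕ := fun i => (pred i).ncard
  have he : Function.Injective e := by
    intro i j hij
    by_contra hne
    have hne' : (i : ℕ) ≠ j := fun h => hne (Subtype.ext h)
    rcases lt_trichotomy ‖x i‖ ‖x j‖ with h | h | h
    · exact (hlt i i.2 j j.2 (Or.inl h)).ne hij
    · rcases lt_or_gt_of_ne hne' with h' | h'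
      · exact (hlt i i.2 j j.2 (Or.inr ⟨h, h'⟩)).ne hij
      · exact (hlt j j.2 i i.2 (Or.inr ⟨h.symm, h'⟩)).ne hij.symm
    · exact (hlt j j.2 i i.2 (Or.inl h)).ne hij.symm
  have hrank : ∀ i : I, ∀ r : ℕ, ‖x i‖ ≤ r → e i < a r := by
    intro i r hr
    have h1 : (pred i).ncard < {i ∈ I | ‖x i‖ ≤ r}.ncard := by
      refine ncard_lt_ncard ⟨hpred i r hr, fun hsub => ?_⟩ (hfin r)
      have : (i : ℕ) ∈ pred i := hsub ⟨i.2, hr⟩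
      rcases this.2 with h | h
      · exact lt_irrefl _ h
      · exact lt_irrefl _ h.2
    refine h1.trans_le ?_
    have h2 := hcount r
    rw [← (hfin r).cast_ncard_eq] at h2
    exact_mod_cast h2
  let s : ℕ → OnePoint (Space d) :=
    Function.extend e (fun i : I => (x i : OnePoint (Space d))) fun _ => OnePoint.infty
  have hs : ∀ i : I, s (e i) = (x i : OnePoint (Space d)) := fun i => he.extend_apply _ _ i
  have hs' : ∀ k ∉ range e, s k = OnePoint.infty := fun k hk => Function.extend_apply' _ _ _ hk
  have hmem : s ∈ enumSet S a := by
    intro k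
    by_cases hk : k ∈ range e
    · obtain ⟨i, rfl⟩ := hk
      rw [hs]
      refine ⟨?_, fun r hr => ?_⟩
      · rintro ⟨y, hy, hyx⟩
        rw [OnePoint.coe_eq_coe.1 hyx] at hy
        exact hy (hx i i.2)
      · rintro ⟨y, hy, hyx⟩
        rw [OnePoint.coe_eq_coe.1 hyx, mem_ball_zero_iff] at hy
        exact absurd hr (not_le.2 (hrank i r hy.le))
    · rw [hs' k hk]
      exact ⟨OnePoint.infty_notMem_image_coe, fun _ _ => OnePoint.infty_notMem_image_coe⟩
  refine ⟨⟨s, hmem⟩, Subtype.ext ?_⟩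
  change enumMeasure s = ξ.1
  rw [hm]
  ext A hA
  rw [enumMeasure, Measure.sum_apply _ hA, Measure.sum_apply _ hA,
    ← he.tsum_eq (f := fun k => pointMeasure (s k) A)]
  · refine tsum_congr fun i => ?_
    rw [hs, pointMeasure_coe]
  · intro k hk
    by_contra hk'
    rw [Function.mem_support, hs' k hk'] at hk
    exact hk rfl

/-- Local smooth functions are continuous on the compact sets of enumerated configurations. -/
theorem IsLocalSmooth.continuous_comp_enumConfig {d : ℕ} {S : Set (Space d)} (hS : IsClosed S)
    {f : Config S → ℝ} (hf : IsLocalSmooth f) (a : ℕ → ℕ) :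
    Continuous fun s : enumSet S a => f (enumConfig s) := by
  classical
  have hSm := hS.measurableSet
  obtain ⟨⟨r, hr⟩, hsm⟩ := hf
  rw [continuous_iff_continuousAt]
  intro t
  -- The function sees only $U_r$; the extra shell lets particles cross the sphere of radius `R`
  -- unnoticed.
  set R : ℕ := r + 1 with hR
  have hrR : (r : ℝ) < R := by simp [hR]
  let B : Set (OnePoint (Space d)) := (OnePoint.some : Space d → _) '' Metric.closedBall 0 (R : ℝ)
  have hBc : IsClosed B := OnePoint.isClosed_image_coe.2
    ⟨Metric.isClosed_closedBall, isCompact_closedBall _ _⟩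
  let J : Finset ℕ := (Finset.range (a (R + 1))).filter fun i => t.1 i ∈ B
  let e : Fin J.card ≃ J := J.equivFin.symm
  have hJB : ∀ j, t.1 (e j) ∈ B := fun j => (Finset.mem_filter.1 (e j).2).2
  let pt : OnePoint (Space d) → Space d := fun o => o.elim 0 id
  have hpt : ∀ y : Space d, pt y = y := fun y => rfl
  have hBS : ∀ (s : enumSet S a) (i : ℕ), s.1 i ∈ B → pt (s.1 i) ∈ U S R ∧
      (pt (s.1 i) : OnePoint (Space d)) = s.1 i := by
    intro s i hi
    obtain ⟨y, hy, hys⟩ := hi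
    rw [← hys, hpt]
    refine ⟨⟨?_, hy⟩, rfl⟩
    by_contra hyS
    exact (s.2 i).1 ⟨y, hyS, hys⟩
  have hbig : ∀ (s : enumSet S a) (i : ℕ), a (R + 1) ≤ i → s.1 i ∉ B := by
    intro s i hi hB
    refine (s.2 i).2 _ hi (image_mono (fun y hy => ?_) hB)
    rw [mem_closedBall_zero_iff] at hy
    rw [mem_ball_zero_iff]
    push_cast
    linarith
  -- The particles that `t` has in the closed ball of radius `R` are followed to `s`; one that has
  -- left the ball is frozen at its old position. This keeps their number fixed and the coordinates
  -- in $U_R$, as smoothness of `f` requires.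
  let X : enumSet S a → Fin J.card → Space d := fun s j =>
    if s.1 (e j) ∈ B then pt (s.1 (e j)) else pt (t.1 (e j))
  have hX : ∀ s, X s ∈ UPow S R J.card := by
    intro s j
    change (if s.1 (e j) ∈ B then pt (s.1 (e j)) else pt (t.1 (e j))) ∈ U S R
    split_ifs with h
    · exact (hBS s _ h).1
    · exact (hBS t _ (hJB j)).1
  have hXlim : Tendsto X (𝓝 t) (𝓝[UPow S R J.card] (X t)) := by
    refine tendsto_nhdsWithin_iff.2 ⟨tendsto_pi_nhds.2 fun j => ?_, Eventually.of_forall hX⟩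
    have h1 : Tendsto (fun s : enumSet S a => s.1 (e j)) (𝓝 t) (𝓝 (t.1 (e j))) :=
      ((continuous_apply (e j : ℕ)).comp continuous_subtype_val).tendsto t
    have h2 : ContinuousAt pt (t.1 (e j)) := by
      rw [← (hBS t _ (hJB j)).2, OnePoint.continuousAt_coe]
      exact continuousAt_id
    have h3 : X t j = pt (t.1 (e j)) := ite_self _
    rw [h3]
    exact (h2.tendsto.comp h1).if' tendsto_const_nhds
  have hη : (enumConfig t).1 (U S R) = J.card := by
    rw [← Measure.restrict_apply_univ]
    change (enumMeasure t.1).restrict _ univ = _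
    rw [enumMeasure_restrict, sum_eq_finset_sum (J := J), Measure.finsetSum_apply]
    · have : ∀ i ∈ J, (pointMeasure (t.1 i)).restrict (U S R) univ = 1 := by
        intro i hi
        obtain ⟨h1, h2⟩ := hBS t i (Finset.mem_filter.1 hi).2
        rw [← h2, Measure.restrict_apply_univ, pointMeasure_coe,
          Measure.dirac_apply' _ (measurableSet_U hSm _), indicator_of_mem h1]
        rfl
      rw [Finset.sum_congr rfl this]
      simp
    · intro i hi
      refine pointMeasure_restrict_eq_zero (measurableSet_U hSm _) fun h => hi ?_
      have hB : t.1 i ∈ B := image_mono inter_subset_right h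
      exact Finset.mem_filter.2 ⟨Finset.mem_range.2 (not_le.1 fun h => hbig t i h hB), hB⟩
  have hev1 : ∀ᶠ s : enumSet S a in 𝓝 t, ∀ i ∈ Finset.range (a (R + 1)), t.1 i ∉ B → s.1 i ∉ B := by
    refine (Filter.eventually_all_finset _).2 fun i _ => ?_
    by_cases h : t.1 i ∈ B
    · exact Eventually.of_forall fun s hs => absurd h hs
    · have h1 : Tendsto (fun s : enumSet S a => s.1 i) (𝓝 t) (𝓝 (t.1 i)) :=
        ((continuous_apply i).comp continuous_subtype_val).tendsto t
      filter_upwards [h1.eventually (hBc.isOpen_compl.mem_nhds h)] with s hs _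
      exact hs
  -- Only particles starting on the boundary sphere can leave for `s` near `t`; their frozen
  -- positions lie outside $U_r$ and do not affect `f`.
  have hev2 : ∀ᶠ s : enumSet S a in 𝓝 t, ∀ j : Fin J.card,
      s.1 (e j) ∉ B → (R : ℝ) ≤ ‖pt (t.1 (e j))‖ := by
    refine Filter.eventually_all.2 fun j => ?_
    by_cases h : (R : ℝ) ≤ ‖pt (t.1 (e j))‖
    · exact Eventually.of_forall fun _ _ => h
    · have h1 : Tendsto (fun s : enumSet S a => s.1 (e j)) (𝓝 t) (𝓝 (t.1 (e j))) :=
        ((continuous_apply (e j : ℕ)).comp continuous_subtype_val).tendsto t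
      have h2 : (OnePoint.some : Space d → _) '' Metric.ball 0 (R : ℝ) ∈ 𝓝 (t.1 (e j)) := by
        refine (OnePoint.isOpen_image_coe.2 Metric.isOpen_ball).mem_nhds ?_
        exact ⟨pt (t.1 (e j)), by simpa using h, (hBS t _ (hJB j)).2⟩
      filter_upwards [h1.eventually h2] with s hs hs'
      exact absurd (image_mono Metric.ball_subset_closedBall hs) hs'
  have hUr : MeasurableSet (U S (r : ℝ)) := measurableSet_U hSm _
  have hUB : (OnePoint.some : Space d → _) '' U S r ⊆ B := image_mono fun y hy =>
    Metric.closedBall_subset_closedBall hrR.le hy.2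
  have key : ∀ᶠ s : enumSet S a in 𝓝 t,
      f (enumConfig s) = urep f R J.card (enumConfig t) (X s) := by
    filter_upwards [hev1, hev2] with s h1 h2
    rw [urep_eq f hη (hX s)]
    refine eq_of_restrict_eq hr ?_
    change (enumMeasure s.1).restrict (U S r) = ((∑ j, Measure.dirac (X s j))
      + (enumConfig t).1.restrict (S \ U S R)).restrict (U S r)
    have hdis : U S (r : ℝ) ∩ (S \ U S (R : ℝ)) = ∅ := by
      ext y
      simp only [mem_inter_iff, Set.mem_sdiff, mem_empty_iff_false, iff_false, not_and, not_not]
      exact fun hy _ => ⟨hy.1, Metric.closedBall_subset_closedBall hrR.le hy.2⟩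
    rw [Measure.restrict_add, Measure.restrict_restrict hUr, hdis, Measure.restrict_empty,
      add_zero, enumMeasure_restrict, sum_eq_finset_sum (J := J) fun i hi => ?_]
    · rw [← Measure.sum_fintype, Measure.restrict_sum_of_countable, Measure.sum_fintype,
        ← Finset.sum_coe_sort, ← e.sum_comp]
      refine Finset.sum_congr rfl fun j _ => ?_
      by_cases hB : s.1 (e j) ∈ B
      · have : X s j = pt (s.1 (e j)) := if_pos hB
        rw [this]
        conv_lhs => rw [← (hBS s _ hB).2]
        rfl
      · have : X s j = pt (t.1 (e j)) := if_neg hB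
        rw [this, pointMeasure_restrict_eq_zero hUr fun h => hB (hUB h)]
        symm
        rw [Measure.restrict_eq_zero, Measure.dirac_apply' _ hUr, indicator_of_notMem]
        intro hy
        have h3 := h2 j hB
        have h4 := hy.2
        rw [mem_closedBall_zero_iff] at h4
        linarith
    · refine pointMeasure_restrict_eq_zero hUr fun h => ?_
      have hB : s.1 i ∈ B := hUB h
      have hi' : i < a (R + 1) := not_le.1 fun h => hbig s i h hB
      have hti : t.1 i ∉ B := fun h =>
        hi (Finset.mem_filter.2 ⟨Finset.mem_range.2 hi', h⟩)
      exact h1 i (Finset.mem_range.2 hi') hti hB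
  have hcont : Tendsto (urep f R J.card (enumConfig t)) (𝓝[UPow S R J.card] (X t))
      (𝓝 (urep f R J.card (enumConfig t) (X t))) :=
    (hsm R J.card (enumConfig t)).continuousOn (X t) (hX t)
  rw [ContinuousAt, key.self_of_nhds]
  exact (tendsto_congr' key).2 (hcont.comp hXlim)

/-- A continuous map from a compact space into a Hausdorff one is closed, hence a quotient map onto
its range, so continuity may be tested on enumerations. -/
theorem IsLocalSmooth.continuousOn_range {d : ℕ} {S : Set (Space d)} (hS : IsClosed S)
    {f : Config S → ℝ} (hf : IsLocalSmooth f) (a : ℕ → ℕ) :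
    ContinuousOn f (range (enumConfig (S := S) (a := a))) := by
  have := isCompact_iff_compactSpace.1 (isCompact_enumSet hS a)
  have hq : IsQuotientMap (rangeFactorization (enumConfig (S := S) (a := a))) :=
    (continuous_enumConfig.subtype_mk _).isClosedMap.isQuotientMap
      (continuous_enumConfig.subtype_mk _) rangeFactorization_surjective
  rw [continuousOn_iff_continuous_domRestrict, hq.continuous_iff]
  exact hf.continuous_comp_enumConfig hS a

/-! ### The closed form -/

section Form

variable {d : ℕ} {S : Set (Space d)} {ν : Config S → Space d → Space d → ℝ≥0}
  {μ : Measure (Config S)}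

theorem comp₂_mem_preDomain [SFinite μ] (hS : MeasurableSet S) (hν : Measurable (rate ν))
    {f g : Config S → ℝ}
    (hf : f ∈ preDomain ν μ) (hg : g ∈ preDomain ν μ) {G : ℝ × ℝ → ℝ} (hG : ContDiff ℝ ∞ G)
    (hL : MemLp (fun ξ => G (f ξ, g ξ)) 2 μ) {a b : ℝ} (ha : 0 ≤ a) (hb : 0 ≤ b)
    (H : ∀ z, incr (fun ξ => G (f ξ, g ξ)) z ^ 2 ≤ a * incr f z ^ 2 + b * incr g z ^ 2) :
    (fun ξ => G (f ξ, g ξ)) ∈ preDomain ν μ := by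
  have hfm := hf.1.1.measurable hS
  have hgm := hg.1.1.measurable hS
  refine ⟨hf.1.comp₂ hS hg.1 hG, hL, (energy_le hS hν μ hfm hgm
    (hG.continuous.measurable.comp (hfm.prodMk hgm)) ha hb H).trans_lt ?_⟩
  exact ENNReal.add_lt_top.2 ⟨ENNReal.mul_lt_top ENNReal.ofReal_lt_top hf.2.2,
    ENNReal.mul_lt_top ENNReal.ofReal_lt_top hg.2.2⟩

theorem const_mem_preDomain [IsFiniteMeasure μ] (hS : MeasurableSet S) (hν : Measurable (rate ν))
    (c : ℝ) :
    (fun _ : Config S => c) ∈ preDomain ν μ := by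
  refine ⟨⟨⟨0, measurable_const⟩, fun r n ξ => ?_⟩, memLp_const c, ?_⟩
  · by_cases h : ξ.1 (U S r) = n
    · exact (contDiffOn_const (c := c)).congr fun x hx => urep_eq _ h hx
    · have : urep (fun _ : Config S => c) r n ξ = fun _ => 0 := by
        funext x; rw [urep, if_neg h]
      rw [this]; exact contDiffOn_const
  · rw [energy_eq hS hν μ measurable_const]
    simp [incr]

theorem add_mem_preDomain [SFinite μ] (hS : MeasurableSet S) (hν : Measurable (rate ν))
    {f g : Config S → ℝ} (hf : f ∈ preDomain ν μ) (hg : g ∈ preDomain ν μ) :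
    f + g ∈ preDomain ν μ :=
  comp₂_mem_preDomain hS hν hf hg (G := fun p => p.1 + p.2) (contDiff_fst.add contDiff_snd)
    (hf.2.1.add hg.2.1) (a := 2) (b := 2) (by norm_num) (by norm_num) fun z => by
      have e : incr (fun ξ => f ξ + g ξ) z = incr f z + incr g z := by simp only [incr]; ring
      rw [e]; nlinarith [sq_nonneg (incr f z - incr g z)]

theorem smul_mem_preDomain [SFinite μ] (hS : MeasurableSet S) (hν : Measurable (rate ν))
    {f : Config S → ℝ} (c : ℝ) (hf : f ∈ preDomain ν μ) : c • f ∈ preDomain ν μ :=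
  comp₂_mem_preDomain hS hν hf hf (G := fun p => c • p.1) (contDiff_fst.const_smul c)
    (hf.2.1.const_smul c) (a := c ^ 2) (b := 0) (sq_nonneg c) le_rfl fun z => by
      have e : incr (fun ξ => c • f ξ) z = c * incr f z := by simp only [incr, smul_eq_mul]; ring
      rw [e]; linarith [mul_pow c (incr f z) 2]

/-- The discrete Leibniz rule evaluates one factor before the jump and the other after it. -/
theorem incr_mul_sq_le {f g : Config S → ℝ} {a b : ℝ} (hf : ∀ ξ, |f ξ| ≤ a) (hg : ∀ ξ, |g ξ| ≤ b)
    (z : (Config S × Space d) × Space d) :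
    incr (fun ξ => f ξ * g ξ) z ^ 2 ≤ 2 * b ^ 2 * incr f z ^ 2 + 2 * a ^ 2 * incr g z ^ 2 := by
  have e : incr (fun ξ => f ξ * g ξ) z = g (jumpMap z) * incr f z + f z.1.1 * incr g z := by
    simp only [incr]; ring
  have h1 : g (jumpMap z) ^ 2 ≤ b ^ 2 := by
    rw [← sq_abs]; exact pow_le_pow_left₀ (abs_nonneg _) (hg _) 2
  have h2 : f z.1.1 ^ 2 ≤ a ^ 2 := by
    rw [← sq_abs]; exact pow_le_pow_left₀ (abs_nonneg _) (hf _) 2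
  rw [e]
  nlinarith [sq_nonneg (g (jumpMap z) * incr f z - f z.1.1 * incr g z),
    mul_le_mul_of_nonneg_right h1 (sq_nonneg (incr f z)),
    mul_le_mul_of_nonneg_right h2 (sq_nonneg (incr g z))]

theorem mul_mem_preDomain [IsFiniteMeasure μ] (hS : MeasurableSet S) (hν : Measurable (rate ν))
    {f g : Config S → ℝ} (hf : f ∈ preDomain ν μ) (hg : g ∈ preDomain ν μ)
    {a b : ℝ} (hfa : ∀ ξ, |f ξ| ≤ a) (hgb : ∀ ξ, |g ξ| ≤ b) :
    (fun ξ => f ξ * g ξ) ∈ preDomain ν μ := by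
  refine comp₂_mem_preDomain hS hν hf hg (G := fun p => p.1 * p.2) (contDiff_fst.mul contDiff_snd)
    (MemLp.of_bound ((hf.1.1.measurable hS).mul (hg.1.1.measurable hS)).aestronglyMeasurable (a * b)
      (ae_of_all _ fun ξ => ?_)) (by positivity) (by positivity) (incr_mul_sq_le hfa hgb)
  rw [Real.norm_eq_abs, abs_mul]
  exact mul_le_mul (hfa ξ) (hgb ξ) (abs_nonneg _) ((abs_nonneg _).trans (hfa ξ))

/-! ### The gradient as a closable operator between two $L^2$ spaces -/

variable [IsProbabilityMeasure μ]

/-- The space `𝔇_∞` as a linear space of functions. -/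
def preSub (hS : MeasurableSet S) (hν : Measurable (rate ν)) (μ : Measure (Config S))
    [IsProbabilityMeasure μ] : Submodule ℝ (Config S → ℝ) where
  carrier := preDomain ν μ
  zero_mem' := const_mem_preDomain hS hν 0
  add_mem' hf hg := add_mem_preDomain hS hν hf hg
  smul_mem' c _ hf := smul_mem_preDomain hS hν c hf

variable (hS : MeasurableSet S) (hν : Measurable (rate ν))

theorem preSub_memLp_grad (f : preSub hS hν μ) : MemLp (grad ν f.1) 2 (jumpMeasure μ) :=
  (memLp_grad_iff hS hν μ (f.2.1.1.measurable hS)).2 f.2.2.2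

/-- The map sending a function in `𝔇_∞` to its class in `L²(μ)`. -/
def preEmb : preSub hS hν μ →ₗ[ℝ] Lp ℝ 2 μ where
  toFun f := f.2.2.1.toLp f.1
  map_add' f g := MemLp.toLp_add f.2.2.1 g.2.2.1
  map_smul' c f := MemLp.toLp_const_smul c f.2.2.1

/-- The gradient as a linear map into an `L²` space. -/
def preGrad : preSub hS hν μ →ₗ[ℝ] Lp ℝ 2 (jumpMeasure μ) where
  toFun f := (preSub_memLp_grad hS hν f).toLp (grad ν f.1)
  map_add' f g := by
    rw [← MemLp.toLp_add]
    congr 1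
    funext z
    simp only [grad, incr, Pi.add_apply, Submodule.coe_add]; ring
  map_smul' c f := by
    rw [RingHom.id_apply, ← MemLp.toLp_const_smul]
    congr 1
    funext z
    simp only [grad, incr, Pi.smul_apply, Submodule.coe_smul, smul_eq_mul]; ring

theorem coeFn_preEmb (f : preSub hS hν μ) : preEmb hS hν f =ᵐ[μ] f.1 :=
  MemLp.coeFn_toLp f.2.2.1

theorem coeFn_preGrad (f : preSub hS hν μ) : preGrad hS hν f =ᵐ[jumpMeasure μ] grad ν f.1 :=
  MemLp.coeFn_toLp (preSub_memLp_grad hS hν f)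

theorem preForm_eq_inner (f g : preSub hS hν μ) :
    preForm ν μ f.1 g.1 = (1 / 2) * inner ℝ (preGrad hS hν f) (preGrad hS hν g) := by
  rw [preForm_eq hS μ (preSub_memLp_grad hS hν f) (preSub_memLp_grad hS hν g), L2.inner_def]
  congr 1
  refine integral_congr_ae ?_
  filter_upwards [coeFn_preGrad hS hν f, coeFn_preGrad hS hν g] with z h1 h2
  rw [h1, h2, real_inner_eq_re_inner, RCLike.inner_apply]
  simp [mul_comm]

theorem preForm_self (f : preSub hS hν μ) :
    preForm ν μ f.1 f.1 = (1 / 2) * ‖preGrad hS hν f‖ ^ 2 := by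
  rw [preForm_eq_inner, real_inner_self_eq_norm_sq]

theorem preForm_sub (f g : preSub hS hν μ) :
    preForm ν μ (f.1 - g.1) (f.1 - g.1) = (1 / 2) * ‖preGrad hS hν f - preGrad hS hν g‖ ^ 2 := by
  rw [← map_sub, ← preForm_self]; rfl

theorem norm_sq_preGrad (f : preSub hS hν μ) :
    ENNReal.ofReal (‖preGrad hS hν f‖ ^ 2) = 2 * energy ν μ f.1 := by
  have h : ‖preGrad hS hν f‖ ^ 2 = ∫ z, grad ν f.1 z ^ 2 ∂jumpMeasure μ := by
    rw [← real_inner_self_eq_norm_sq, L2.inner_def]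
    refine integral_congr_ae ?_
    filter_upwards [coeFn_preGrad hS hν f] with z h1
    rw [h1]; simp [sq]
  rw [h, energy_eq_grad hS hν μ (f.2.1.1.measurable hS), ofReal_integral_eq_lintegral_ofReal
    ((memLp_two_iff_integrable_sq (preSub_memLp_grad hS hν f).1).1 (preSub_memLp_grad hS hν f))
    (ae_of_all _ fun z => sq_nonneg _), ← mul_assoc]
  have : (2 : ℝ≥0∞) * (1 / 2) = 1 := ENNReal.mul_div_cancel (by simp) (by simp)
  rw [this, one_mul]

theorem norm_preGrad_le {f : preSub hS hν μ} {C : ℝ} (hC : 0 ≤ C)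
    (h : energy ν μ f.1 ≤ ENNReal.ofReal C) : ‖preGrad hS hν f‖ ≤ √(2 * C) := by
  refine Real.le_sqrt_of_sq_le ((ENNReal.ofReal_le_ofReal_iff (by positivity)).1 ?_)
  rw [norm_sq_preGrad, ENNReal.ofReal_mul (by norm_num), ENNReal.ofReal_ofNat]
  gcongr

/-- The graph of the closure of the gradient. -/
def formGraph : Submodule ℝ (Lp ℝ 2 μ × Lp ℝ 2 (jumpMeasure μ)) :=
  (LinearMap.range ((preEmb hS hν (μ := μ)).prod (preGrad hS hν))).topologicalClosure

theorem mem_formGraph (f : preSub hS hν μ) :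
    (preEmb hS hν f, preGrad hS hν f) ∈ formGraph hS hν (μ := μ) :=
  Submodule.le_topologicalClosure _ ⟨f, rfl⟩

theorem isClosed_formGraph :
    IsClosed (formGraph hS hν (μ := μ) : Set (Lp ℝ 2 μ × Lp ℝ 2 (jumpMeasure μ))) :=
  Submodule.isClosed_topologicalClosure _

theorem exists_seq_of_mem_formGraph {w : Lp ℝ 2 μ × Lp ℝ 2 (jumpMeasure μ)}
    (hw : w ∈ formGraph hS hν (μ := μ)) : ∃ s : ℕ → preSub hS hν μ,
      Tendsto (fun n => preEmb hS hν (s n)) atTop (𝓝 w.1) ∧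
      Tendsto (fun n => preGrad hS hν (s n)) atTop (𝓝 w.2) := by
  obtain ⟨x, hx, hlim⟩ := mem_closure_iff_seq_limit.1 hw
  choose s hs using hx
  have e : x = fun n => (preEmb hS hν (s n), preGrad hS hν (s n)) := funext fun n => (hs n).symm
  rw [e] at hlim
  exact ⟨s, (continuous_fst.tendsto w).comp hlim, (continuous_snd.tendsto w).comp hlim⟩

theorem exists_near_of_mem_formGraph {w : Lp ℝ 2 μ × Lp ℝ 2 (jumpMeasure μ)}
    (hw : w ∈ formGraph hS hν (μ := μ)) {ε : ℝ} (hε : 0 < ε) : ∃ f : preSub hS hν μ,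
      ‖preEmb hS hν f - w.1‖ < ε ∧ ‖preGrad hS hν f - w.2‖ < ε := by
  obtain ⟨s, h1, h2⟩ := exists_seq_of_mem_formGraph hS hν hw
  obtain ⟨n, h1, h2⟩ := ((Metric.tendsto_nhds.1 h1 ε hε).and (Metric.tendsto_nhds.1 h2 ε hε)).exists
  exact ⟨s n, by rwa [← dist_eq_norm], by rwa [← dist_eq_norm]⟩

theorem tendsto_preEmb_iff {s : ℕ → preSub hS hν μ} {u : Lp ℝ 2 μ} :
    Tendsto (fun n => preEmb hS hν (s n)) atTop (𝓝 u)
      ↔ Tendsto (fun n => eLpNorm ((s n).1 - ⇑u) 2 μ) atTop (𝓝 0) := by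
  rw [Lp.tendsto_Lp_iff_tendsto_eLpNorm']
  refine tendsto_congr fun n => eLpNorm_congr_ae ?_
  exact (coeFn_preEmb hS hν (s n)).sub EventuallyEq.rfl

theorem exists_of_bounded_approx {u : Lp ℝ 2 μ} {C : ℝ}
    (h : ∀ ε : ℝ, 0 < ε → ∃ f : preSub hS hν μ, ‖preEmb hS hν f - u‖ ≤ ε ∧ ‖preGrad hS hν f‖ ≤ C) :
    ∃ v, (u, v) ∈ formGraph hS hν (μ := μ) ∧ ‖v‖ ≤ C :=
  exists_mem_closure_of_norm_le (Submodule.convex _) fun ε hε => by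
    obtain ⟨f, h1, h2⟩ := h ε hε
    exact ⟨_, ⟨f, rfl⟩, h1, h2⟩

/-- Closability as single-valuedness of the closed graph: along an approximating sequence the form
values tend to $\frac12\|w_2\|^2$, and by closability also to 0. -/
theorem formGraph_snd_eq_zero (hcl : IsClosable ν μ) {w : Lp ℝ 2 μ × Lp ℝ 2 (jumpMeasure μ)}
    (hw : w ∈ formGraph hS hν (μ := μ)) (h0 : w.1 = 0) : w.2 = 0 := by
  obtain ⟨s, h1, h2⟩ := exists_seq_of_mem_formGraph hS hν hw
  have hcau : IsCauchySeq ν μ fun n => (s n).1 := by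
    refine ⟨fun n => (s n).2, fun ε hε => ?_⟩
    obtain ⟨N, hN⟩ := Metric.cauchySeq_iff.1 h2.cauchySeq (√ε) (Real.sqrt_pos.2 hε)
    refine ⟨N, fun m hm n hn => ?_⟩
    rw [preForm_sub]
    have h3 := hN m hm n hn
    rw [dist_eq_norm] at h3
    have h4 : ‖preGrad hS hν (s m) - preGrad hS hν (s n)‖ ^ 2 < ε := by
      rw [← Real.sq_sqrt hε.le]
      exact pow_lt_pow_left₀ h3 (norm_nonneg _) (by norm_num)
    linarith
  rw [h0] at h1
  have h1' : Tendsto (fun n => eLpNorm (s n).1 2 μ) atTop (𝓝 0) := by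
    refine ((tendsto_preEmb_iff hS hν).1 h1).congr fun n => eLpNorm_congr_ae ?_
    filter_upwards [Lp.coeFn_zero ℝ 2 μ] with x hx
    rw [Pi.sub_apply, hx, Pi.zero_apply, sub_zero]
  have h3 := hcl _ hcau h1'
  simp_rw [preForm_self] at h3
  have h4 := (h2.norm.pow 2).const_mul (1 / 2 : ℝ)
  have h5 := tendsto_nhds_unique h3 h4
  have h6 : ‖w.2‖ ^ 2 = 0 := by linarith
  exact norm_eq_zero.1 (pow_eq_zero_iff (by norm_num) |>.1 h6)

/-- The closure of the form `(𝔈, 𝔇_∞)`. -/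
def closedForm : L2Form μ where
  dom := (formGraph hS hν (μ := μ)).toLinearPMap.domain
  form := LinearMap.mk₂ ℝ (fun u v => (1 / 2) * inner ℝ ((formGraph hS hν).toLinearPMap u)
      ((formGraph hS hν).toLinearPMap v))
    (fun u v w => by rw [LinearPMap.map_add, inner_add_left, mul_add])
    (fun c u v => by rw [LinearPMap.map_smul, real_inner_smul_left, smul_eq_mul]; ring)
    (fun u v w => by rw [LinearPMap.map_add, inner_add_right, mul_add])
    (fun c u v => by rw [LinearPMap.map_smul, real_inner_smul_right, smul_eq_mul]; ring)

/-- The closed gradient. -/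
def closedGrad : (closedForm hS hν (μ := μ)).dom →ₗ[ℝ] Lp ℝ 2 (jumpMeasure μ) :=
  (formGraph hS hν (μ := μ)).toLinearPMap.toFun

theorem closedForm_form (u v : (closedForm hS hν (μ := μ)).dom) :
    (closedForm hS hν).form u v
      = (1 / 2) * inner ℝ (closedGrad hS hν u) (closedGrad hS hν v) := rfl

theorem closedForm_self (u : (closedForm hS hν (μ := μ)).dom) :
    (closedForm hS hν).form u u = (1 / 2) * ‖closedGrad hS hν u‖ ^ 2 := by
  rw [closedForm_form, real_inner_self_eq_norm_sq]

theorem normSq_eq (u : (closedForm hS hν (μ := μ)).dom) :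
    (closedForm hS hν).normSq u
      = (1 / 2) * ‖closedGrad hS hν u‖ ^ 2 + ‖(u : Lp ℝ 2 μ)‖ ^ 2 := by
  rw [L2Form.normSq, closedForm_self]

theorem mem_dom_of_mem_formGraph {w : Lp ℝ 2 μ × Lp ℝ 2 (jumpMeasure μ)}
    (hw : w ∈ formGraph hS hν (μ := μ)) : w.1 ∈ (closedForm hS hν (μ := μ)).dom :=
  ⟨w, hw, rfl⟩

/-- `toLinearPMap` represents the subspace only when it is a graph, which is where closability
enters. -/
theorem closedGrad_mem (hcl : IsClosable ν μ) (u : (closedForm hS hν (μ := μ)).dom) :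
    ((u : Lp ℝ 2 μ), closedGrad hS hν u) ∈ formGraph hS hν (μ := μ) :=
  Submodule.mem_graph_toLinearPMap (fun _ hx h0 => formGraph_snd_eq_zero hS hν hcl hx h0) u

theorem closedGrad_eq (hcl : IsClosable ν μ) {u : (closedForm hS hν (μ := μ)).dom}
    {v : Lp ℝ 2 (jumpMeasure μ)} (h : ((u : Lp ℝ 2 μ), v) ∈ formGraph hS hν (μ := μ)) :
    closedGrad hS hν u = v := by
  have h1 := Submodule.sub_mem _ (closedGrad_mem hS hν hcl u) h
  exact sub_eq_zero.1 (formGraph_snd_eq_zero hS hν hcl h1 (sub_self _))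

theorem exists_tendsto_of_approximates (hcl : IsClosable ν μ)
    {s : ℕ → Config S → ℝ} {u : Lp ℝ 2 μ} (h : Approximates ν μ s u) :
    ∃ (t : ℕ → preSub hS hν μ) (u' : (closedForm hS hν (μ := μ)).dom), (∀ n, (t n).1 = s n) ∧
      (u' : Lp ℝ 2 μ) = u ∧
      Tendsto (fun n => preGrad hS hν (t n)) atTop (𝓝 (closedGrad hS hν u')) := by
  obtain ⟨⟨hmem, hcau⟩, hlim⟩ := h
  let t : ℕ → preSub hS hν μ := fun n => ⟨s n, hmem n⟩
  have h1 : Tendsto (fun n => preEmb hS hν (t n)) atTop (𝓝 u) := (tendsto_preEmb_iff hS hν).2 hlim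
  have h2 : CauchySeq fun n => preGrad hS hν (t n) := by
    rw [Metric.cauchySeq_iff]
    intro ε hε
    obtain ⟨N, hN⟩ := hcau (ε ^ 2 / 2) (by positivity)
    refine ⟨N, fun m hm n hn => ?_⟩
    have h3 := hN m hm n hn
    rw [show s m = (t m).1 from rfl, show s n = (t n).1 from rfl, preForm_sub] at h3
    rw [dist_eq_norm]
    exact lt_of_pow_lt_pow_left₀ 2 hε.le (by linarith)
  obtain ⟨v, hv⟩ := cauchySeq_tendsto_of_complete h2
  have hw : (u, v) ∈ formGraph hS hν (μ := μ) :=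
    (isClosed_formGraph hS hν).mem_of_tendsto (h1.prodMk_nhds hv)
      (Eventually.of_forall fun n => mem_formGraph hS hν (t n))
  refine ⟨t, ⟨u, mem_dom_of_mem_formGraph hS hν hw⟩, fun _ => rfl, rfl, ?_⟩
  rwa [closedGrad_eq hS hν hcl hw]

theorem isClosureForm_closedForm (hcl : IsClosable ν μ) :
    IsClosureForm ν μ (closedForm hS hν) := by
  refine ⟨fun u => ⟨fun hu => ?_, fun ⟨s, hs⟩ => ?_⟩, fun u v s t hs ht => ?_⟩
  · obtain ⟨s, h1, h2⟩ := exists_seq_of_mem_formGraph hS hν (closedGrad_mem hS hν hcl ⟨u, hu⟩)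
    refine ⟨fun n => (s n).1, ⟨fun n => (s n).2, fun ε hε => ?_⟩,
      (tendsto_preEmb_iff hS hν).1 h1⟩
    obtain ⟨N, hN⟩ := Metric.cauchySeq_iff.1 h2.cauchySeq (√ε) (Real.sqrt_pos.2 hε)
    refine ⟨N, fun m hm n hn => ?_⟩
    rw [preForm_sub]
    have h3 := hN m hm n hn
    rw [dist_eq_norm] at h3
    have h4 : ‖preGrad hS hν (s m) - preGrad hS hν (s n)‖ ^ 2 < ε := by
      rw [← Real.sq_sqrt hε.le]
      exact pow_lt_pow_left₀ h3 (norm_nonneg _) (by norm_num)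
    linarith
  · obtain ⟨-, u', -, rfl, -⟩ := exists_tendsto_of_approximates hS hν hcl hs
    exact u'.2
  · obtain ⟨s', u', hs', hu', h1⟩ := exists_tendsto_of_approximates hS hν hcl hs
    obtain ⟨t', v', ht', hv', h2⟩ := exists_tendsto_of_approximates hS hν hcl ht
    obtain rfl : u' = u := Subtype.ext hu'
    obtain rfl : v' = v := Subtype.ext hv'
    rw [closedForm_form]
    refine ((h1.inner h2).const_mul _).congr fun n => ?_
    rw [← hs', ← ht', preForm_eq_inner]

theorem closed_closedForm (hcl : IsClosable ν μ) (s : ℕ → (closedForm hS hν (μ := μ)).dom)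
    (h : ∀ ε : ℝ, 0 < ε → ∃ N, ∀ k ≥ N, ∀ n ≥ N, (closedForm hS hν).normSq (s k - s n) < ε) :
    ∃ u : (closedForm hS hν (μ := μ)).dom,
      Tendsto (fun n => (closedForm hS hν).normSq (s n - u)) atTop (𝓝 0) := by
  have hc : ∀ ε : ℝ, 0 < ε → ∃ N, ∀ k ≥ N, ∀ n ≥ N,
      ‖closedGrad hS hν (s k) - closedGrad hS hν (s n)‖ < ε ∧
      ‖(s k : Lp ℝ 2 μ) - s n‖ < ε := by
    intro ε hε
    obtain ⟨N, hN⟩ := h (ε ^ 2 / 2) (by positivity)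
    refine ⟨N, fun k hk n hn => ?_⟩
    have h1 := hN k hk n hn
    rw [normSq_eq, map_sub, Submodule.coe_sub] at h1
    have h2 := sq_nonneg ‖closedGrad hS hν (s k) - closedGrad hS hν (s n)‖
    have h3 := sq_nonneg ‖(s k : Lp ℝ 2 μ) - s n‖
    exact ⟨lt_of_pow_lt_pow_left₀ 2 hε.le (by linarith),
      lt_of_pow_lt_pow_left₀ 2 hε.le (by nlinarith)⟩
  have c1 : CauchySeq fun n => closedGrad hS hν (s n) := Metric.cauchySeq_iff.2 fun ε hε => by
    obtain ⟨N, hN⟩ := hc ε hε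
    exact ⟨N, fun k hk n hn => by rw [dist_eq_norm]; exact (hN k hk n hn).1⟩
  have c2 : CauchySeq fun n => (s n : Lp ℝ 2 μ) := Metric.cauchySeq_iff.2 fun ε hε => by
    obtain ⟨N, hN⟩ := hc ε hε
    exact ⟨N, fun k hk n hn => by rw [dist_eq_norm]; exact (hN k hk n hn).2⟩
  obtain ⟨v, hv⟩ := cauchySeq_tendsto_of_complete c1
  obtain ⟨u, hu⟩ := cauchySeq_tendsto_of_complete c2
  have hw : (u, v) ∈ formGraph hS hν (μ := μ) :=
    (isClosed_formGraph hS hν).mem_of_tendsto (hu.prodMk_nhds hv)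
      (Eventually.of_forall fun n => closedGrad_mem hS hν hcl (s n))
  refine ⟨⟨u, mem_dom_of_mem_formGraph hS hν hw⟩, ?_⟩
  have hg : closedGrad hS hν ⟨u, mem_dom_of_mem_formGraph hS hν hw⟩ = v :=
    closedGrad_eq hS hν hcl hw
  simp_rw [normSq_eq, map_sub, Submodule.coe_sub, hg]
  have t1 := ((tendsto_iff_norm_sub_tendsto_zero.1 hv).pow 2).const_mul (1 / 2 : ℝ)
  have t2 := (tendsto_iff_norm_sub_tendsto_zero.1 hu).pow 2
  simpa using t1.add t2

/-- A function in `𝔇_∞`, as an element of the domain of the closed form. -/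
def domOf (f : preSub hS hν μ) : (closedForm hS hν (μ := μ)).dom :=
  ⟨preEmb hS hν f, mem_dom_of_mem_formGraph hS hν (mem_formGraph hS hν f)⟩

/-- Every element of the domain is approximated in graph norm from $\mathfrak D_\infty$, so only
functions of that space need approximating. -/
theorem isDense_of_formGraph (hcl : IsClosable ν μ) {A : Set (closedForm hS hν (μ := μ)).dom}
    (h : ∀ (f : preSub hS hν μ), ∀ ε : ℝ, 0 < ε → ∃ a ∈ A,
      ‖preEmb hS hν f - (a : Lp ℝ 2 μ)‖ < ε ∧ ‖preGrad hS hν f - closedGrad hS hν a‖ < ε) :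
    (closedForm hS hν (μ := μ)).IsDense A := by
  intro u ε hε
  -- Two errors below `e` in each component give at most
  -- $\frac12(2e)^2+(2e)^2=6e^2\le3e<\varepsilon$.
  set e := min (ε / 16) (1 / 2) with he
  have he0 : 0 < e := lt_min (by linarith) (by norm_num)
  have he1 : e ≤ 1 / 2 := min_le_right _ _
  have he2 : e ≤ ε / 16 := min_le_left _ _
  obtain ⟨f, f1, f2⟩ := exists_near_of_mem_formGraph hS hν (closedGrad_mem hS hν hcl u) he0
  obtain ⟨a, ha, a1, a2⟩ := h f e he0
  have f1' : ‖(u : Lp ℝ 2 μ) - preEmb hS hν f‖ < e := by rw [norm_sub_rev]; exact f1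
  have f2' : ‖closedGrad hS hν u - preGrad hS hν f‖ < e := by rw [norm_sub_rev]; exact f2
  refine ⟨a, ha, ?_⟩
  have h1 : ‖closedGrad hS hν u - closedGrad hS hν a‖ ≤ 2 * e := by
    have := norm_sub_le_norm_sub_add_norm_sub (closedGrad hS hν u) (preGrad hS hν f)
      (closedGrad hS hν a)
    linarith
  have h2 : ‖(u : Lp ℝ 2 μ) - a‖ ≤ 2 * e := by
    have := norm_sub_le_norm_sub_add_norm_sub (u : Lp ℝ 2 μ) (preEmb hS hν f) (a : Lp ℝ 2 μ)
    linarith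
  rw [normSq_eq, map_sub, Submodule.coe_sub]
  have h3 := pow_le_pow_left₀ (norm_nonneg _) h1 2
  have h4 := pow_le_pow_left₀ (norm_nonneg _) h2 2
  nlinarith

theorem isDense_range_domOf (hcl : IsClosable ν μ) :
    (closedForm hS hν (μ := μ)).IsDense (range (domOf hS hν)) :=
  isDense_of_formGraph hS hν hcl fun f ε hε => ⟨domOf hS hν f, ⟨f, rfl⟩, by
    rw [domOf, sub_self, norm_zero]; exact hε, by
    rw [domOf, closedGrad_eq hS hν hcl (mem_formGraph hS hν f), sub_self, norm_zero]; exact hε⟩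

/-- A contraction need not be smooth and would leave $\mathfrak D_\infty$; its mollification stays
there and still increases no increment. Boundedness of `c` keeps the result in $L^2$. -/
theorem exists_contraction (f : preSub hS hν μ) {c : ℝ → ℝ} (hc : LipschitzWith 1 c)
    {B : ℝ} (hB : ∀ t, |c t| ≤ B) {ε : ℝ} (hε : 0 < ε) :
    ∃ g : preSub hS hν μ, (∀ ξ, |g.1 ξ - c (f.1 ξ)| ≤ ε) ∧ (∀ z, |incr g.1 z| ≤ |incr f.1 z|) ∧
      ‖preGrad hS hν g‖ ≤ ‖preGrad hS hν f‖ := by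
  obtain ⟨G, hG, hG1, hGc⟩ := exists_contDiff_lipschitz_approx hc hε
  have hGB : ∀ t, |G t| ≤ B + ε := fun t => by
    have h1 := abs_add_le (G t - c t) (c t)
    rw [sub_add_cancel] at h1
    linarith [hGc t, hB t]
  have hm : (fun ξ => G (f.1 ξ)) ∈ preDomain ν μ :=
    comp₂_mem_preDomain hS hν f.2 f.2 (G := fun p => G p.1) (hG.comp contDiff_fst)
      (MemLp.of_bound (hG.continuous.measurable.comp
        (f.2.1.1.measurable hS)).aestronglyMeasurable (B + ε) (ae_of_all _ fun ξ => hGB _))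
      (a := 1) (b := 0) zero_le_one le_rfl fun z => by
        have := sq_le_sq.2 (hG1 (f.1 (jumpMap z)) (f.1 z.1.1))
        simp only [incr]; linarith
  refine ⟨⟨_, hm⟩, fun ξ => hGc _, fun z => hG1 _ _, Lp.norm_le_norm_of_ae_le ?_⟩
  filter_upwards [coeFn_preGrad hS hν f, coeFn_preGrad hS hν ⟨_, hm⟩] with z h1 h2
  rw [h1, h2, grad, grad, norm_mul, norm_mul]
  exact mul_le_mul_of_nonneg_right (hG1 _ _) (norm_nonneg _)

theorem lipschitzWith_clamp : LipschitzWith 1 fun t : ℝ => min (max t 0) 1 :=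
  (LipschitzWith.id.max_const 0).min_const 1

/-- Smoothed contractions of functions approximating `u` tend to `v` in $L^2$, with gradients of
norm at most $\|\nabla u\|+\eta$. The weak-limit lemma yields a gradient for `v` with that bound; it
is unique, so $\eta\to0$ is allowed. -/
theorem markov_closedForm (hcl : IsClosable ν μ) (u : (closedForm hS hν (μ := μ)).dom)
    (v : Lp ℝ 2 μ) (hv : ∀ᵐ x ∂μ, v x = min (max ((u : Lp ℝ 2 μ) x) 0) 1) :
    ∃ hv : v ∈ (closedForm hS hν (μ := μ)).dom,
      (closedForm hS hν).form ⟨v, hv⟩ ⟨v, hv⟩ ≤ (closedForm hS hν).form u u := by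
  have key : ∀ η : ℝ, 0 < η → ∃ w, (v, w) ∈ formGraph hS hν (μ := μ) ∧
      ‖w‖ ≤ ‖closedGrad hS hν u‖ + η := by
    intro η hη
    refine exists_of_bounded_approx hS hν fun ε hε => ?_
    obtain ⟨f, f1, f2⟩ := exists_near_of_mem_formGraph hS hν (closedGrad_mem hS hν hcl u)
      (lt_min (half_pos hε) hη)
    obtain ⟨g, g1, -, g2⟩ := exists_contraction hS hν f lipschitzWith_clamp (B := 1)
      (fun t => abs_le.2 ⟨by have := le_min (le_max_right t 0) zero_le_one; linarith,
        min_le_right _ _⟩) (half_pos hε)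
    refine ⟨g, ?_, ?_⟩
    · have hle : ‖preEmb hS hν g - v‖ ≤ ‖Lp.const 2 μ (ε / 2)‖ + ‖preEmb hS hν f - (u : Lp ℝ 2 μ)‖ := by
        have h0 : ‖preEmb hS hν g - v‖
            ≤ ‖Lp.const 2 μ (ε / 2) + |preEmb hS hν f - (u : Lp ℝ 2 μ)|‖ := by
          refine Lp.norm_le_norm_of_ae_le ?_
          filter_upwards [hv, coeFn_preEmb hS hν f, coeFn_preEmb hS hν g,
            Lp.coeFn_sub (preEmb hS hν g) v, Lp.coeFn_sub (preEmb hS hν f) (u : Lp ℝ 2 μ),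
            Lp.coeFn_add (Lp.const 2 μ (ε / 2)) |preEmb hS hν f - (u : Lp ℝ 2 μ)|,
            Lp.coeFn_abs (preEmb hS hν f - (u : Lp ℝ 2 μ)),
            Lp.coeFn_const (p := 2) (μ := μ) (ε / 2)] with x h1 h2 h3 h4 h5 h6 h7 h8
          rw [h4, h6, Pi.sub_apply, Pi.add_apply, h7, h5, Pi.sub_apply, h8, h1, h2, h3,
            Function.const_apply, Real.norm_eq_abs, Real.norm_eq_abs,
            abs_of_nonneg (a := ε / 2 + _) (by positivity)]
          have h9 := lipschitzWith_clamp.dist_le_mul (f.1 x) ((u : Lp ℝ 2 μ) x)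
          rw [NNReal.coe_one, one_mul, Real.dist_eq, Real.dist_eq] at h9
          refine (abs_sub_le _ (min (max (f.1 x) 0) 1) _).trans ?_
          exact add_le_add (g1 x) h9
        refine h0.trans ((norm_add_le _ _).trans_eq ?_)
        rw [norm_abs_eq_norm]
      have h1 : ‖Lp.const 2 μ (ε / 2)‖ ≤ ε / 2 := by
        refine (Lp.norm_const_le _ _ _).trans_eq ?_
        simp [abs_of_pos hε]
      have h2 := f1.trans_le (min_le_left _ _)
      simp only at h2
      linarith
    · have h2 := f2.trans_le (min_le_right _ _)
      have h3 := norm_le_norm_add_norm_sub' (preGrad hS hν f) (closedGrad hS hν u)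
      simp only at h2
      linarith
  obtain ⟨w, hw, -⟩ := key 1 one_pos
  refine ⟨mem_dom_of_mem_formGraph hS hν hw, ?_⟩
  rw [closedForm_self, closedForm_self]
  have hle : ‖closedGrad hS hν ⟨v, mem_dom_of_mem_formGraph hS hν hw⟩‖ ≤ ‖closedGrad hS hν u‖ := by
    refine le_of_forall_pos_le_add fun η hη => ?_
    obtain ⟨w', hw', hle⟩ := key η hη
    rwa [closedGrad_eq hS hν hcl hw']
  gcongr

end Form

/-! ### Functions of linear statistics and density in `L²` -/

theorem WeightBounded.const_mul {d : ℕ} {C : ℝ} {φ : Space d → ℝ} (h : WeightBounded C φ)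
    {c : ℝ} (hc : 0 ≤ c) : WeightBounded (c * C) (fun x => c * φ x) := by
  refine ⟨fun x => ?_, fun x y hxy => ?_⟩
  · rw [abs_mul, abs_of_nonneg hc, mul_assoc]
    exact mul_le_mul_of_nonneg_left (h.1 x) hc
  · rw [← mul_sub, abs_mul, abs_of_nonneg hc, mul_assoc, mul_assoc, ← mul_assoc C]
    exact mul_le_mul_of_nonneg_left (h.2 x y hxy) hc

/-- Functions whose increments are bounded by those of a linear statistic have finite energy,
controlled by the constant `B`. -/
def EnergyBounded {d : ℕ} {S : Set (Space d)} (ν : Config S → Space d → Space d → ℝ≥0)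
    (μ : Measure (Config S)) (B : ℝ≥0∞) : Prop :=
  ∀ (C : ℝ) (φ : Space d → ℝ), WeightBounded C φ → ∀ f : Config S → ℝ,
    (∀ z ∈ jumpSet S, incr f z ^ 2 ≤ (φ z.2 - φ z.1.2) ^ 2) →
    energy ν μ f ≤ ENNReal.ofReal (C ^ 2) * B

section Density

variable {d : ℕ} {S : Set (Space d)} {ν : Config S → Space d → Space d → ℝ≥0}
  {μ : Measure (Config S)} {B : ℝ≥0∞}

/-- The increments are dominated by those of the statistic of $L\varphi$. -/
theorem EnergyBounded.comp_pair (hB : EnergyBounded ν μ B) {C : ℝ} {φ : C_c(Space d, ℝ)}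
    (hφ : WeightBounded C φ) {G : ℝ → ℝ} {L : ℝ≥0} (hG : LipschitzWith L G) :
    energy ν μ (fun ξ => G (pair φ ξ)) ≤ ENNReal.ofReal ((L * C) ^ 2) * B := by
  refine hB _ _ (hφ.const_mul L.coe_nonneg) _ fun z hz => ?_
  have h1 := hG.dist_le_mul (pair φ (jumpMap z)) (pair φ z.1.1)
  rw [Real.dist_eq, Real.dist_eq] at h1
  have h2 : pair φ (jumpMap z) - pair φ z.1.1 = φ z.2 - φ z.1.2 := incr_pair φ hz
  rw [← mul_sub, ← h2]
  refine sq_le_sq.2 (h1.trans_eq ?_)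
  rw [abs_mul, abs_of_nonneg L.coe_nonneg]

theorem comp_pair_mem_preDomain [IsProbabilityMeasure μ] (hS : MeasurableSet S)
    (hB : EnergyBounded ν μ B) (hBt : B < ⊤) {φ : C_c(Space d, ℝ)} (hφ : ContDiff ℝ ∞ φ)
    {G : ℝ → ℝ} (hG : ContDiff ℝ ∞ G) {L : ℝ≥0} (hGL : LipschitzWith L G) {M : ℝ}
    (hM : ∀ t, |G t| ≤ M) : (fun ξ : Config S => G (pair φ ξ)) ∈ preDomain ν μ := by
  obtain ⟨C, hC⟩ := weightBounded_of_contDiff hφ φ.hasCompactSupport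
  exact ⟨(isLocalSmooth_pair hS φ hφ).comp hS hG,
    MemLp.of_bound (hG.continuous.measurable.comp
      (measurable_pair_cc φ)).aestronglyMeasurable M (ae_of_all _ fun ξ => hM _),
    (hB.comp_pair hC hGL).trans_lt (ENNReal.mul_lt_top ENNReal.ofReal_lt_top hBt)⟩

/-- The indicator of `A` is the pointwise limit of functions in `𝔇_∞` with values in `[0, 1]`. -/
def IsApproximable (ν : Config S → Space d → Space d → ℝ≥0) (μ : Measure (Config S))
    (A : Set (Config S)) : Prop :=
  ∃ f : ℕ → Config S → ℝ, (∀ n, f n ∈ preDomain ν μ) ∧ (∀ n ξ, |f n ξ| ≤ 1) ∧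
    ∀ ξ, Tendsto (fun n => f n ξ) atTop (𝓝 (A.indicator 1 ξ))

theorem IsApproximable.inter [IsProbabilityMeasure μ] (hS : MeasurableSet S)
    (hν : Measurable (rate ν)) {A A' : Set (Config S)} (h : IsApproximable ν μ A)
    (h' : IsApproximable ν μ A') : IsApproximable ν μ (A ∩ A') := by
  obtain ⟨f, f1, f2, f3⟩ := h
  obtain ⟨g, g1, g2, g3⟩ := h'
  refine ⟨fun n ξ => f n ξ * g n ξ, fun n => mul_mem_preDomain hS hν (f1 n) (g1 n) (f2 n) (g2 n),
    fun n ξ => ?_, fun ξ => ?_⟩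
  · rw [abs_mul]
    exact mul_le_one₀ (f2 n ξ) (abs_nonneg _) (g2 n ξ)
  · rw [Set.inter_indicator_one]
    exact (f3 ξ).mul (g3 ξ)

/-- Smooth steps of slope proportional to `n` that vanish at and below level `a`. -/
theorem isApproximable_lt_pair [IsProbabilityMeasure μ] (hS : MeasurableSet S)
    (hB : EnergyBounded ν μ B) (hBt : B < ⊤) {φ : C_c(Space d, ℝ)} (hφ : ContDiff ℝ ∞ φ) (a : ℝ) :
    IsApproximable ν μ {ξ | a < pair φ ξ} := by
  obtain ⟨L, -, hL⟩ := exists_lipschitz_smoothTransition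
  refine ⟨fun n ξ => Real.smoothTransition (n * (pair φ ξ - a)), fun n => ?_, fun n ξ => ?_,
    fun ξ => ?_⟩
  · refine comp_pair_mem_preDomain hS hB hBt hφ
      (G := fun t => Real.smoothTransition (n * (t - a))) (L := L * n) (M := 1)
      (Real.smoothTransition.contDiff.comp
        (contDiff_const.mul (contDiff_id.sub contDiff_const))) ?_ fun t => ?_
    · refine LipschitzWith.of_dist_le_mul fun s t => ?_
      refine (hL.dist_le_mul _ _).trans_eq ?_
      rw [Real.dist_eq, Real.dist_eq, ← mul_sub, sub_sub_sub_cancel_right, abs_mul, Nat.abs_cast]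
      push_cast; ring
    · rw [abs_of_nonneg (Real.smoothTransition.nonneg _)]
      exact Real.smoothTransition.le_one _
  · rw [abs_of_nonneg (Real.smoothTransition.nonneg _)]
    exact Real.smoothTransition.le_one _
  · by_cases h : a < pair φ ξ
    · rw [Set.indicator_of_mem (by exact h)]
      refine tendsto_const_nhds.congr' ?_
      have hp : 0 < pair φ ξ - a := sub_pos.2 h
      filter_upwards [eventually_ge_atTop ⌈(pair φ ξ - a)⁻¹⌉₊] with n hn
      refine (Real.smoothTransition.one_of_one_le ?_).symm
      rw [← inv_mul_cancel₀ hp.ne']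
      exact mul_le_mul_of_nonneg_right (Nat.ceil_le.1 hn) hp.le
    · rw [Set.indicator_of_notMem (by exact h)]
      refine tendsto_const_nhds.congr fun n => ?_
      refine (Real.smoothTransition.zero_of_nonpos ?_).symm
      exact mul_nonpos_of_nonneg_of_nonpos n.cast_nonneg (by linarith [not_lt.1 h])

theorem comap_le_of_measurableSet_lt {X ι : Type*} {m : MeasurableSpace X} {f : X → ι → ℝ}
    (h : ∀ k a, MeasurableSet[m] {x | a < f x k}) :
    MeasurableSpace.comap f inferInstance ≤ m :=
  Measurable.comap_le (measurable_pi_iff.2 fun k => measurable_of_Ioi (h k))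

theorem generateFrom_isApproximable [IsProbabilityMeasure μ] (hS : MeasurableSet S)
    (hB : EnergyBounded ν μ B) (hBt : B < ⊤) :
    (inferInstance : MeasurableSpace (Config S))
      = MeasurableSpace.generateFrom {A | MeasurableSet A ∧ IsApproximable ν μ A} := by
  obtain ⟨φ, hφ, hφi⟩ := exists_countable_smooth_inducing S
  refine le_antisymm ?_ (MeasurableSpace.generateFrom_le fun A hA => hA.1)
  rw [measurableSpace_eq_comap hφi]
  refine comap_le_of_measurableSet_lt fun k a => ?_
  exact MeasurableSpace.measurableSet_generateFrom
    ⟨measurable_pair_cc (φ k) measurableSet_Ioi, isApproximable_lt_pair hS hB hBt (hφ k) a⟩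

/-- An element orthogonal to $\mathfrak D_\infty$ integrates to 0 over approximable sets, by
dominated convergence. These form a generating π-system, so it integrates to 0 over every measurable
set; the constants handle complements. -/
theorem dense_preEmb [IsProbabilityMeasure μ] (hS : MeasurableSet S) (hν : Measurable (rate ν))
    (hB : EnergyBounded ν μ B) (hBt : B < ⊤) :
    (LinearMap.range (preEmb hS hν (μ := μ))).topologicalClosure = ⊤ := by
  rw [Submodule.topologicalClosure_eq_top_iff, Submodule.eq_bot_iff]
  intro u hu
  have hint : Integrable u μ := (Lp.memLp u).integrable (by norm_num)
  have h0 : ∀ f ∈ preDomain ν μ, ∫ ξ, f ξ * u ξ ∂μ = 0 := fun f hf => by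
    have h1 : inner ℝ (preEmb hS hν ⟨f, hf⟩) u = 0 := hu _ ⟨_, rfl⟩
    rw [L2.inner_def] at h1
    rw [← h1]
    refine integral_congr_ae ?_
    filter_upwards [coeFn_preEmb hS hν ⟨f, hf⟩] with ξ h2
    rw [h2, real_inner_eq_re_inner, RCLike.inner_apply]
    simp [mul_comm]
  have hA0 : ∀ A, MeasurableSet A → IsApproximable ν μ A → ∫ ξ in A, u ξ ∂μ = 0 := by
    rintro A hA ⟨f, f1, f2, f3⟩
    have h1 : Tendsto (fun n => ∫ ξ, f n ξ * u ξ ∂μ) atTop (𝓝 (∫ ξ, A.indicator 1 ξ * u ξ ∂μ)) := by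
      refine tendsto_integral_of_dominated_convergence (fun ξ => ‖u ξ‖) (fun n => ?_) hint.norm
        (fun n => ae_of_all _ fun ξ => ?_) (ae_of_all _ fun ξ => (f3 ξ).mul_const _)
      · exact (f1 n).2.1.1.mul hint.1
      · rw [norm_mul]
        exact mul_le_of_le_one_left (norm_nonneg _) (f2 n ξ)
    simp_rw [h0 _ (f1 _)] at h1
    rw [← integral_indicator hA]
    refine Eq.trans (integral_congr_ae (ae_of_all _ fun ξ => ?_))
      (tendsto_nhds_unique tendsto_const_nhds h1).symm
    by_cases h : ξ ∈ A <;> simp [h]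
  have huniv : ∫ ξ, u ξ ∂μ = 0 := by
    have := h0 _ (const_mem_preDomain hS hν 1)
    simpa using this
  have hall : ∀ A, MeasurableSet A → ∫ ξ in A, u ξ ∂μ = 0 := by
    intro A hA
    induction A, hA using MeasurableSpace.induction_on_inter
      (generateFrom_isApproximable hS hB hBt (ν := ν) (μ := μ)) with
    | h_inter =>
      rintro A hA A' hA' -
      exact ⟨hA.1.inter hA'.1, hA.2.inter hS hν hA'.2⟩
    | empty => simp
    | basic A hA => exact hA0 A hA.1 hA.2
    | compl A hA ih =>
      have := integral_add_compl hA hint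
      rwa [ih, zero_add, huniv] at this
    | iUnion A hd hA ih =>
      rw [integral_iUnion hA hd hint.integrableOn]
      simp [ih]
  exact Lp.eq_zero_iff_ae_eq_zero.2
    (hint.ae_eq_zero_of_forall_setIntegral_eq_zero fun A hA _ => hall A hA)

theorem dense_closedForm [IsProbabilityMeasure μ] (hS : MeasurableSet S) (hν : Measurable (rate ν))
    (hB : EnergyBounded ν μ B) (hBt : B < ⊤) :
    Dense ((closedForm hS hν (μ := μ)).dom : Set (Lp ℝ 2 μ)) := by
  have h := Submodule.dense_iff_topologicalClosure_eq_top.2 (dense_preEmb hS hν hB hBt (μ := μ))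
  refine h.mono ?_
  rintro _ ⟨f, rfl⟩
  exact (domOf hS hν f).2

theorem isDirichlet_closedForm [IsProbabilityMeasure μ] (hS : MeasurableSet S)
    (hν : Measurable (rate ν)) (hB : EnergyBounded ν μ B) (hBt : B < ⊤) (hcl : IsClosable ν μ) :
    (closedForm hS hν (μ := μ)).IsDirichlet where
  dense := dense_closedForm hS hν hB hBt
  symm u v := by rw [closedForm_form, closedForm_form, real_inner_comm]
  nonneg u := by rw [closedForm_self]; positivity
  closed := closed_closedForm hS hν hcl
  markov := markov_closedForm hS hν hcl

end Density

/-! ### Compact nests -/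

theorem tendsto_toLp_of_dominated {X : Type*} [MeasurableSpace X] {m : Measure X}
    {F : ℕ → Lp ℝ 2 m} {h G : X → ℝ} (hh : MemLp h 2 m) (hG : MemLp G 2 m)
    (hFG : ∀ n, ∀ᵐ x ∂m, |F n x - h x| ≤ G x)
    (hlim : ∀ᵐ x ∂m, Tendsto (fun n => F n x) atTop (𝓝 (h x))) :
    Tendsto F atTop (𝓝 (hh.toLp h)) := by
  rw [Lp.tendsto_Lp_iff_tendsto_eLpNorm]
  exact tendsto_eLpNorm_two_of_dominated (fun n => (Lp.memLp (F n)).1) hG hFG hlim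

theorem L2Form.isNest_univ {X : Type*} [MeasurableSpace X] [TopologicalSpace X] {m : Measure X}
    (F : L2Form m) : F.IsNest fun _ => univ := by
  refine ⟨monotone_const, fun _ => isClosed_univ, fun u ε hε => ⟨u, ⟨0, ?_⟩, ?_⟩⟩
  · exact ae_of_all _ fun x hx => absurd (mem_univ x) hx
  · rw [sub_self, L2Form.normSq]
    simpa using hε

/-- The weight as a continuous function. -/
def weightMap {d : ℕ} : C(Space d, ℝ) := ⟨weight, contDiff_weight.continuous⟩

theorem ae_integrable_weight {d : ℕ} {S : Set (Space d)} {μ : Measure (Config S)} {s : ℝ}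
    (h : ∫⁻ ξ, ∫⁻ x, ENNReal.ofReal ((1 + ‖x‖) ^ (-s)) ∂ξ.1 ∂μ < (⊤ : ℝ≥0∞)) :
    ∀ᵐ ξ ∂μ, Integrable (weight (d := d)) ξ.1 := by
  obtain ⟨K, hK, hKw⟩ := exists_weight_le_rpow (d := d) s
  have hmeas : Measurable fun x : Space d => ENNReal.ofReal ((1 + ‖x‖) ^ (-s)) :=
    ((measurable_const.add measurable_norm).pow_const _).ennreal_ofReal
  have h1 := ae_lt_top ((Measure.measurable_lintegral hmeas).comp (measurable_val S)) h.ne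
  filter_upwards [h1] with ξ hξ
  refine ⟨contDiff_weight.continuous.aestronglyMeasurable, ?_⟩
  rw [hasFiniteIntegral_iff_ofReal (ae_of_all _ fun x => (weight_pos x).le)]
  calc ∫⁻ x, ENNReal.ofReal (weight x) ∂ξ.1
      ≤ ∫⁻ x, ENNReal.ofReal K * ENNReal.ofReal ((1 + ‖x‖) ^ (-s)) ∂ξ.1 := by
        refine lintegral_mono fun x => ?_
        rw [← ENNReal.ofReal_mul hK.le]
        exact ENNReal.ofReal_le_ofReal (hKw x)
    _ = ENNReal.ofReal K * ∫⁻ x, ENNReal.ofReal ((1 + ‖x‖) ^ (-s)) ∂ξ.1 :=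
        lintegral_const_mul _ hmeas
    _ < ⊤ := ENNReal.mul_lt_top ENNReal.ofReal_lt_top hξ

/-- A bound on the number of particles in `U_r` when the total weight is at most `2 (n + 1)`. -/
def countBound (n r : ℕ) : ℕ := ⌈2 * ((n : ℝ) + 1) * Real.exp (1 + r)⌉₊

/-- A compact set of configurations. -/
def compactSet {d : ℕ} (S : Set (Space d)) (n : ℕ) : Set (Config S) :=
  range (enumConfig (S := S) (a := countBound n))

theorem monotone_compactSet {d : ℕ} (S : Set (Space d)) : Monotone (compactSet S) := by
  refine fun n m h => range_enumConfig_mono fun r => Nat.ceil_mono ?_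
  have : (n : ℝ) ≤ m := by exact_mod_cast h
  gcongr

/-- Each particle in $U_r$ contributes at least $e^{-(1+r)}$ to the total weight. Integrability
cannot be dropped: without it the Bochner integral is 0 and bounds nothing. -/
theorem mem_compactSet {d : ℕ} {S : Set (Space d)} (hS : MeasurableSet S) {n : ℕ} {ξ : Config S}
    (hi : Integrable (weight (d := d)) ξ.1) (h : pair weight ξ ≤ 2 * ((n : ℝ) + 1)) :
    ξ ∈ compactSet S n := by
  refine mem_range_enumConfig (fun r => ?_) hS
  have hm : MeasurableSet (U S (r : ℝ)) := measurableSet_U hS r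
  have hfin : ξ.1 (U S r) < ⊤ := by
    refine (measure_mono ?_).trans_lt (ξ.2.finite _ (isCompact_closedBall (0 : Space d) r))
    exact inter_subset_right
  have h1 : Real.exp (-(1 + r)) * ξ.1.real (U S r) ≤ pair weight ξ := by
    have h2 : ∫ _x in U S (r : ℝ), Real.exp (-(1 + r)) ∂ξ.1 ≤ ∫ x in U S (r : ℝ), weight x ∂ξ.1 := by
      refine setIntegral_mono_on (integrableOn_const hfin.ne) hi.integrableOn hm fun x hx => ?_
      have h3 : ‖x‖ ≤ r := mem_closedBall_zero_iff.1 hx.2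
      exact Real.exp_le_exp.2 (by linarith [bracket_le x])
    rw [setIntegral_const, smul_eq_mul, mul_comm] at h2
    exact h2.trans (setIntegral_le_integral hi (ae_of_all _ fun x => (weight_pos x).le))
  have h4 : ξ.1.real (U S r) ≤ countBound n r := by
    refine le_trans ?_ (Nat.le_ceil _)
    have h5 := mul_le_mul_of_nonneg_right (h1.trans h) (Real.exp_pos (1 + r)).le
    rwa [mul_right_comm, ← Real.exp_add, neg_add_cancel, Real.exp_zero, one_mul] at h5
  rw [← ENNReal.ofReal_toReal hfin.ne, ← ENNReal.ofReal_natCast]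
  exact ENNReal.ofReal_le_ofReal h4

section Nest

variable {d : ℕ} {S : Set (Space d)} {ν : Config S → Space d → Space d → ℝ≥0}
  {μ : Measure (Config S)} [IsProbabilityMeasure μ] {B : ℝ≥0∞}
  (hS : MeasurableSet S) (hν : Measurable (rate ν))

/-- The cut-off function on configurations built from a linear statistic. -/
def cutoff (φ : Space d → ℝ) (n : ℕ) (ξ : Config S) : ℝ :=
  Real.smoothTransition (2 - pair φ ξ / (n + 1))

theorem cutoff_nonneg (φ : Space d → ℝ) (n : ℕ) (ξ : Config S) : 0 ≤ cutoff φ n ξ :=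
  Real.smoothTransition.nonneg _

theorem cutoff_le_one (φ : Space d → ℝ) (n : ℕ) (ξ : Config S) : cutoff φ n ξ ≤ 1 :=
  Real.smoothTransition.le_one _

theorem abs_cutoff_le_one (φ : Space d → ℝ) (n : ℕ) (ξ : Config S) : |cutoff φ n ξ| ≤ 1 := by
  rw [abs_of_nonneg (cutoff_nonneg φ n ξ)]; exact cutoff_le_one φ n ξ

/-- The weight has no compact support, so its cut-off is reached only as a limit of cut-offs by
compactly supported statistics. -/
theorem tendsto_cutoff_cutMul {ξ : Config S} (hi : Integrable (weight (d := d)) ξ.1) (n : ℕ) :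
    Tendsto (fun R : ℕ => cutoff (cutMul weightMap R) n ξ) atTop (𝓝 (cutoff weight n ξ)) := by
  have h : Tendsto (fun R : ℕ => pair (cutMul weightMap R) ξ) atTop (𝓝 (pair weight ξ)) := by
    refine tendsto_integral_of_dominated_convergence weight
      (fun R => (cutMul weightMap R).continuous.aestronglyMeasurable) hi
      (fun R => ae_of_all _ fun x => ?_) (ae_of_all _ fun x => ?_)
    · change ‖weight x * cut R x‖ ≤ weight x
      rw [norm_mul, Real.norm_of_nonneg (weight_pos x).le, Real.norm_of_nonneg (cut_nonneg _ x)]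
      exact mul_le_of_le_one_right (weight_pos x).le (cut_le_one _ x)
    · refine tendsto_const_nhds.congr' ?_
      filter_upwards [eventually_ge_atTop ⌈‖x‖⌉₊] with R hR
      change weight x = weight x * cut R x
      rw [cut_eq_one (Nat.ceil_le.1 hR), mul_one]
  exact (Real.smoothTransition.continuous.tendsto _).comp (tendsto_const_nhds.sub (h.div_const _))

/-- Dividing the statistic by $n+1$ scales the gradient by the same factor, and the bound is uniform
in the radius `R`. -/
theorem exists_cutoff_mem (hB : EnergyBounded ν μ B) (hBt : B < ⊤) : ∃ D : ℝ, 0 ≤ D ∧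
    ∀ n R : ℕ, ∃ χ : preSub hS hν μ, χ.1 = cutoff (cutMul weightMap R) n ∧
      ‖preGrad hS hν χ‖ ≤ D / (n + 1) := by
  obtain ⟨L, -, hL⟩ := exists_lipschitz_smoothTransition
  set b := B.toReal with hb
  have hBb : B = ENNReal.ofReal b := (ENNReal.ofReal_toReal hBt.ne).symm
  -- The weight bound of the truncated weight is $2(1+L)$, the slope of the cut-off is $L/(n+1)$,
  -- and the squared gradient norm is twice the energy.
  refine ⟨√(2 * b) * (L * (2 * (1 + L))), by positivity, fun n R => ?_⟩
  have hn : (0 : ℝ) < n + 1 := by positivity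
  have hGL : LipschitzWith (L / (n + 1)) fun t : ℝ => Real.smoothTransition (2 - t / (n + 1)) := by
    refine LipschitzWith.of_dist_le_mul fun s t => (hL.dist_le_mul _ _).trans_eq ?_
    rw [Real.dist_eq, Real.dist_eq, sub_sub_sub_cancel_left, ← sub_div, abs_div, abs_of_pos hn,
      abs_sub_comm]
    push_cast; ring
  have hmem : (cutoff (cutMul weightMap R) n : Config S → ℝ) ∈ preDomain ν μ :=
    comp_pair_mem_preDomain hS hB hBt (φ := cutMul weightMap R)
      (contDiff_weight.mul (contDiff_cut _))
      (G := fun t => Real.smoothTransition (2 - t / (n + 1))) (M := 1)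
      (Real.smoothTransition.contDiff.comp (contDiff_const.sub (contDiff_id.div_const _))) hGL
      fun t => by
        rw [abs_of_nonneg (Real.smoothTransition.nonneg _)]
        exact Real.smoothTransition.le_one _
  refine ⟨⟨_, hmem⟩, rfl, ?_⟩
  have hE := hB.comp_pair (φ := cutMul weightMap R) (weightBounded_weight.mul_cut hL R) hGL
  rw [hBb, ← ENNReal.ofReal_mul (sq_nonneg _)] at hE
  refine (norm_preGrad_le hS hν (f := ⟨_, hmem⟩) (by positivity) hE).trans_eq ?_
  rw [mul_comm _ b, ← mul_assoc, Real.sqrt_mul (by positivity), Real.sqrt_sq (by positivity)]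
  push_cast
  field_simp

theorem norm_preGrad_mul_le {f g h : preSub hS hν μ} {a b : ℝ} (hf : ∀ ξ, |f.1 ξ| ≤ a)
    (hg : ∀ ξ, |g.1 ξ| ≤ b) (hh : ∀ ξ, h.1 ξ = f.1 ξ * g.1 ξ) :
    ‖preGrad hS hν h‖ ≤ b * ‖preGrad hS hν f‖ + a * ‖preGrad hS hν g‖ := by
  obtain ⟨ξ₀⟩ : Nonempty (Config S) := nonempty_of_isProbabilityMeasure μ
  have ha : 0 ≤ a := (abs_nonneg _).trans (hf ξ₀)
  have hb : 0 ≤ b := (abs_nonneg _).trans (hg ξ₀)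
  have h1 : ‖preGrad hS hν h‖ ≤ ‖b • |preGrad hS hν f| + a • |preGrad hS hν g|‖ := by
    refine Lp.norm_le_norm_of_ae_le ?_
    filter_upwards [coeFn_preGrad hS hν f, coeFn_preGrad hS hν g, coeFn_preGrad hS hν h,
      Lp.coeFn_add (b • |preGrad hS hν f|) (a • |preGrad hS hν g|),
      Lp.coeFn_smul b |preGrad hS hν f|, Lp.coeFn_smul a |preGrad hS hν g|,
      Lp.coeFn_abs (preGrad hS hν f), Lp.coeFn_abs (preGrad hS hν g)]
      with z h1 h2 h3 h4 h5 h6 h7 h8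
    rw [h3, h4, Pi.add_apply, h5, h6, Pi.smul_apply, Pi.smul_apply, h7, h8, h1, h2, smul_eq_mul,
      smul_eq_mul, Real.norm_eq_abs, Real.norm_eq_abs]
    refine le_trans ?_ (le_abs_self _)
    simp only [grad, abs_mul]
    have e : incr h.1 z = g.1 (jumpMap z) * incr f.1 z + f.1 z.1.1 * incr g.1 z := by
      simp only [incr, hh]; ring
    have h9 : |incr h.1 z| ≤ b * |incr f.1 z| + a * |incr g.1 z| := by
      rw [e]
      refine (abs_add_le _ _).trans ?_
      rw [abs_mul, abs_mul]
      exact add_le_add (mul_le_mul_of_nonneg_right (hg _) (abs_nonneg _))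
        (mul_le_mul_of_nonneg_right (hf _) (abs_nonneg _))
    refine (mul_le_mul_of_nonneg_right h9 (abs_nonneg _)).trans_eq ?_
    ring
  refine h1.trans ((norm_add_le _ _).trans_eq ?_)
  rw [norm_smul, norm_smul, norm_abs_eq_norm, norm_abs_eq_norm, Real.norm_of_nonneg ha,
    Real.norm_of_nonneg hb]

end Nest

/-! ### Density of functions carried by compact sets, and quasi-regularity -/

section QuasiRegular

variable {d : ℕ} {S : Set (Space d)} {ν : Config S → Space d → Space d → ℝ≥0}
  {μ : Measure (Config S)} {B : ℝ≥0∞}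

theorem aestronglyMeasurable_cutoff
    (hi : ∀ᵐ ξ ∂μ, Integrable (weight (d := d)) ξ.1) (n : ℕ) :
    AEStronglyMeasurable (fun ξ : Config S => cutoff weight n ξ) μ := by
  refine aestronglyMeasurable_of_tendsto_ae atTop
    (f := fun (R : ℕ) (ξ : Config S) => cutoff (cutMul weightMap R) n ξ) (fun R => ?_) ?_
  · exact (Real.smoothTransition.continuous.comp (continuous_const.sub
      ((continuous_pair (cutMul weightMap R)).div_const _))).aestronglyMeasurable
  · filter_upwards [hi] with ξ h
    exact tendsto_cutoff_cutMul h n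

theorem cutoff_eq_zero (hi : ∀ᵐ ξ ∂μ, Integrable (weight (d := d)) ξ.1) (hS : MeasurableSet S)
    (n : ℕ) : ∀ᵐ ξ ∂μ, ξ ∉ compactSet S n → cutoff weight n ξ = 0 := by
  filter_upwards [hi] with ξ h hξ
  have h1 : 2 * ((n : ℝ) + 1) < pair weight ξ := by
    by_contra! hle
    exact hξ (mem_compactSet hS h hle)
  refine Real.smoothTransition.zero_of_nonpos (sub_nonpos.2 ?_)
  exact (le_div_iff₀ (by positivity)).2 h1.le

variable [IsProbabilityMeasure μ] (hS : MeasurableSet S) (hν : Measurable (rate ν))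

theorem abs_clamp_le {a : ℝ} (ha : 0 ≤ a) (t : ℝ) : |max (-a) (min a t)| ≤ a :=
  abs_le.2 ⟨le_max_left _ _, max_le (by linarith) (min_le_left _ _)⟩

theorem abs_clamp_le_abs {a : ℝ} (ha : 0 ≤ a) (t : ℝ) : |max (-a) (min a t)| ≤ |t| := by
  refine abs_le.2 ⟨?_, max_le (by linarith [abs_nonneg t]) ((min_le_right _ _).trans (le_abs_self t))⟩
  refine le_max_of_le_right (le_min ?_ (neg_abs_le t))
  linarith [abs_nonneg t]

theorem clamp_of_abs_le {a t : ℝ} (h : |t| ≤ a) : max (-a) (min a t) = t := by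
  rw [min_eq_right (abs_le.1 h).2, max_eq_right (abs_le.1 h).1]

theorem lipschitzWith_max_min (a : ℝ) : LipschitzWith 1 fun t : ℝ => max (-a) (min a t) :=
  (LipschitzWith.id.const_min a).const_max (-a)

/-- The elements of the closed graph whose first component vanishes a.e. off some `compactSet S n`. -/
def nestGraph : Set (Lp ℝ 2 μ × Lp ℝ 2 (jumpMeasure μ)) :=
  {w | w ∈ formGraph hS hν ∧ ∃ n, ∀ᵐ ξ ∂μ, ξ ∉ compactSet S n → w.1 ξ = 0}

/-- The compact sets increase, so two elements vanish off a common one. Convexity is what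
`exists_mem_closure_of_norm_le` asks for. -/
theorem convex_nestGraph : Convex ℝ (nestGraph hS hν (μ := μ)) := by
  rintro w ⟨hw, n, hn⟩ w' ⟨hw', m, hm⟩ a b ha hb hab
  refine ⟨Submodule.convex _ hw hw' ha hb hab, max n m, ?_⟩
  filter_upwards [hn, hm, Lp.coeFn_add (a • w.1) (b • w'.1), Lp.coeFn_smul a w.1,
    Lp.coeFn_smul b w'.1] with ξ h1 h2 h3 h4 h5 hξ
  change (a • w.1 + b • w'.1 : Lp ℝ 2 μ) ξ = 0
  rw [h3, Pi.add_apply, h4, h5, Pi.smul_apply, Pi.smul_apply,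
    h1 fun h => hξ (monotone_compactSet S (le_max_left n m) h),
    h2 fun h => hξ (monotone_compactSet S (le_max_right n m) h)]
  simp

/-- Products with the truncated cut-offs lie in $\mathfrak D_\infty$ and converge in $L^2$ as `R`
grows, with bounded gradients. The limit vanishes off the compact set because the full cut-off does.
-/
theorem exists_mem_nestGraph (hi : ∀ᵐ ξ ∂μ, Integrable (weight (d := d)) ξ.1)
    {D : ℝ} (hD : 0 ≤ D) {n : ℕ} (hχ : ∀ R : ℕ, ∃ χ : preSub hS hν μ,
      χ.1 = cutoff (cutMul weightMap R) n ∧ ‖preGrad hS hν χ‖ ≤ D / (n + 1))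
    (g : preSub hS hν μ) (hg : ∀ ξ, |g.1 ξ| ≤ n + 2) :
    ∃ w ∈ nestGraph hS hν (μ := μ), (w.1 =ᵐ[μ] fun ξ => g.1 ξ * cutoff weight n ξ) ∧
      ‖w.2‖ ≤ ‖preGrad hS hν g‖ + 2 * D := by
  have hm : MemLp (fun ξ => g.1 ξ * cutoff weight n ξ) 2 μ := by
    refine MemLp.of_bound (g.2.2.1.1.mul (aestronglyMeasurable_cutoff hi n)) (n + 2)
      (ae_of_all _ fun ξ => ?_)
    rw [norm_mul]
    exact (mul_le_of_le_one_right (norm_nonneg _) (abs_cutoff_le_one _ _ _)).trans (hg ξ)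
  choose χ hχ1 hχ2 using hχ
  have hχ3 : ∀ R ξ, |(χ R).1 ξ| ≤ 1 := fun R ξ => by rw [hχ1]; exact abs_cutoff_le_one _ _ _
  let s : ℕ → preSub hS hν μ := fun R =>
    ⟨fun ξ => g.1 ξ * (χ R).1 ξ, mul_mem_preDomain hS hν g.2 (χ R).2 hg (hχ3 R)⟩
  have hs : Tendsto (fun R => preEmb hS hν (s R)) atTop (𝓝 (hm.toLp _)) := by
    refine tendsto_toLp_of_dominated hm (memLp_const (2 * ((n : ℝ) + 2))) (fun R => ?_) ?_
    · filter_upwards [coeFn_preEmb hS hν (s R)] with ξ h1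
      rw [h1]
      change |g.1 ξ * (χ R).1 ξ - g.1 ξ * cutoff weight n ξ| ≤ _
      rw [← mul_sub, abs_mul, mul_comm]
      refine mul_le_mul ?_ (hg ξ) (abs_nonneg _) (by norm_num)
      refine (abs_sub _ _).trans ?_
      linarith [hχ3 R ξ, abs_cutoff_le_one (weight (d := d)) n ξ]
    · filter_upwards [ae_all_iff.2 fun R => coeFn_preEmb hS hν (s R), hi] with ξ h1 h2
      simp_rw [h1]
      refine Tendsto.const_mul _ ?_
      simp_rw [hχ1]
      exact tendsto_cutoff_cutMul h2 n
  obtain ⟨v, hv, hvC⟩ := exists_of_bounded_approx hS hν (u := hm.toLp _)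
    (C := ‖preGrad hS hν g‖ + 2 * D) fun ε hε => by
      obtain ⟨R, hR⟩ := (Metric.tendsto_nhds.1 hs ε hε).exists
      rw [dist_eq_norm] at hR
      refine ⟨s R, hR.le, (norm_preGrad_mul_le hS hν hg (hχ3 R) fun ξ => rfl).trans ?_⟩
      rw [one_mul]
      -- The height of `g` grows no faster than the gradient of the cut-off decays, so the bound
      -- does not depend on `n`.
      have h1 : ((n : ℝ) + 2) * (D / (n + 1)) ≤ 2 * D := by
        rw [mul_div_assoc', div_le_iff₀ (by positivity)]
        nlinarith [n.cast_nonneg (α := ℝ)]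
      have h2 : ((n : ℝ) + 2) * ‖preGrad hS hν (χ R)‖ ≤ (n + 2) * (D / (n + 1)) :=
        mul_le_mul_of_nonneg_left (hχ2 R) (by positivity)
      linarith
  refine ⟨(hm.toLp _, v), ⟨hv, n, ?_⟩, hm.coeFn_toLp, hvC⟩
  filter_upwards [hm.coeFn_toLp, cutoff_eq_zero hi hS n] with ξ h1 h2 hξ
  change (hm.toLp _ : Lp ℝ 2 μ) ξ = 0
  rw [h1, h2 hξ, mul_zero]

/-- Truncate at height about `n`, cut off at level `n`, and let `n` grow: this converges to `f` in
$L^2$ with bounded gradients. Convex combinations converge in graph norm, and closability forces the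
limit gradient to be that of `f`. -/
theorem mem_closure_nestGraph (hB : EnergyBounded ν μ B) (hBt : B < ⊤) (hcl : IsClosable ν μ)
    (hi : ∀ᵐ ξ ∂μ, Integrable (weight (d := d)) ξ.1) (f : preSub hS hν μ) :
    (preEmb hS hν f, preGrad hS hν f) ∈ closure (nestGraph hS hν (μ := μ)) := by
  obtain ⟨D, hD, hχ⟩ := exists_cutoff_mem hS hν hB hBt
  have hn : ∀ n : ℕ, (0 : ℝ) < n + 1 := fun n => by positivity
  -- Clamping at height $n+1$ with smoothing error $1/(n+1)\le1$ gives the bound $n+2$.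
  choose g hg1 _ hg3 using fun n : ℕ => exists_contraction hS hν f (lipschitzWith_max_min (n + 1))
    (abs_clamp_le (hn n).le) (one_div_pos.2 (hn n))
  have hε : ∀ n : ℕ, 1 / ((n : ℝ) + 1) ≤ 1 := fun n => by
    rw [div_le_one (hn n)]; linarith [n.cast_nonneg (α := ℝ)]
  have hdec : ∀ n ξ, |(g n).1 ξ| ≤ |max (-((n : ℝ) + 1)) (min (n + 1) (f.1 ξ))| + 1 := fun n ξ => by
    have h1 := abs_add_le ((g n).1 ξ - max (-((n : ℝ) + 1)) (min (n + 1) (f.1 ξ)))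
      (max (-((n : ℝ) + 1)) (min (n + 1) (f.1 ξ)))
    rw [sub_add_cancel] at h1
    linarith [hg1 n ξ, hε n]
  have hgb : ∀ n ξ, |(g n).1 ξ| ≤ n + 2 := fun n ξ => by
    linarith [hdec n ξ, abs_clamp_le (hn n).le (f.1 ξ)]
  have hgf : ∀ n ξ, |(g n).1 ξ| ≤ |f.1 ξ| + 1 := fun n ξ => by
    linarith [hdec n ξ, abs_clamp_le_abs (hn n).le (f.1 ξ)]
  choose w hw1 hw2 hw3 using fun n => exists_mem_nestGraph hS hν hi hD (hχ n) (g n) (hgb n)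
  have hlim : Tendsto (fun n => (w n).1) atTop (𝓝 (preEmb hS hν f)) := by
    refine tendsto_toLp_of_dominated f.2.2.1 (G := fun ξ => |f.1 ξ| + 1 + |f.1 ξ|)
      ((f.2.2.1.abs.add (memLp_const 1)).add f.2.2.1.abs) (fun n => ?_) ?_
    · filter_upwards [hw2 n] with ξ h1
      rw [h1]
      refine (abs_sub _ _).trans (add_le_add ?_ le_rfl)
      rw [abs_mul]
      exact (mul_le_of_le_one_right (abs_nonneg _) (abs_cutoff_le_one _ _ _)).trans (hgf n ξ)
    · filter_upwards [ae_all_iff.2 hw2] with ξ h1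
      simp_rw [h1]
      have e1 : ∀ᶠ n : ℕ in atTop, cutoff weight n ξ = 1 := by
        filter_upwards [eventually_ge_atTop ⌈pair weight ξ⌉₊] with n h
        refine Real.smoothTransition.one_of_one_le ?_
        have : pair weight ξ / (n + 1) ≤ 1 :=
          (div_le_one (hn n)).2 (by linarith [Nat.ceil_le.1 h])
        linarith
      have e2 : Tendsto (fun n => (g n).1 ξ) atTop (𝓝 (f.1 ξ)) := by
        refine tendsto_iff_norm_sub_tendsto_zero.2 (squeeze_zero' (Eventually.of_forall fun n =>
          norm_nonneg _) ?_ tendsto_one_div_add_atTop_nhds_zero_nat)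
        filter_upwards [eventually_ge_atTop ⌈|f.1 ξ|⌉₊] with n h
        have h2 := hg1 n ξ
        rwa [clamp_of_abs_le (by linarith [Nat.ceil_le.1 h])] at h2
      refine e2.congr' ?_
      filter_upwards [e1] with n h
      rw [h, mul_one]
  obtain ⟨v, hv, -⟩ := exists_mem_closure_of_norm_le (convex_nestGraph hS hν (μ := μ))
    (u := preEmb hS hν f) (C := ‖preGrad hS hν f‖ + 2 * D) fun ε hε => by
      obtain ⟨n, h⟩ := (Metric.tendsto_nhds.1 hlim ε hε).exists
      rw [dist_eq_norm] at h
      exact ⟨w n, hw1 n, h.le, (hw3 n).trans (by linarith [hg3 n])⟩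
  have hv' : (preEmb hS hν f, v) ∈ formGraph hS hν (μ := μ) :=
    closure_minimal (fun p hp => hp.1) (isClosed_formGraph hS hν) hv
  have h0 : v - preGrad hS hν f = 0 := formGraph_snd_eq_zero hS hν hcl
    (Submodule.sub_mem _ hv' (mem_formGraph hS hν f)) (sub_self _)
  rwa [← sub_eq_zero.1 h0]

theorem isNest_compactSet (hSc : IsClosed S) (hB : EnergyBounded ν μ B) (hBt : B < ⊤)
    (hcl : IsClosable ν μ) (hi : ∀ᵐ ξ ∂μ, Integrable (weight (d := d)) ξ.1) :
    (closedForm hS hν (μ := μ)).IsNest (compactSet S) := by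
  refine ⟨monotone_compactSet S, fun n => (isCompact_range_enumConfig hSc _).isClosed,
    isDense_of_formGraph hS hν hcl fun f ε hε => ?_⟩
  obtain ⟨w, ⟨hw, hn⟩, hd⟩ :=
    Metric.mem_closure_iff.1 (mem_closure_nestGraph hS hν hB hBt hcl hi f) ε hε
  rw [Prod.dist_eq, max_lt_iff, dist_eq_norm, dist_eq_norm] at hd
  refine ⟨⟨w.1, mem_dom_of_mem_formGraph hS hν hw⟩, hn, hd.1, ?_⟩
  have hg : closedGrad hS hν ⟨w.1, mem_dom_of_mem_formGraph hS hν hw⟩ = w.2 :=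
    closedGrad_eq hS hν hcl hw
  rw [hg]
  exact hd.2

theorem lipschitzWith_arctan : LipschitzWith 1 Real.arctan := by
  refine lipschitzWith_of_nnnorm_deriv_le Real.differentiable_arctan fun x => ?_
  rw [← NNReal.coe_le_coe, coe_nnnorm, Real.deriv_arctan, NNReal.coe_one,
    Real.norm_of_nonneg (by positivity)]
  exact (div_le_one (by positivity)).2 (by linarith [sq_nonneg x])

theorem abs_arctan_le (x : ℝ) : |Real.arctan x| ≤ Real.pi / 2 :=
  abs_le.2 ⟨(Real.neg_pi_div_two_lt_arctan x).le, (Real.arctan_lt_pi_div_two x).le⟩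

/-- Elements of $\mathfrak D_\infty$ are their own quasi-continuous versions, being continuous on
each set of the compact nest. -/
theorem isQuasiRegularDirichlet_closedForm (hSc : IsClosed S) (hB : EnergyBounded ν μ B)
    (hBt : B < ⊤) (hcl : IsClosable ν μ)
    (hi : ∀ᵐ ξ ∂μ, Integrable (weight (d := d)) ξ.1) :
    (closedForm hS hν (μ := μ)).IsQuasiRegularDirichlet where
  isDirichlet := isDirichlet_closedForm hS hν hB hBt hcl
  compact_nest := ⟨compactSet S, isNest_compactSet hS hν hSc hB hBt hcl hi,
    fun n => isCompact_range_enumConfig hSc _⟩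
  dense_quasiContinuous := by
    refine ⟨range (domOf hS hν), isDense_range_domOf hS hν hcl, ?_⟩
    rintro _ ⟨f, rfl⟩
    exact ⟨f.1, ⟨compactSet S, isNest_compactSet hS hν hSc hB hBt hcl hi,
      fun n => f.2.1.continuousOn_range hSc _⟩, coeFn_preEmb hS hν f⟩
  separating := by
    obtain ⟨φ, hφ, hφi⟩ := exists_countable_smooth_inducing S
    -- The arctangent is smooth, bounded, Lipschitz and injective, so these functions belong to
    -- $\mathfrak D_\infty$ and separate all points. Being continuous everywhere, they need only the
    -- trivial nest and an empty exceptional set.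
    have hm : ∀ k, (fun ξ : Config S => Real.arctan (pair (φ k) ξ)) ∈ preDomain ν μ := fun k =>
      comp_pair_mem_preDomain hS hB hBt (hφ k) Real.contDiff_arctan lipschitzWith_arctan
        abs_arctan_le
    refine ⟨fun k => domOf hS hν ⟨_, hm k⟩, fun k ξ => Real.arctan (pair (φ k) ξ), ∅, fun k => ?_,
      ⟨_, L2Form.isNest_univ _, empty_subset _⟩, fun ξ _ η _ hne => ?_⟩
    · exact ⟨⟨_, L2Form.isNest_univ _, fun _ => (Real.continuous_arctan.comp
        (continuous_pair (φ k))).continuousOn⟩, coeFn_preEmb hS hν ⟨_, hm k⟩⟩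
    · by_contra! h
      exact hne (hφi.injective (funext fun k => Real.arctan_injective (h k)))

end QuasiRegular

end JumpForm

end

theorem theorem1 {d : ℕ} (hd : 0 < d) {S : Set (JumpForm.Space d)}
    (hS : IsClosed S) (h0 : (0 : JumpForm.Space d) ∈ S) (hSint : closure (interior S) = S)
    (ν : JumpForm.Config S → JumpForm.Space d → JumpForm.Space d → ℝ≥0)
    (hν : Measurable
      (fun z : JumpForm.Config S × JumpForm.Space d × JumpForm.Space d => ν z.1 z.2.1 z.2.2))
    (μ : Measure (JumpForm.Config S)) [IsProbabilityMeasure μ]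
    -- (A.1) closability
    (hA1 : JumpForm.IsClosable ν μ)
    -- (A.2) the density functions lie in `L^q` for some `1 < q ≤ ∞`
    (σ : ℕ → (n : ℕ) → (Fin n → JumpForm.Space d) → ℝ) (hσ : JumpForm.IsDensity μ σ)
    (q : ℝ≥0∞) (hq : 1 < q)
    (hA2 : ∀ r k : ℕ, 0 < r → MemLp (σ r k) q (volume.restrict (JumpForm.UPow S r k)))
    -- (B.0) the jump kernel is dominated by `C₁ p(|x - y|)`, with `p` locally bounded on `(0, ∞)`
    (C₁ : ℝ) (p : ℝ → ℝ)
    (hp : ∀ a b : ℝ, 0 < a → ∃ M : ℝ, ∀ r ∈ Set.Icc a b, |p r| ≤ M)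
    (hB0 : ∀ᵐ ξ ∂μ, ∀ᵐ x ∂ξ.1, ∀ᵐ y ∂(volume.restrict S), (ν ξ x y : ℝ) ≤ C₁ * p ‖x - y‖)
    -- (B.1) growth of the 1-correlation function
    (ρ : JumpForm.Space d → ℝ≥0) (hρ : JumpForm.IsCorrelation μ ρ) (κ : ℝ) (hκ : 0 ≤ κ)
    (hB1 : (fun x => (ρ x : ℝ)) =O[Bornology.cobounded (JumpForm.Space d) ⊓ 𝓟 S]
      (fun x => ‖x‖ ^ κ))
    -- (B.2) decay of `p` at infinity
    (α : ℝ) (hα : κ < α) (hB2 : p =O[atTop] (fun r => r ^ (-((d : ℝ) + α))))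
    -- (B.3) behaviour of `p` at zero
    (β : ℝ) (hβ0 : 0 < β) (hβ2 : β < 2) (hB3 : p =O[𝓝[>] 0] (fun r => r ^ (-((d : ℝ) + β))))
    -- (B.4) decay of the relative variance of the number of particles
    (δ : ℝ) (hδ : 0 < δ) (hL2 : ∀ r : ℕ, MemLp (JumpForm.count (S := S) r) 2 μ)
    (hB4 : (fun r : ℕ => ProbabilityTheory.variance (JumpForm.count (S := S) r) μ /
        (∫ ξ, JumpForm.count (S := S) r ξ ∂μ) ^ 2) =O[atTop] (fun r : ℕ => (r : ℝ) ^ (-δ))) :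
    ∃ F : JumpForm.L2Form μ, JumpForm.IsClosureForm ν μ F ∧ F.IsQuasiRegularDirichlet := by
  have hSm := hS.measurableSet
  obtain ⟨B, hBt, hB⟩ := JumpForm.exists_energy_bound hd hSm hp hB0 hρ hκ hB1 hα hB2 hβ0 hβ2 hB3 hL2
  exact ⟨JumpForm.closedForm hSm (JumpForm.measurable_rate hν),
    JumpForm.isClosureForm_closedForm hSm _ hA1,
    JumpForm.isQuasiRegularDirichlet_closedForm hSm _ hS hB hBt hA1
      (JumpForm.ae_integrable_weight
        (JumpForm.lintegral_rpow_lt_top hSm hρ hκ hB1 hL2 hα))⟩
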